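/- **Theorem 4.3.** Let $k$ be a field, $\prec$ a monomial order on the words in $x_1,\dots,x_n$ that refines the degree, and $\mathfrak a\subseteq\langle x_1,\dots,x_n\rangle\subset k\langle x_1,\dots,x_n\rangle$ a two-sided ideal that has a finite reduced Gröbner basis with respect to $\prec$. Put $A=k\langle x_1,\dots,x_n\rangle/\mathfrak a$, so that $k\cong A/\langle x_1,\dots,x_n\rangle$. Let $\mathcal G$ be the set of standard monomials of degree $\ge 1$, and $\mathrm{MinGen}$ the set of minimal monomial generators of the initial ideal of $\mathfrak a$. Every word $u$ has a unique Gröbner representation $u=a_1+\sum_{v\in\mathcal G}a_v v$ in $A$, with $a_1,a_v\in k$. *Bar resolution.* The normalized bar resolution of $k$ is the complex of free left $A$-modules with basis the cells $[w_1|\dots|w_l]$, $w_i\in\mathcal G$, in degree $l\ge 0$, and $$\partial[w_1|\dots|w_l]=w_1[w_2|\dots|w_l]+\sum_{j=1}^{l-1}(-1)^j\sum_{v\in\mathcal G}a_{j,v}\,[w_1|\dots|w_{j-1}|v|w_{j+2}|\dots|w_l],$$ where $w_jw_{j+1}=a_{j,1}+\sum_v a_{j,v}v$ is the Gröbner representation.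 Write $[c:c']$ for the coefficient of $c'$ in $\partial c$. Let $G$ be the directed graph on the cells with an edge $c\to c'$ whenever $[c:c']\ne0$. *Matching.* Let $B_0$ be the set of all cells. For $j\ge1$ let $\mathcal M_j$ be the set of the edges $[w_1|\dots|w_{j-1}|u_1|u_2|w_{j+1}|\dots|w_l]\to[w_1|\dots|w_{j-1}|u_1u_2|w_{j+1}|\dots|w_l]$ of $G$ between elements of $B_{j-1}$ such that $[w_1|\dots|w_{j-1}|v_1|v_2|w_{j+1}|\dots|w_l]\notin B_{j-1}$ for every proper prefix $v_1$ of $u_1$, where $v_1v_2=u_1u_2$ (for $j=1$ this means that $u_1$ is a letter). Let $B_j$ be the set of the elements of $B_{j-1}$ that lie in no edge of $\mathcal M_j$. Put $\mathcal M=\bigcup_j\mathcal M_j$. *Fully attached tuples.* These are the following cells: $[\,]$; the $[x_i]$ (with $x_i\in\mathcal G$); and, for $l\ge2$, the cells $[u_1|v_1w_1|v_2w_2|\dots|v_{l-1}w_{l-1}]$ (all entries in $\mathcal G$) such that $u_jv_jw_j\in\mathrm{MinGen}$ for $1\le j\le l-1$, $u_{j+1}=w_j$ for $1\le j\le l-2$,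 $|u_1|=1$, and $v_jw_jp\in\mathcal G$ for $1\le j\le l-2$ and every proper prefix $p$ of $v_{j+1}w_{j+1}$. Let $\mathcal B_l$ be the set of fully attached $l$-tuples. *Morse complex.* Let $G_{\mathcal M}$ be $G$ with the edges $c\to c'$ of $\mathcal M$ reversed. In $G_{\mathcal M}$ a reversed edge has weight $-[c:c']^{-1}$ and any other edge $c\to c'$ has weight $[c:c']$. The weight of a path is the ordered product of the weights of its edges. Let $F_l=\bigoplus_{e\in\mathcal B_l}A\,e$ and $\partial e=\sum_{f\in\mathcal B_{l-1}}\Gamma(e,f)\,f$ for $e\in\mathcal B_l$, where $\Gamma(e,f)$ is the sum of the weights of all paths from $e$ to $f$ in $G_{\mathcal M}$. *Reductions.* A cell $c'$ is an *inner face* of a cell $c$ if it arises by replacing two neighbours $w_j,w_{j+1}$ of $c$ by some $v\in\mathcal G$ whose coefficient in the Gröbner representation of $w_jw_{j+1}$ is nonzero ($w_jw_{j+1}$ itself may be standard). A *reduction of Type I* goes from $e_1$ to $e_2$ if $e_2$ is matched with an inner face $c'$ of $e_1$, that is, $(e_2\to c')\in\mathcal M$. A *reduction of Type II* goes from a cell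 to a fully attached inner face of it. We say that a reduction of Type II is *possible* if one applies to some cell that is obtained from a fully attached tuple by finitely many (possibly zero) reductions of Type I. *Anick resolutions.* An *Anick resolution* is an exact complex $\cdots\to F_2\to F_1\to F_0\to A/\langle x_1,\dots,x_n\rangle\to0$ on the modules $F_l$ above, ending in the canonical projection $F_0=A\to A/\langle x_1,\dots,x_n\rangle$, whose differential $d$ satisfies the following for every $e\in\mathcal B_l$, $l\ge1$. There are $s\in\mathcal G$ and $f\in\mathcal B_{l-1}$ such that $e=sf$ as words (a tuple being read as the product of its entries) and such that $d(e)-s\cdot f$ is a $k$-linear combination of terms $t\cdot g$, with $t\in\mathcal G\cup\{1\}$ and $g\in\mathcal B_{l-1}$, for which the word $tg$ is $\prec$ the word $e$. Then: 1. $\mathcal M$ is an acyclic matching: each cell lies in at most one edge of $\mathcal M$; $[c:c']$ is a central unit of $A$ for every edge $c\to c'$ of $\mathcal M$; and $G_{\mathcal M}$ has no directed cycles. The cells in no edge of $\mathcal M$ are exactly the fully attached tuples. For each $e\in\mathcal B_l$, $l\ge1$, there are only finitely many paths in $G_{\mathcal M}$ from $e$ to elements of $\mathcal B_{l-1}$.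 So $(F_\bullet,\partial)$ is well defined and is the Morse complex of $\mathcal M$. 2. $(F_\bullet,\partial)$ is an $A$-free resolution of $k\cong A/\langle x_1,\dots,x_n\rangle$. 3. $(F_\bullet,\partial)$ is an Anick resolution, and it is isomorphic, as a complex of $A$-modules and by an isomorphism that is the identity in degree $0$, to every Anick resolution. 4. If no reduction of Type II is possible, then $(F_\bullet,\partial)$ is minimal: $\partial(F_l)\subseteq\langle x_1,\dots,x_n\rangle F_{l-1}$ for all $l\ge1$. -/

import Mathlib

open scoped Classical

noncomputable section

namespace AnickMorse

/-! ### Words and polynomials in non-commuting indeterminates -/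

/-- Monomials in the non-commuting indeterminates `x_0, …, x_{n-1}`. -/
abbrev Word (n : ℕ) := FreeMonoid (Fin n)

/-- The free associative algebra `k⟨x_0, …, x_{n-1}⟩`, as the monoid algebra of the free monoid. -/
abbrev NCPoly (k : Type*) [Field k] (n : ℕ) := MonoidAlgebra k (Word n)

/-- `lt` is a (strict, total) monomial order on words that refines the degree. Over finitely many
letters such an order is automatically a well-order. -/
structure IsDegreeMonomialOrder {n : ℕ} (lt : Word n → Word n → Prop) : Prop where
  irrefl : ∀ u, ¬ lt u u
  trans : ∀ u v w, lt u v → lt v w → lt u w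
  total : ∀ u v, lt u v ∨ u = v ∨ lt v u
  mul : ∀ p u v q, lt u v → lt (p * u * q) (p * v * q)
  degree : ∀ u v, u.length < v.length → lt u v

/-- `m` divides `w` as a word, i.e. `m` is a contiguous subword of `w`. -/
def IsFactor {n : ℕ} (m w : Word n) : Prop := ∃ p q, w = p * m * q

/-- `p` is a prefix of `w` with `p ≠ w`. -/
def IsProperPrefix {n : ℕ} (p w : Word n) : Prop := ∃ r, r ≠ 1 ∧ p * r = w

section Algebra

variable {k : Type*} [Field k] {n : ℕ}

/-- `m` is the leading monomial of `f`. -/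
def IsLeadWord (lt : Word n → Word n → Prop) (f : NCPoly k n) (m : Word n) : Prop :=
  m ∈ f.coeff.support ∧ ∀ w ∈ f.coeff.support, w ≠ m → lt w m

variable (lt : Word n → Word n → Prop) (I : Ideal (NCPoly k n))

/-- The monomials of the initial ideal of `I`. -/
def initialWords : Set (Word n) := {w | ∃ f ∈ I, IsLeadWord lt f w}

/-- The minimal monomial generating system of the initial ideal of `I`. -/
def minGen : Set (Word n) :=
  {m | m ∈ initialWords lt I ∧ ∀ w ∈ initialWords lt I, IsFactor w m → w = m}

/-- The standard monomials of degree at least one. -/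
def stdWords : Set (Word n) := {w | w ∉ initialWords lt I ∧ w ≠ 1}

/-- `S` is a (finite) reduced Gröbner basis of the two-sided ideal `I`. -/
structure IsReducedGroebnerBasis (S : Finset (NCPoly k n)) : Prop where
  subset : ∀ f ∈ S, f ∈ I
  monic : ∀ f ∈ S, ∃ m, IsLeadWord lt f m ∧ f.coeff m = 1
  divides : ∀ w ∈ initialWords lt I, ∃ f ∈ S, ∃ m, IsLeadWord lt f m ∧ IsFactor m w
  reduced : ∀ f ∈ S, ∀ g ∈ S, f ≠ g → ∀ m, IsLeadWord lt g m →
    ∀ w ∈ f.coeff.support, ¬ IsFactor m w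

/-- The Gröbner representation of the word `u`: the combination of standard monomials
(the monomial `1` being allowed) that is congruent to `u` modulo `I`. It exists and is unique. -/
def normalForm (u : Word n) : NCPoly k n :=
  Classical.epsilon fun p : NCPoly k n =>
    (∀ w ∈ p.coeff.support, w ∉ initialWords lt I) ∧ MonoidAlgebra.of k (Word n) u - p ∈ I

/-- The class of a word in `A = k⟨x_0, …, x_{n-1}⟩ / I`. -/
def mon (u : Word n) : NCPoly k n ⧸ I := Submodule.Quotient.mk (MonoidAlgebra.of k (Word n) u)

end Algebra

/-! ### Algebraic discrete Morse theory -/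

section Morse

variable {R : Type*} [Ring R] {X : Type*}

/-- The edges of the graph `G_M`: the edges `c → c'` with `[c : c'] ≠ 0` that are not matched, and
the reversed matched edges. -/
def MorseEdge (wt : X → X → R) (M : X → X → Prop) (c c' : X) : Prop :=
  (wt c c' ≠ 0 ∧ ¬ M c c') ∨ M c' c

/-- `M` is an acyclic matching on the weighted graph with vertices `X` and weights
`wt c c' = [c : c']` (there is an edge `c → c'` if the weight is nonzero). -/
structure IsAcyclicMatching (wt : X → X → R) (M : X → X → Prop) : Prop where
  edge : ∀ c c', M c c' → wt c c' ≠ 0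
  matching : ∀ c c' d d', M c c' → M d d' →
    (c = d ∨ c = d' ∨ c' = d ∨ c' = d') → c = d ∧ c' = d'
  invertible : ∀ c c', M c c' → IsUnit (wt c c') ∧ wt c c' ∈ Subring.center R
  acyclic : ∀ c, ¬ Relation.TransGen (MorseEdge wt M) c c

/-- A vertex is critical if it does not lie in a matched edge. -/
def IsCritical (M : X → X → Prop) (c : X) : Prop := ∀ c', ¬ M c c' ∧ ¬ M c' c

/-- The weight of an edge of `G_M`; a reversed matched edge has weight `-1 / [c' : c]`. -/
def edgeWeight (wt : X → X → R) (M : X → X → Prop) (c c' : X) : R :=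
  if M c' c then - Ring.inverse (wt c' c) else wt c c'

/-- The weight of a path, the ordered product of the weights of its edges. -/
def pathWeight (wt : X → X → R) (M : X → X → Prop) : List X → R
  | c :: c' :: p => edgeWeight wt M c c' * pathWeight wt M (c' :: p)
  | _ => 1

/-- The list `p` of vertices is a directed path from `c` to `c'` in `G_M`. -/
def IsPath (wt : X → X → R) (M : X → X → Prop) (c c' : X) (p : List X) : Prop :=
  p.IsChain (MorseEdge wt M) ∧ p.head? = some c ∧ p.getLast? = some c'

/-- The sum of the weights of all paths from `c` to `c'` (meant for finitely many paths). -/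
def pathSum (wt : X → X → R) (M : X → X → Prop) (c c' : X) : R :=
  ∑ᶠ p ∈ {p | IsPath wt M c c' p}, pathWeight wt M p

end Morse

/-! ### The normalized bar resolution and the matching on it -/

section Bar

variable {k : Type*} [Field k] {n : ℕ} (lt : Word n → Word n → Prop) (I : Ideal (NCPoly k n))

/-- The basis elements `[w_1 | … | w_l]` of the normalized bar resolution, where `w_1, …, w_l` are
standard monomials of degree at least one; the homological degree is the length `l`. -/
def Cell := {c : List (Word n) // ∀ w ∈ c, w ∈ stdWords lt I}

/-- `[… | w_{j+1} | w_{j+2} | …] ↦ w_{j+1} w_{j+2}`, where `j` counts from `0`. -/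
def prodAt (c : List (Word n)) (j : ℕ) : Word n := c.getD j 1 * c.getD (j + 1) 1

/-- `[… | w_j | w_{j+1} | w_{j+2} | w_{j+3} | …] ↦ [… | w_j | v | w_{j+3} | …]`. -/
def face (c : List (Word n)) (j : ℕ) (v : Word n) : List (Word n) :=
  c.take j ++ v :: c.drop (j + 2)

/-- The differential of the normalized bar resolution of `k` on basis elements:
`∂[w_1|…|w_l] = w_1 [w_2|…|w_l] + ∑_{j=1}^{l-1} (-1)^j ∑_v a_{j,v} [w_1|…|w_{j-1}|v|w_{j+2}|…|w_l]`
where `w_j w_{j+1} = a_{j,1} + ∑_v a_{j,v} v` is the Gröbner representation. -/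
def barBoundary [I.IsTwoSided] : List (Word n) → (List (Word n) →₀ (NCPoly k n ⧸ I))
  | [] => 0
  | w :: c => Finsupp.single c (mon I w) +
      ∑ j ∈ Finset.range c.length,
        ∑ v ∈ (normalForm lt I (prodAt (w :: c) j)).coeff.support.filter (fun v => v ≠ 1),
          Finsupp.single (face (w :: c) j v)
            (algebraMap k (NCPoly k n ⧸ I)
              ((-1) ^ (j + 1) * (normalForm lt I (prodAt (w :: c) j)).coeff v))

/-- The coefficient `[c : c']` of `c'` in `∂ c`. -/
def barWeight [I.IsTwoSided] (c c' : Cell lt I) : NCPoly k n ⧸ I := barBoundary lt I c.1 c'.1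

/-- Given the set `B` of cells that are left over by the matchings at the first `j` coordinates,
this is the matching at the next coordinate: an edge
`[w_1|…|w_j|u_1|u_2|…] → [w_1|…|w_j|u_1 u_2|…]` between cells in `B` such that
`[w_1|…|w_j|v_1|v_2|…] ∉ B` whenever `v_1 v_2 = u_1 u_2` and `v_1` is a proper prefix of `u_1`.
(For `j = 0` and `B` the set of all cells this says that `u_1` is a letter.) -/
def MatchAt [I.IsTwoSided] (B : Set (Cell lt I)) (j : ℕ) (c c' : Cell lt I) : Prop :=
  c ∈ B ∧ c' ∈ B ∧ barWeight lt I c c' ≠ 0 ∧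
    ∃ (p q : List (Word n)) (u₁ u₂ : Word n), p.length = j ∧
      c.1 = p ++ u₁ :: u₂ :: q ∧ c'.1 = p ++ (u₁ * u₂) :: q ∧
      ∀ v₁ v₂, IsProperPrefix v₁ u₁ → v₁ * v₂ = u₁ * u₂ →
        ∀ b ∈ B, b.1 ≠ p ++ v₁ :: v₂ :: q

/-- The cells that are left over by the matchings at the first `j` coordinates. -/
def critAfter [I.IsTwoSided] : ℕ → Set (Cell lt I)
  | 0 => Set.univ
  | j + 1 => {c | c ∈ critAfter j ∧
      ∀ c', ¬ MatchAt lt I (critAfter j) j c c' ∧ ¬ MatchAt lt I (critAfter j) j c' c}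

/-- The matching on the normalized bar resolution: the union of the matchings at all coordinates. -/
def barMatching [I.IsTwoSided] (c c' : Cell lt I) : Prop :=
  ∃ j, MatchAt lt I (critAfter lt I j) j c c'

/-! ### Fully attached tuples -/

/-- Fully attached tuples: the empty tuple, the tuples `[x_i]`, and the tuples
`[u_0, v_0 w_0, v_1 w_1, …, v_{r-1} w_{r-1}]` with `r ≥ 1`, `u_j v_j w_j ∈ MinGen(in(I))`,
`u_{j+1} = w_j`, `|u_0| = 1`, such that `v_j w_j p` is standard for every proper prefix `p` of
`v_{j+1} w_{j+1}`. (It is applied to tuples of standard monomials of degree at least one only.) -/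
def IsFullyAttached (c : List (Word n)) : Prop :=
  c = [] ∨ (∃ i : Fin n, c = [FreeMonoid.of i]) ∨
    ∃ (r : ℕ) (u v w : ℕ → Word n), 1 ≤ r ∧
      (∀ j < r, u j * v j * w j ∈ minGen lt I) ∧
      (∀ j, j + 1 < r → u (j + 1) = w j) ∧
      (u 0).length = 1 ∧
      (∀ j, j + 1 < r → ∀ p, IsProperPrefix p (v (j + 1) * w (j + 1)) →
        v j * w j * p ∈ stdWords lt I) ∧
      c = u 0 :: (List.range r).map (fun j => v j * w j)

/-- The fully attached `l`-tuples of standard monomials of degree at least one. -/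
def Chain (l : ℕ) := {c : Cell lt I // IsFullyAttached lt I c.1 ∧ c.1.length = l}

/-- The word `w_1 w_2 ⋯ w_l` underlying `[w_1, …, w_l]`. -/
def Chain.word {lt : Word n → Word n → Prop} {I : Ideal (NCPoly k n)} {l : ℕ}
    (e : Chain lt I l) : Word n := e.1.1.prod

/-! ### Complexes of free modules on the fully attached tuples -/

/-- The left ideal of `A` generated by `x_0, …, x_{n-1}` (it is two-sided). -/
def augIdeal [I.IsTwoSided] : Ideal (NCPoly k n ⧸ I) :=
  Ideal.span (Set.range fun i : Fin n => mon I (FreeMonoid.of i))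

/-- The free left `A`-module `F_l` with the fully attached `l`-tuples as its basis. -/
abbrev FreeMod [I.IsTwoSided] (l : ℕ) := Chain lt I l →₀ (NCPoly k n ⧸ I)

/-- A sequence of `A`-linear maps `F_{l+1} → F_l`. -/
abbrev Differential [I.IsTwoSided] := ∀ l : ℕ, FreeMod lt I (l + 1) →ₗ[NCPoly k n ⧸ I] FreeMod lt I l

/-- The augmentation of `F_0 = A` to the residue class field `A / ⟨x_0, …, x_{n-1}⟩`. -/
def augmentation [I.IsTwoSided] :
    FreeMod lt I 0 →ₗ[NCPoly k n ⧸ I] ((NCPoly k n ⧸ I) ⧸ augIdeal I) :=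
  Finsupp.linearCombination (NCPoly k n ⧸ I) fun _ => Submodule.Quotient.mk 1

/-- `⋯ → F_2 → F_1 → F_0 → A / ⟨x_0, …, x_{n-1}⟩ → 0` is exact. -/
structure IsResolution [I.IsTwoSided] (d : Differential lt I) : Prop where
  surjective : Function.Surjective (augmentation lt I)
  exact_zero : Function.Exact (d 0) (augmentation lt I)
  exact_succ : ∀ l, Function.Exact (d (l + 1)) (d l)

/-- All the coefficients of the differential lie in the ideal `⟨x_0, …, x_{n-1}⟩`. -/
def IsMinimal [I.IsTwoSided] (d : Differential lt I) : Prop :=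
  ∀ l (x : FreeMod lt I (l + 1)) (f : Chain lt I l), d l x f ∈ augIdeal I

/-- The shape of the differential in the Anick resolution: `d e = s f + (lower terms)`, where
`s` is a standard monomial with `e = s f` as words, and the lower terms are `k`-linear combinations
of terms `t g`, with `t` a standard monomial (possibly `1`) and with the word `t g` smaller
than `e`. -/
def HasAnickLeadingTerms [I.IsTwoSided] (d : Differential lt I) : Prop :=
  ∀ l (e : Chain lt I (l + 1)), ∃ (s : Word n) (f : Chain lt I l),
    s ∈ stdWords lt I ∧ s * f.word = e.word ∧
    d l (Finsupp.single e 1) - Finsupp.single f (mon I s) ∈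
      Submodule.span k {y : FreeMod lt I l | ∃ (t : Word n) (g : Chain lt I l),
        t ∉ initialWords lt I ∧ lt (t * g.word) e.word ∧ y = Finsupp.single g (mon I t)}

/-- The Anick resolution: a free resolution of the residue class field on the fully attached tuples
(the Anick chains) whose differential has the leading terms prescribed by Anick. -/
structure IsAnickResolution [I.IsTwoSided] (d : Differential lt I) : Prop where
  resolution : IsResolution lt I d
  leading : HasAnickLeadingTerms lt I d

/-- The differential of the Morse complex of the normalized bar resolution, on the fully attached
tuples: `e ↦ ∑_f Γ(e, f) f`, where `Γ(e, f)` is the sum of the weights of all paths. -/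
def morseDifferential [I.IsTwoSided] : Differential lt I := fun l =>
  Finsupp.linearCombination (NCPoly k n ⧸ I) fun e : Chain lt I (l + 1) =>
    ∑ᶠ f : Chain lt I l,
      Finsupp.single f (pathSum (barWeight lt I) (barMatching lt I) e.1 f.1)

/-! ### Reductions -/

/-- `c'` arises from `c` by replacing two neighbours `w_j, w_{j+1}` by a standard monomial of degree
at least one that occurs in the Gröbner representation of `w_j w_{j+1}`. -/
def MergesTo (c c' : Cell lt I) : Prop :=
  ∃ (j : ℕ) (v : Word n), j + 1 < c.1.length ∧ v ≠ 1 ∧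
    (normalForm lt I (prodAt c.1 j)).coeff v ≠ 0 ∧ c'.1 = face c.1 j v

/-- Reduction of Type I: `w_j, w_{j+1}` is replaced by a monomial in the Gröbner representation of
`w_j w_{j+1}`, and the resulting cell `c'` by the cell that is matched with `c'` from above. -/
def ReducesTypeI [I.IsTwoSided] (e₁ e₂ : Cell lt I) : Prop :=
  ∃ c', MergesTo lt I e₁ c' ∧ barMatching lt I e₂ c'

/-- Reduction of Type II: `w_j, w_{j+1}` is replaced by a monomial in the Gröbner representation of
`w_j w_{j+1}`, and the result is fully attached. -/
def ReducesTypeII (e₁ e₂ : Cell lt I) : Prop :=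
  MergesTo lt I e₁ e₂ ∧ IsFullyAttached lt I e₂.1

/-- Some fully attached tuple can be reduced, by reductions of Type I, to a tuple to which a
reduction of Type II can be applied. -/
def TypeIIPossible [I.IsTwoSided] : Prop :=
  ∃ e e' f : Cell lt I, IsFullyAttached lt I e.1 ∧
    Relation.ReflTransGen (ReducesTypeI lt I) e e' ∧ ReducesTypeII lt I e' f

end Bar

end AnickMorse

end

set_option linter.unusedSectionVars false

noncomputable section

open scoped Classical

namespace AnickMorse

/-! Since the order refines the degree, each word has finitely many predecessors, so arguments along
the order become inductions on the `rank` in ℕ. The standard monomials form a k-basis of A; hence a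
free module on words-bearing generators has the k-basis of terms t·g, and each term has a word tg.

Matching: read a cell from the left. An entry is a minimal overlap if it is shortest among its
prefixes with a non-standard product with its predecessor (for the first entry: a letter). Look at
the first entry that is not one. If it is an overlap, it can be split after a minimal one; if it is
no overlap, it can be merged with its predecessor. These operations are inverse to each other and
are the matching (`critAfter_iff`, `barMatching_iff`). The cells left over are the chains of minimal
overlaps, that is, the fully attached tuples (`isFullyAttached_iff`). A `potential` made of the
word, the length of the initial chain and the degree drops along every edge of G_M; this excludes
cycles and makes the paths from a cell finite in number.

Morse complex: the path sums define a linear map `morseProj` on the bar complex. It kills the upper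
cells and their boundaries and is the identity on critical cells of its degree. Upper cells, their
boundaries and critical cells generate everything (`triangularSpan_eq_top`), so the projection is a
chain map (`morseProj_bd`).

Leading terms: describe tuples by cut positions in a fixed word. Fully attached tuples are the left
greedy sequences; a right greedy sequence with the same ends interlaces with each of them. Removing
its first position and making the rest left greedy again yields the chain f with e = sf. Extremality
of greedy sequences shows that a word has at most one suffix that is a chain with l entries
(`Chain.suffix_unique`). In the boundary of e only the outer face has the full word. Its positions
are moved one at a time to those of f, each move being a boundary modulo smaller words
(`morseProj_posTerm_mixed_sub_mem_fil`).

Exactness and uniqueness need the leading terms only. If t·g is the top term of a cycle and s·f the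
leading term of dg, then ts is not standard. So the right greedy sequence of g extends to the left
inside t (`exists_extension`), and t·g is the leading term of a boundary. Induction on the rank
gives preimages with no larger words (`HasAnickLeadingTerms.exists_preimage`). This control of words
lifts the identity in degree 0 to comparison maps of the form identity plus smaller words, which are
bijective.

Minimality is read modulo the augmentation ideal: outer faces vanish there, and a path through inner
faces is a series of reductions of Type I closed by one of Type II. -/

/-- The standing assumptions: `lt` is a monomial order refining the degree, and the ideal `I` is
contained in the ideal generated by the letters. -/
class Setting {k : Type*} [Field k] {n : ℕ} (lt : Word n → Word n → Prop)
    (I : Ideal (NCPoly k n)) : Prop where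
  order : IsDegreeMonomialOrder lt
  aug : ∀ p ∈ I, p.coeff 1 = 0

/-! ### The monomial order, embedded into ℕ by ranks. -/

section Order

variable {n : ℕ} {lt : Word n → Word n → Prop}

namespace IsDegreeMonomialOrder

lemma length_le (h : IsDegreeMonomialOrder lt) {u v : Word n} (huv : lt u v) :
    u.length ≤ v.length := by
  by_contra hc
  exact h.irrefl _ (h.trans _ _ _ huv (h.degree _ _ (not_le.1 hc)))

/-- Smaller words are no longer, and there are finitely many words of bounded length. Without this
finiteness `rank` would take the junk value 0. -/
lemma finite_lt (h : IsDegreeMonomialOrder lt) (w : Word n) : {v | lt v w}.Finite :=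
  (List.finite_length_le (Fin n) w.length).subset fun _ hv => h.length_le hv

end IsDegreeMonomialOrder

/-- The number of words that are smaller than `w`. -/
def rank (lt : Word n → Word n → Prop) (w : Word n) : ℕ := {v | lt v w}.ncard

lemma rank_lt_of_lt (h : IsDegreeMonomialOrder lt) {u v : Word n} (huv : lt u v) :
    rank lt u < rank lt v := by
  refine Set.ncard_lt_ncard ⟨fun w hw => h.trans _ _ _ hw huv, fun hs => ?_⟩ (h.finite_lt v)
  exact h.irrefl _ (hs huv)

lemma rank_lt_iff (h : IsDegreeMonomialOrder lt) {u v : Word n} :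
    rank lt u < rank lt v ↔ lt u v := by
  refine ⟨fun hr => ?_, rank_lt_of_lt h⟩
  rcases h.total u v with h1 | rfl | h1
  · exact h1
  · exact absurd hr (lt_irrefl _)
  · exact absurd (rank_lt_of_lt h h1) (lt_asymm hr)

lemma rank_inj (h : IsDegreeMonomialOrder lt) {u v : Word n} (hr : rank lt u = rank lt v) :
    u = v := by
  rcases h.total u v with h1 | h1 | h1
  · exact absurd (rank_lt_of_lt h h1) (by omega)
  · exact h1
  · exact absurd (rank_lt_of_lt h h1) (by omega)

lemma rank_lt_mul (h : IsDegreeMonomialOrder lt) (p q : Word n) {u v : Word n}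
    (hr : rank lt u < rank lt v) : rank lt (p * u * q) < rank lt (p * v * q) :=
  rank_lt_of_lt h (h.mul _ _ _ _ ((rank_lt_iff h).1 hr))

lemma rank_mul_left_lt (h : IsDegreeMonomialOrder lt) (p : Word n) {u v : Word n}
    (hr : rank lt u < rank lt v) : rank lt (p * u) < rank lt (p * v) := by
  simpa using rank_lt_mul h p 1 hr

lemma rank_mul_right_lt (h : IsDegreeMonomialOrder lt) (q : Word n) {u v : Word n}
    (hr : rank lt u < rank lt v) : rank lt (u * q) < rank lt (v * q) := by
  simpa using rank_lt_mul h 1 q hr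

lemma rank_mul_right_le (h : IsDegreeMonomialOrder lt) (q : Word n) {u v : Word n}
    (hr : rank lt u ≤ rank lt v) : rank lt (u * q) ≤ rank lt (v * q) := by
  rcases hr.eq_or_lt with h1 | h1
  · rw [rank_inj h h1]
  · exact (rank_mul_right_lt h q h1).le

lemma rank_mul_left_le (h : IsDegreeMonomialOrder lt) (p : Word n) {u v : Word n}
    (hr : rank lt u ≤ rank lt v) : rank lt (p * u) ≤ rank lt (p * v) := by
  rcases hr.eq_or_lt with h1 | h1
  · rw [rank_inj h h1]
  · exact (rank_mul_left_lt h p h1).le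

lemma rank_lt_of_length_lt (h : IsDegreeMonomialOrder lt) {u v : Word n}
    (hr : u.length < v.length) : rank lt u < rank lt v :=
  rank_lt_of_lt h (h.degree _ _ hr)

lemma length_pos_of_ne_one {w : Word n} (h : w ≠ 1) : 0 < w.length := by
  rcases Nat.eq_zero_or_pos w.length with h0 | h0
  · exact absurd (FreeMonoid.length_eq_zero.1 h0) h
  · exact h0

end Order

/-! ### Gröbner representations and the quotient algebra. -/

section Algebra

variable {k : Type*} [Field k] {n : ℕ} {lt : Word n → Word n → Prop} {I : Ideal (NCPoly k n)}

lemma exists_isLeadWord (h : IsDegreeMonomialOrder lt) {f : NCPoly k n} (hf : f ≠ 0) :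
    ∃ m, IsLeadWord lt f m := by
  have hne : f.coeff.support.Nonempty := by
    rw [Finset.nonempty_iff_ne_empty]
    simpa using hf
  obtain ⟨m, hm, hmax⟩ := Finset.exists_max_image f.coeff.support (rank lt) hne
  refine ⟨m, hm, fun w hw hwm => (rank_lt_iff h).1 (lt_of_le_of_ne (hmax w hw) fun he => ?_)⟩
  exact hwm (rank_inj h he)

section Ideal

variable [I.IsTwoSided]

lemma mul_mem_initialWords (h : IsDegreeMonomialOrder lt) {w : Word n}
    (hw : w ∈ initialWords lt I) (p q : Word n) : p * w * q ∈ initialWords lt I := by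
  obtain ⟨f, hf, hsup, hlead⟩ := hw
  have hs : (MonoidAlgebra.single p (1 : k) * f * MonoidAlgebra.single q 1).coeff.support =
      (f.coeff.support.map (mulLeftEmbedding p)).map (mulRightEmbedding q) := by
    rw [MonoidAlgebra.support_coeff_mul_single _ _ (by simp),
      MonoidAlgebra.support_coeff_single_mul _ _ (by simp)]
  refine ⟨_, Ideal.mul_mem_right (MonoidAlgebra.single q 1) _
    (Ideal.mul_mem_left _ (MonoidAlgebra.single p 1) hf), ?_, ?_⟩
  · rw [hs]
    simpa using hsup
  · intro v hv hne
    rw [hs] at hv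
    simp only [Finset.mem_map, mulLeftEmbedding_apply, mulRightEmbedding_apply] at hv
    obtain ⟨_, ⟨v, hv, rfl⟩, rfl⟩ := hv
    exact h.mul _ _ _ _ (hlead v hv fun he => hne (by rw [he]))

variable [Setting lt I]

lemma Setting.ord (lt : Word n → Word n → Prop) (I : Ideal (NCPoly k n)) [Setting lt I] :
    IsDegreeMonomialOrder lt := Setting.order (lt := lt) (I := I)

lemma mul_left_mem_initialWords {w : Word n} (p : Word n)
    (hw : w ∈ initialWords lt I) : p * w ∈ initialWords lt I := by
  simpa using mul_mem_initialWords (Setting.ord lt I) hw p 1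

lemma mul_right_mem_initialWords {w : Word n} (q : Word n)
    (hw : w ∈ initialWords lt I) : w * q ∈ initialWords lt I := by
  simpa using mul_mem_initialWords (Setting.ord lt I) hw 1 q

lemma one_notMem_initialWords : (1 : Word n) ∉ initialWords lt I := by
  rintro ⟨f, hf, hsup, -⟩
  exact (Finsupp.mem_support_iff.1 hsup) (Setting.aug lt f hf)

lemma stdWords_of_mul {p w q : Word n} (h : p * w * q ∉ initialWords lt I) (hw : w ≠ 1) :
    w ∈ stdWords lt I :=
  ⟨fun h' => h (mul_mem_initialWords (Setting.ord lt I) h' p q), hw⟩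

/-- The monomials in `p` are standard. -/
def IsStdPoly (lt : Word n → Word n → Prop) (I : Ideal (NCPoly k n)) (p : NCPoly k n) : Prop :=
  ∀ w ∈ p.coeff.support, w ∉ initialWords lt I

/-- Otherwise the leading word of the difference would be an initial word, although it occurs in p
or in q. -/
lemma IsStdPoly.eq_of_sub_mem {p q : NCPoly k n} (hp : IsStdPoly lt I p) (hq : IsStdPoly lt I q)
    (h : p - q ∈ I) : p = q := by
  by_contra hne
  obtain ⟨m, hm⟩ := exists_isLeadWord (Setting.ord lt I) (sub_ne_zero.2 hne)
  have hm' : m ∈ initialWords lt I := ⟨_, h, hm⟩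
  have h0 : ∀ r : NCPoly k n, IsStdPoly lt I r → r.coeff m = 0 := fun r hr => by
    by_contra hc
    exact hr m (Finsupp.mem_support_iff.2 hc) hm'
  have := Finsupp.mem_support_iff.1 hm.1
  rw [MonoidAlgebra.coeff_sub, Finsupp.sub_apply, h0 p hp, h0 q hq] at this
  exact this (sub_zero 0)

lemma IsStdPoly.add {p q : NCPoly k n} (hp : IsStdPoly lt I p) (hq : IsStdPoly lt I q) :
    IsStdPoly lt I (p + q) := by
  intro w hw
  rcases Finset.mem_union.1 (Finsupp.support_add hw) with h | h
  exacts [hp w h, hq w h]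

lemma IsStdPoly.smul {p : NCPoly k n} (hp : IsStdPoly lt I p) (c : k) :
    IsStdPoly lt I (c • p) :=
  fun w hw => hp w (Finsupp.support_smul hw)

lemma IsStdPoly.zero : IsStdPoly lt I (0 : NCPoly k n) := fun w hw => by simp at hw

lemma isStdPoly_of {u : Word n} (hu : u ∉ initialWords lt I) :
    IsStdPoly lt I (MonoidAlgebra.of k (Word n) u) := by
  intro w hw
  have := Finsupp.support_single_subset hw
  rw [Finset.mem_singleton.1 this]
  exact hu

/-- Division with remainder: an element of the ideal with leading word u rewrites u by smaller
words, to which induction on the rank applies. The rank bound is carried along because all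
filtration arguments rest on it. -/
lemma exists_normalForm (u : Word n) : ∃ p : NCPoly k n, IsStdPoly lt I p ∧
    MonoidAlgebra.of k (Word n) u - p ∈ I ∧ ∀ w ∈ p.coeff.support, rank lt w ≤ rank lt u := by
  induction hr : rank lt u using Nat.strong_induction_on generalizing u with
  | _ r ih =>
    subst hr
    by_cases hu : u ∈ initialWords lt I
    · obtain ⟨f, hf, hsup, hlead⟩ := hu
      -- A combination of words smaller than u is reduced summand by summand.
      have key : ∀ s : Finset (Word n), (∀ w ∈ s, rank lt w < rank lt u) → ∀ g : Word n → k,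
          ∃ p : NCPoly k n, IsStdPoly lt I p ∧
            ∑ w ∈ s, g w • MonoidAlgebra.of k (Word n) w - p ∈ I ∧
            ∀ w ∈ p.coeff.support, rank lt w ≤ rank lt u := by
        intro s hs g
        induction s using Finset.induction_on with
        | empty => exact ⟨0, .zero, by simp, by simp⟩
        | insert a s ha ihs =>
          obtain ⟨p, hp1, hp2, hp3⟩ := ihs fun w hw => hs w (Finset.mem_insert_of_mem hw)
          have hau := hs a (Finset.mem_insert_self _ _)
          obtain ⟨q, hq1, hq2, hq3⟩ := ih _ hau a rfl
          refine ⟨g a • q + p, (hq1.smul _).add hp1, ?_, ?_⟩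
          · rw [Finset.sum_insert ha, add_sub_add_comm, ← smul_sub]
            exact I.add_mem (Submodule.smul_of_tower_mem I _ hq2) hp2
          · intro w hw
            rcases Finset.mem_union.1 (Finsupp.support_add hw) with h | h
            · exact (hq3 w (Finsupp.support_smul h)).trans hau.le
            · exact hp3 w h
      obtain ⟨p, hp1, hp2, hp3⟩ := key (f.coeff.support.erase u)
        (fun w hw => (rank_lt_of_lt (Setting.ord lt I)
          (hlead w (Finset.mem_of_mem_erase hw) (Finset.ne_of_mem_erase hw))))
        -- These coefficients arise by solving f ≡ 0 for the word u.
        (fun w => -(f.coeff u)⁻¹ * f.coeff w)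
      refine ⟨p, hp1, ?_, hp3⟩
      have hfu := Finsupp.mem_support_iff.1 hsup
      have hexp : f = f.coeff u • MonoidAlgebra.of k (Word n) u +
          ∑ w ∈ f.coeff.support.erase u, f.coeff w • MonoidAlgebra.of k (Word n) w := by
        rw [Finset.add_sum_erase _ (fun w => f.coeff w • MonoidAlgebra.of k (Word n) w) hsup]
        conv_lhs => rw [← MonoidAlgebra.sum_coeff_single f]
        simp [Finsupp.sum, MonoidAlgebra.of]
      have h2 : MonoidAlgebra.of k (Word n) u - p = (f.coeff u)⁻¹ • f +
          (∑ w ∈ f.coeff.support.erase u, (-(f.coeff u)⁻¹ * f.coeff w) •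
            MonoidAlgebra.of k (Word n) w - p) := by
        have h3 : (f.coeff u)⁻¹ • f = MonoidAlgebra.of k (Word n) u + (f.coeff u)⁻¹ •
            ∑ w ∈ f.coeff.support.erase u, f.coeff w • MonoidAlgebra.of k (Word n) w := by
          rw [← inv_smul_smul₀ hfu (MonoidAlgebra.of k (Word n) u), ← smul_add, ← hexp]
        rw [h3, Finset.smul_sum]
        simp only [neg_mul, neg_smul, Finset.sum_neg_distrib, mul_smul]
        abel
      rw [h2]
      exact I.add_mem (Submodule.smul_of_tower_mem I _ hf) hp2
    · refine ⟨_, isStdPoly_of hu, by simp, fun w hw => ?_⟩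
      rw [Finset.mem_singleton.1 (Finsupp.support_single_subset hw)]

lemma normalForm_spec (u : Word n) : IsStdPoly lt I (normalForm lt I u) ∧
    MonoidAlgebra.of k (Word n) u - normalForm lt I u ∈ I := by
  obtain ⟨p, h1, h2, -⟩ := exists_normalForm (I := I) (lt := lt) u
  exact Classical.epsilon_spec (p := fun p : NCPoly k n =>
    (∀ w ∈ p.coeff.support, w ∉ initialWords lt I) ∧ MonoidAlgebra.of k (Word n) u - p ∈ I)
    ⟨p, h1, h2⟩

lemma normalForm_eq {u : Word n} {p : NCPoly k n} (hp : IsStdPoly lt I p)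
    (h : MonoidAlgebra.of k (Word n) u - p ∈ I) : normalForm lt I u = p := by
  refine (normalForm_spec u).1.eq_of_sub_mem hp ?_
  have := I.sub_mem h (normalForm_spec (lt := lt) u).2
  simpa using this

lemma normalForm_of_std {u : Word n} (hu : u ∉ initialWords lt I) :
    normalForm lt I u = MonoidAlgebra.of k (Word n) u :=
  normalForm_eq (isStdPoly_of hu) (by simp)

lemma rank_le_of_mem_normalForm {u w : Word n} (hw : (normalForm lt I u).coeff w ≠ 0) :
    rank lt w ≤ rank lt u := by
  obtain ⟨p, h1, h2, h3⟩ := exists_normalForm (I := I) (lt := lt) u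
  rw [normalForm_eq h1 h2] at hw
  exact h3 w (Finsupp.mem_support_iff.2 hw)

lemma notMem_of_mem_normalForm {u w : Word n} (hw : (normalForm lt I u).coeff w ≠ 0) :
    w ∉ initialWords lt I :=
  (normalForm_spec u).1 w (Finsupp.mem_support_iff.2 hw)

/-! ### The quotient algebra and its basis of standard monomials -/

lemma exists_stdPoly (a : NCPoly k n ⧸ I) : ∃ q : NCPoly k n, IsStdPoly lt I q ∧
    (Submodule.Quotient.mk q : NCPoly k n ⧸ I) = a := by
  obtain ⟨p, rfl⟩ := Submodule.Quotient.mk_surjective _ a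
  induction p using MonoidAlgebra.induction_linear with
  | zero => exact ⟨0, .zero, rfl⟩
  | add p q hp hq =>
    obtain ⟨p', h1, h2⟩ := hp
    obtain ⟨q', h3, h4⟩ := hq
    exact ⟨p' + q', h1.add h3, by rw [Submodule.Quotient.mk_add, h2, h4, Submodule.Quotient.mk_add]⟩
  | single w c =>
    refine ⟨c • normalForm lt I w, (normalForm_spec w).1.smul c, ?_⟩
    symm
    rw [Submodule.Quotient.eq]
    have : MonoidAlgebra.single w c - c • normalForm lt I w =
      c • (MonoidAlgebra.of k (Word n) w - normalForm lt I w) := by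
      simp [smul_sub, MonoidAlgebra.of]
    rw [this]
    exact Submodule.smul_of_tower_mem I _ (normalForm_spec w).2

variable (lt I) in
/-- The coefficients of an element of `A` with respect to the standard monomials. -/
def stdCoeff : (NCPoly k n ⧸ I) →ₗ[k] (Word n →₀ k) where
  toFun a := (exists_stdPoly (I := I) (lt := lt) a).choose.coeff
  map_add' a b := by
    have ha := (exists_stdPoly (I := I) (lt := lt) a).choose_spec
    have hb := (exists_stdPoly (I := I) (lt := lt) b).choose_spec
    have hab := (exists_stdPoly (I := I) (lt := lt) (a + b)).choose_spec
    rw [hab.1.eq_of_sub_mem (ha.1.add hb.1)]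
    · rfl
    · rw [← Submodule.Quotient.eq, hab.2, Submodule.Quotient.mk_add, ha.2, hb.2]
  map_smul' c a := by
    have ha := (exists_stdPoly (I := I) (lt := lt) a).choose_spec
    have hca := (exists_stdPoly (I := I) (lt := lt) (c • a)).choose_spec
    rw [hca.1.eq_of_sub_mem (ha.1.smul c)]
    · rfl
    · rw [← Submodule.Quotient.eq, hca.2, Submodule.Quotient.mk_smul, ha.2]

lemma stdCoeff_mk {p : NCPoly k n} (hp : IsStdPoly lt I p) :
    stdCoeff lt I (Submodule.Quotient.mk p) = p.coeff := by
  have h := (exists_stdPoly (I := I) (lt := lt) (Submodule.Quotient.mk p : NCPoly k n ⧸ I)).choose_spec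
  change (exists_stdPoly (I := I) (lt := lt) (Submodule.Quotient.mk p : NCPoly k n ⧸ I)).choose.coeff = _
  rw [h.1.eq_of_sub_mem hp]
  rw [← Submodule.Quotient.eq, h.2]

lemma stdCoeff_mon (u : Word n) : stdCoeff lt I (mon I u) = (normalForm lt I u).coeff := by
  rw [← stdCoeff_mk (normalForm_spec (lt := lt) (I := I) u).1, mon, (Submodule.Quotient.eq I).2 (normalForm_spec (lt := lt) u).2]

lemma stdCoeff_mon_of_std {u : Word n} (hu : u ∉ initialWords lt I) :
    stdCoeff lt I (mon I u) = Finsupp.single u 1 := by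
  rw [stdCoeff_mon, normalForm_of_std hu]
  rfl

lemma notMem_of_stdCoeff_ne {a : NCPoly k n ⧸ I} {w : Word n} (hw : stdCoeff lt I a w ≠ 0) :
    w ∉ initialWords lt I :=
  (exists_stdPoly (I := I) (lt := lt) a).choose_spec.1 w (Finsupp.mem_support_iff.2 hw)

lemma sum_stdCoeff (a : NCPoly k n ⧸ I) :
    (stdCoeff lt I a).sum (fun w c => c • mon I w) = a := by
  have h := (exists_stdPoly (I := I) (lt := lt) a).choose_spec
  conv_rhs => rw [← h.2, ← MonoidAlgebra.sum_coeff_single (exists_stdPoly (I := I) (lt := lt) a).choose]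
  change _ = Submodule.mkQ I _
  rw [map_finsuppSum]
  change Finsupp.sum (exists_stdPoly (I := I) (lt := lt) a).choose.coeff _ = _
  refine Finsupp.sum_congr fun w _ => ?_
  rw [mon, ← Submodule.Quotient.mk_smul]
  simp [MonoidAlgebra.of]

lemma mon_mul (u v : Word n) : mon I (u * v) = mon I u * mon I v := by
  simp only [mon, map_mul]
  rfl

lemma mon_one : mon I (1 : Word n) = 1 := by
  simp only [mon, map_one]
  rfl

/-! ### The augmentation ideal -/

lemma lift_zero_apply (p : NCPoly k n) :
    MonoidAlgebra.lift k k (Word n) (FreeMonoid.lift fun _ : Fin n => (0 : k)) p = p.coeff 1 := by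
  induction p using MonoidAlgebra.induction_linear with
  | zero => simp
  | add p q hp hq => simp [hp, hq]
  | single w c =>
    rw [MonoidAlgebra.lift_single]
    induction w using FreeMonoid.casesOn with
    | one => simp
    | of_mul x xs => simp

variable (lt I) in
/-- The ring homomorphism `A → k` that maps the letters to zero. -/
def counit : (NCPoly k n ⧸ I) →ₐ[k] k :=
  Ideal.Quotient.liftₐ I (MonoidAlgebra.lift k k (Word n)
    (FreeMonoid.lift fun _ : Fin n => (0 : k)))
    fun p hp => (lift_zero_apply p).trans (Setting.aug lt p hp)

lemma counit_mk (p : NCPoly k n) : counit lt I (Submodule.Quotient.mk p) = p.coeff 1 :=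
  lift_zero_apply p

lemma counit_mon {w : Word n} (hw : w ≠ 1) : counit lt I (mon I w) = 0 := by
  rw [mon, counit_mk]
  exact Finsupp.single_eq_of_ne' hw

lemma stdCoeff_apply_one (a : NCPoly k n ⧸ I) : stdCoeff lt I a 1 = counit lt I a := by
  obtain ⟨q, hq, rfl⟩ := exists_stdPoly (lt := lt) a
  rw [stdCoeff_mk hq, counit_mk]

lemma mon_mem_augIdeal {w : Word n} (hw : w ≠ 1) : mon I w ∈ augIdeal I := by
  induction w using FreeMonoid.inductionOn' with
  | one => exact absurd rfl hw
  | of_mul x xs ih =>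
    by_cases hx : xs = 1
    · subst hx
      rw [mul_one]
      exact Ideal.subset_span ⟨x, rfl⟩
    · rw [mon_mul]
      exact Ideal.mul_mem_left _ _ (ih hx)

variable (lt) in
lemma sub_counit_mem_augIdeal (a : NCPoly k n ⧸ I) :
    a - algebraMap k _ (counit lt I a) ∈ augIdeal I := by
  have h : a = algebraMap k _ (counit lt I a) +
      ((stdCoeff lt I a).erase 1).sum (fun w c => c • mon I w) := by
    conv_lhs => rw [← sum_stdCoeff (lt := lt) a]
    rw [← Finsupp.single_add_erase (a := (1 : Word n)) (stdCoeff lt I a),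
      Finsupp.sum_add_index' (by simp) (by simp [add_smul]), Finsupp.sum_single_index (by simp),
      stdCoeff_apply_one, mon_one, Algebra.algebraMap_eq_smul_one]
    simp
  rw [sub_eq_of_eq_add' h]
  refine Submodule.sum_mem _ fun w hw => ?_
  have hw1 : w ≠ 1 := by
    rintro rfl
    simp at hw
  exact Submodule.smul_of_tower_mem _ _ (mon_mem_augIdeal hw1)

lemma mem_augIdeal_iff {a : NCPoly k n ⧸ I} : a ∈ augIdeal I ↔ counit lt I a = 0 := by
  constructor
  · intro ha
    have : augIdeal I ≤ RingHom.ker (counit lt I) := by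
      rw [augIdeal, Ideal.span_le]
      rintro _ ⟨i, rfl⟩
      exact counit_mon (FreeMonoid.of_ne_one i)
    exact this ha
  · intro ha
    simpa [ha] using sub_counit_mem_augIdeal lt a

lemma bijective_algebraMap_quotient (lt : Word n → Word n → Prop) (I : Ideal (NCPoly k n))
    [I.IsTwoSided] [Setting lt I] : Function.Bijective (fun a : k => (Submodule.Quotient.mk
      (algebraMap k (NCPoly k n ⧸ I) a) : (NCPoly k n ⧸ I) ⧸ augIdeal I)) := by
  constructor
  · intro a b hab
    have h := (Submodule.Quotient.eq _).1 hab
    rw [mem_augIdeal_iff (lt := lt), map_sub, AlgHom.commutes, AlgHom.commutes] at h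
    exact sub_eq_zero.1 h
  · intro x
    obtain ⟨a, rfl⟩ := Submodule.Quotient.mk_surjective _ x
    refine ⟨counit lt I a, ?_⟩
    symm
    exact (Submodule.Quotient.eq (augIdeal I)).2 (sub_counit_mem_augIdeal lt a)

end Ideal

end Algebra

/-! ### The normalized bar complex and its contracting homotopy. -/

section BarComplex

variable {k : Type*} [Field k] {n : ℕ} {lt : Word n → Word n → Prop} {I : Ideal (NCPoly k n)}
variable [I.IsTwoSided]

/-! ### The normalized bar resolution as a complex of free modules -/

variable (lt I) in
/-- The free module on all cells, in all degrees. -/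
abbrev BarMod := Cell lt I →₀ (NCPoly k n ⧸ I)

/-- The cell with the entries `c`. -/
def Cell.mk (c : List (Word n)) (h : ∀ w ∈ c, w ∈ stdWords lt I) : Cell lt I := ⟨c, h⟩

/-- The entries of a cell. -/
def Cell.entries (c : Cell lt I) : List (Word n) := c.1

lemma Cell.std (c : Cell lt I) : ∀ w ∈ c.entries, w ∈ stdWords lt I := c.2

@[simp] lemma Cell.entries_mk (c : List (Word n)) (h : ∀ w ∈ c, w ∈ stdWords lt I) :
    (Cell.mk c h).entries = c := rfl

@[ext] lemma Cell.ext {c d : Cell lt I} (h : c.entries = d.entries) : c = d := Subtype.ext h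

variable (lt I) in
/-- `a` times the cell with the entries `c`, or zero if `c` is not a cell. -/
def barTerm (c : List (Word n)) (a : NCPoly k n ⧸ I) : BarMod lt I :=
  if h : ∀ w ∈ c, w ∈ stdWords lt I then Finsupp.single (Cell.mk c h) a else 0

lemma barTerm_of_cell (c : Cell lt I) (a : NCPoly k n ⧸ I) :
    barTerm lt I c.entries a = Finsupp.single c a := dif_pos c.std

lemma barTerm_of_not {c : List (Word n)} (h : ¬ ∀ w ∈ c, w ∈ stdWords lt I)
    (a : NCPoly k n ⧸ I) : barTerm lt I c a = 0 := dif_neg h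

lemma smul_barTerm (c : List (Word n)) (a b : NCPoly k n ⧸ I) :
    b • barTerm lt I c a = barTerm lt I c (b * a) := by
  unfold barTerm
  split_ifs <;> simp

lemma smul_barTerm_one (c : List (Word n)) (b : NCPoly k n ⧸ I) :
    b • barTerm lt I c 1 = barTerm lt I c b := by
  rw [smul_barTerm, mul_one]

lemma smul_barTerm' (c : List (Word n)) (a : NCPoly k n ⧸ I) (b : k) :
    b • barTerm lt I c a = barTerm lt I c (algebraMap k _ b * a) := by
  rw [← smul_barTerm, algebraMap_smul]

variable (lt I) in
/-- `barTerm` as a linear map. -/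
def barTermHom (c : List (Word n)) : (NCPoly k n ⧸ I) →ₗ[k] BarMod lt I where
  toFun a := barTerm lt I c a
  map_add' a b := by
    unfold barTerm
    split_ifs <;> simp
  map_smul' r a := by
    rw [RingHom.id_apply, smul_barTerm', Algebra.smul_def]

@[simp] lemma barTermHom_apply (c : List (Word n)) (a : NCPoly k n ⧸ I) :
    barTermHom lt I c a = barTerm lt I c a := rfl

lemma barTerm_apply (c : List (Word n)) (a : NCPoly k n ⧸ I) (x : Cell lt I) :
    barTerm lt I c a x = Finsupp.single c a x.entries := by
  unfold barTerm
  split_ifs with h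
  · rw [Finsupp.single_apply, Finsupp.single_apply, Cell.ext_iff, Cell.entries_mk]
    congr
  · rw [Finsupp.single_apply, if_neg, Finsupp.zero_apply]
    rintro rfl
    exact h x.std

variable (lt I) in
/-- The inner part of the boundary of the tuple `c`. -/
def innerBoundary (c : List (Word n)) : BarMod lt I :=
  ∑ j ∈ Finset.range (c.length - 1), (normalForm lt I (prodAt c j)).coeff.sum fun v a =>
    if v ≠ 1 then
      barTerm lt I (face c j v) (algebraMap k (NCPoly k n ⧸ I) ((-1) ^ (j + 1) * a))
    else 0

/-- The boundary of a tuple. -/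
def listBoundary (lt : Word n → Word n → Prop) (I : Ideal (NCPoly k n)) [I.IsTwoSided] :
    List (Word n) → BarMod lt I
  | [] => 0
  | w :: c => barTerm lt I c (mon I w) + innerBoundary lt I (w :: c)

lemma listBoundary_apply (c : List (Word n)) (x : Cell lt I) :
    listBoundary lt I c x = barBoundary lt I c x.entries := by
  rcases c with _ | ⟨w, c⟩
  · rfl
  · rw [listBoundary, barBoundary, Finsupp.add_apply, Finsupp.add_apply, barTerm_apply,
      innerBoundary, Finsupp.finsetSum_apply, Finsupp.finsetSum_apply]
    congr 1
    refine Finset.sum_congr rfl fun j _ => ?_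
    rw [Finsupp.sum, Finset.sum_filter, Finsupp.finsetSum_apply, Finsupp.finsetSum_apply]
    refine Finset.sum_congr rfl fun v _ => ?_
    split_ifs
    · exact barTerm_apply _ _ _
    · rfl

/-- The boundary of a cell. -/
def cellBoundary (c : Cell lt I) : BarMod lt I := listBoundary lt I c.entries

lemma cellBoundary_apply (c c' : Cell lt I) : cellBoundary c c' = barWeight lt I c c' :=
  listBoundary_apply _ _

/-- The empty cell. -/
def Cell.nil : Cell lt I := Cell.mk [] (by simp)

/-- The cell `[w | c]`. -/
def Cell.cons (w : Word n) (hw : w ∈ stdWords lt I) (c : Cell lt I) : Cell lt I :=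
  Cell.mk (w :: c.entries) (by
    intro v hv
    rcases List.mem_cons.1 hv with rfl | hv
    exacts [hw, c.std v hv])

@[simp] lemma Cell.entries_nil : (Cell.nil : Cell lt I).entries = [] := rfl

@[simp] lemma Cell.entries_cons (w : Word n) (hw : w ∈ stdWords lt I) (c : Cell lt I) :
    (Cell.cons w hw c).entries = w :: c.entries := rfl

lemma Cell.induction {P : Cell lt I → Prop} (nil : P Cell.nil)
    (cons : ∀ w hw c, P c → P (Cell.cons w hw c)) (c : Cell lt I) : P c := by
  have h : ∀ (l : List (Word n)) (hl : ∀ w ∈ l, w ∈ stdWords lt I), P (Cell.mk l hl) := by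
    intro l
    induction l with
    | nil => exact fun _ => nil
    | cons w l ih =>
      exact fun hl => cons w (hl w (by simp)) (Cell.mk l fun v hv => hl v (by simp [hv])) (ih _)
  exact h c.entries c.std

lemma cellBoundary_nil : cellBoundary (Cell.nil : Cell lt I) = 0 := rfl

lemma cellBoundary_eq (w : Word n) (hw) (c : Cell lt I) :
    cellBoundary (Cell.cons w hw c) =
      Finsupp.single c (mon I w) + innerBoundary lt I (w :: c.entries) := by
  rw [cellBoundary, Cell.entries_cons, listBoundary, barTerm_of_cell]

variable [Setting lt I]

lemma one_notMem_stdWords : (1 : Word n) ∉ stdWords lt I := fun h => h.2 rfl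

lemma prod_ne_one_of_pair {u : Word n} (hu : u ∈ stdWords lt I) (v : Word n) : u * v ≠ 1 := by
  intro h
  have := congrArg FreeMonoid.length h
  have h2 := length_pos_of_ne_one hu.2
  simp at this
  exact hu.2 this.1

variable (lt I) in
/-- The contracting homotopy `a [w_1 | … | w_l] ↦ [a | w_1 | … | w_l]`. -/
def barHomotopy : BarMod lt I →ₗ[k] BarMod lt I :=
  Finsupp.lsum k fun c => (Finsupp.linearCombination k fun v => barTerm lt I (v :: c.entries) 1).comp
    (stdCoeff lt I)

lemma barHomotopy_barTerm (c : List (Word n)) (a : NCPoly k n ⧸ I) :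
    barHomotopy lt I (barTerm lt I c a) =
      (stdCoeff lt I a).sum fun v r => r • barTerm lt I (v :: c) 1 := by
  by_cases h : ∀ w ∈ c, w ∈ stdWords lt I
  · rw [barTerm, dif_pos h, barHomotopy, Finsupp.lsum_single, LinearMap.comp_apply,
      Finsupp.linearCombination_apply]
    rfl
  · rw [barTerm_of_not h, map_zero]
    symm
    refine Finset.sum_eq_zero fun v _ => ?_
    change _ • _ = _
    rw [barTerm_of_not, smul_zero]
    intro h'
    exact h fun w hw => h' w (by simp [hw])

lemma barHomotopy_barTerm_std (c : List (Word n)) {w : Word n} (hw : w ∉ initialWords lt I)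
    (b : k) : barHomotopy lt I (barTerm lt I c (algebraMap k _ b * mon I w)) =
      barTerm lt I (w :: c) (algebraMap k _ b) := by
  rw [← smul_barTerm', map_smul, barHomotopy_barTerm, stdCoeff_mon_of_std hw,
    Finsupp.sum_single_index (by simp), one_smul, smul_barTerm', mul_one]

/-- The tuple [1|c] is not a cell in the normalized resolution. -/
lemma barHomotopy_barTerm_scalar (c : List (Word n)) (b : k) :
    barHomotopy lt I (barTerm lt I c (algebraMap k _ b)) = 0 := by
  have h := barHomotopy_barTerm_std (I := I) c (one_notMem_initialWords (lt := lt)) b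
  rw [mon_one, mul_one] at h
  rw [h, barTerm_of_not]
  intro h'
  exact one_notMem_stdWords (h' 1 (by simp))

lemma barHomotopy_barHomotopy (y : BarMod lt I) : barHomotopy lt I (barHomotopy lt I y) = 0 := by
  induction y using Finsupp.induction_linear with
  | zero => simp
  | add x y hx hy => simp [hx, hy]
  | single c a =>
    rw [← barTerm_of_cell, barHomotopy_barTerm, map_finsuppSum]
    refine Finset.sum_eq_zero fun v _ => ?_
    change barHomotopy lt I (_ • _) = 0
    rw [map_smul, ← map_one (algebraMap k (NCPoly k n ⧸ I)), barHomotopy_barTerm_scalar, smul_zero]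

lemma mul_algebraMap_comm (a : NCPoly k n ⧸ I) (b : k) :
    a * algebraMap k _ b = algebraMap k _ b * a := (Algebra.commutes b a).symm

/-- Prefixing w shifts the inner faces of c by one position and so flips their signs, while merging
w with the first entry of c is the homotopy applied to w times the outer face of c. The homotopy
formula and ∂∂ = 0 are both derived from this recursion. -/
lemma cellBoundary_cons (w : Word n) (hw) (c : Cell lt I) :
    cellBoundary (Cell.cons w hw c) = Finsupp.single c (mon I w) -
      barHomotopy lt I (mon I w • cellBoundary c) := by
  rw [cellBoundary_eq, sub_eq_add_neg, cellBoundary]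
  congr 1
  rcases c.entries with _ | ⟨w2, c⟩
  · simp [listBoundary, innerBoundary]
  rw [listBoundary, innerBoundary, List.length_cons, List.length_cons, Nat.add_sub_cancel,
    Finset.sum_range_succ', add_comm, smul_add, map_add, neg_add, smul_barTerm, ← mon_mul]
  congr 1
  · rw [barHomotopy_barTerm, stdCoeff_mon, Finsupp.sum, Finsupp.sum, ← Finset.sum_neg_distrib]
    refine Finset.sum_congr rfl fun v _ => ?_
    -- The monomial v = 1 contributes nothing on either side: it is left out of the boundary, and
    -- [1|c] is no cell.
    have hv1 : barTerm lt I (1 :: c) (1 : NCPoly k n ⧸ I) = 0 := barTerm_of_not (fun h =>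
      one_notMem_stdWords (h 1 (by simp))) _
    by_cases hv : v = 1
    · rw [if_neg (by simpa using hv), hv, hv1, smul_zero, neg_zero]
    · rw [if_pos hv, smul_barTerm', mul_one, ← barTermHom_apply, ← barTermHom_apply, ← map_neg,
        ← map_neg]
      simp [prodAt, face]
  · rw [innerBoundary, List.length_cons, Nat.add_sub_cancel, Finset.smul_sum, map_sum,
      ← Finset.sum_neg_distrib]
    refine Finset.sum_congr rfl fun j _ => ?_
    have h1 : prodAt (w :: w2 :: c) (j + 1) = prodAt (w2 :: c) j := by simp [prodAt]
    rw [h1, Finsupp.sum, Finsupp.sum, Finset.smul_sum, map_sum, ← Finset.sum_neg_distrib]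
    refine Finset.sum_congr rfl fun v _ => ?_
    have h2 : face (w :: w2 :: c) (j + 1) v = w :: face (w2 :: c) j v := by simp [face]
    rw [h2]
    split_ifs with hv
    · rw [smul_barTerm, mul_algebraMap_comm, barHomotopy_barTerm_std _ hw.1]
      simp only [← barTermHom_apply, ← map_neg]
      congr 2
      ring
    · simp

variable (lt I) in
/-- The differential of the normalized bar resolution. -/
def bd : BarMod lt I →ₗ[NCPoly k n ⧸ I] BarMod lt I :=
  Finsupp.linearCombination (NCPoly k n ⧸ I) cellBoundary

lemma bd_single (c : Cell lt I) (a : NCPoly k n ⧸ I) :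
    bd lt I (Finsupp.single c a) = a • cellBoundary c := by
  rw [bd, Finsupp.linearCombination_single]

lemma bd_barTerm_cons {w : Word n} (hw : w ∈ stdWords lt I) (c : Cell lt I) :
    bd lt I (barTerm lt I (w :: c.entries) 1) = Finsupp.single c (mon I w) -
      barHomotopy lt I (mon I w • cellBoundary c) := by
  rw [← Cell.entries_cons w hw, barTerm_of_cell, bd_single, one_smul, cellBoundary_cons]

/-- In the recursion for the boundary the second term is already in the image of the homotopy, whose
square is zero. -/
lemma barHomotopy_cellBoundary_cons (w : Word n) (hw) (c : Cell lt I) :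
    barHomotopy lt I (cellBoundary (Cell.cons w hw c)) = Finsupp.single (Cell.cons w hw c) 1 := by
  rw [cellBoundary_cons, map_sub, barHomotopy_barHomotopy, sub_zero, ← barTerm_of_cell]
  have := barHomotopy_barTerm_std (I := I) c.entries hw.1 1
  rw [map_one, one_mul] at this
  rw [this, ← barTerm_of_cell, Cell.entries_cons]

/-- The contracting homotopy contracts the bar resolution to the residue class field. -/
lemma bd_barHomotopy (y : BarMod lt I) : bd lt I (barHomotopy lt I y) =
    y - Finsupp.single Cell.nil (algebraMap k _ (counit lt I (y Cell.nil))) -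
      barHomotopy lt I (bd lt I y) := by
  induction y using Finsupp.induction_linear with
  | zero => simp
  | add x y hx hy =>
    simp only [map_add, hx, hy, Finsupp.add_apply, Finsupp.single_add]
    abel
  | single c a =>
    -- `T b` extends the formula for ∂[b|c] linearly to all b in A. As [1|c] is not a cell, ∂ of the
    -- homotopy differs from T by the constant coefficient of b times `T 1`.
    let T : (NCPoly k n ⧸ I) →ₗ[k] BarMod lt I :=
      barTermHom lt I c.entries - (barHomotopy lt I).comp
        ((LinearMap.toSpanSingleton (NCPoly k n ⧸ I) _ (cellBoundary c)).restrictScalars k)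
    have hT : ∀ b, T b = Finsupp.single c b - barHomotopy lt I (b • cellBoundary c) := by
      intro b
      rw [← barTerm_of_cell]
      rfl
    have h1 : ∀ v, v ∉ initialWords lt I → bd lt I (barTerm lt I (v :: c.entries) 1) =
        T (mon I v) - if v = 1 then T 1 else 0 := by
      intro v hv
      by_cases hv1 : v = 1
      · rw [if_pos hv1, hv1, mon_one, sub_self, barTerm_of_not, map_zero]
        exact fun h => one_notMem_stdWords (h 1 (by simp))
      · rw [if_neg hv1, sub_zero, hT, bd_barTerm_cons ⟨hv, hv1⟩]
    have h2 : bd lt I (barHomotopy lt I (Finsupp.single c a)) = T a - counit lt I a • T 1 := by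
      rw [← barTerm_of_cell, barHomotopy_barTerm, map_finsuppSum]
      conv_rhs => rw [← sum_stdCoeff (lt := lt) a]
      rw [sum_stdCoeff (lt := lt) a, ← stdCoeff_apply_one]
      have h3 : T a = (stdCoeff lt I a).sum fun v r => r • T (mon I v) := by
        conv_lhs => rw [← sum_stdCoeff (lt := lt) a]
        rw [map_finsuppSum]
        simp only [map_smul]
      have h4 : stdCoeff lt I a 1 • T 1 =
          (stdCoeff lt I a).sum fun v r => r • if v = 1 then T 1 else 0 := by
        rw [Finsupp.sum]
        simp only [smul_ite, smul_zero]
        rw [Finset.sum_ite_eq']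
        split_ifs with h
        · rfl
        · rw [Finsupp.notMem_support_iff.1 h, zero_smul]
      rw [h3, h4, ← Finsupp.sum_sub]
      refine Finsupp.sum_congr fun v hv => ?_
      rw [LinearMap.map_smul_of_tower, h1 v (notMem_of_stdCoeff_ne (Finsupp.mem_support_iff.1 hv)),
        smul_sub]
    -- For a non-empty c the homotopy returns c from its boundary, so that `T 1` vanishes; the empty
    -- cell accounts for the counit term.
    have h5 : T 1 = if c = Cell.nil then Finsupp.single c 1 else 0 := by
      rw [hT, one_smul]
      induction c using Cell.induction with
      | nil => simp [cellBoundary_nil]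
      | cons w hw c _ =>
        rw [barHomotopy_cellBoundary_cons, sub_self, if_neg]
        rw [Cell.ext_iff]
        simp
    rw [h2, h5, hT, bd_single, sub_right_comm]
    congr 1
    congr 1
    by_cases hc : c = Cell.nil
    · rw [if_pos hc, hc, Finsupp.single_eq_same, ← Finsupp.smul_single_one (Cell.nil)
        (algebraMap k _ _), algebraMap_smul]
    · rw [if_neg hc, Finsupp.single_eq_of_ne (Ne.symm hc)]
      simp

/-- By the recursion, ∂∂[w|c] is w∂c minus ∂ of the homotopy of w∂c. The homotopy formula and
induction give zero, since the coefficients of w∂c have counit zero. -/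
lemma bd_bd (y : BarMod lt I) : bd lt I (bd lt I y) = 0 := by
  induction y using Finsupp.induction_linear with
  | zero => simp
  | add x y hx hy => simp [hx, hy]
  | single c a =>
    rw [bd_single, map_smul]
    suffices h : bd lt I (cellBoundary c) = 0 by rw [h, smul_zero]
    induction c using Cell.induction with
    | nil => simp [cellBoundary_nil]
    | cons w hw c ih =>
      rw [cellBoundary_cons, map_sub, bd_barHomotopy, bd_single, map_smul, ih, smul_zero, map_zero,
        sub_zero, Finsupp.smul_apply, smul_eq_mul, map_mul, counit_mon hw.2, zero_mul, map_zero,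
        Finsupp.single_zero, sub_zero, sub_self]

end BarComplex

/-! ### Factorizations of words and splittings of tuples. -/

section Words

variable {n : ℕ}

lemma mul_eq_mul_cases {a b a' b' : Word n} (h : a * b = a' * b') :
    (a = a' ∧ b = b') ∨ IsProperPrefix a a' ∨ IsProperPrefix a' a := by
  rcases List.append_eq_append_iff.1 (show a.toList ++ b.toList = a'.toList ++ b'.toList from h)
    with ⟨r, h1, h2⟩ | ⟨r, h1, h2⟩
  · by_cases hr : r = []
    · subst hr
      exact Or.inl ⟨by simpa using h1.symm, by simpa using h2⟩
    · exact Or.inr (Or.inl ⟨FreeMonoid.ofList r, hr, h1.symm⟩)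
  · by_cases hr : r = []
    · subst hr
      exact Or.inl ⟨by simpa using h1, by simpa using h2.symm⟩
    · exact Or.inr (Or.inr ⟨FreeMonoid.ofList r, hr, h1.symm⟩)

lemma IsProperPrefix.length_lt {a b : Word n} (h : IsProperPrefix a b) : a.length < b.length := by
  obtain ⟨r, hr, rfl⟩ := h
  have := length_pos_of_ne_one hr
  rw [FreeMonoid.length_mul]
  omega

lemma exists_split {α : Type*} {l : List α} {j : ℕ} (h : j + 1 < l.length) :
    ∃ p a b q, l = p ++ a :: b :: q ∧ p.length = j := by
  refine ⟨l.take j, l[j], l[j + 1], l.drop (j + 2), ?_, by simp; omega⟩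
  conv_lhs => rw [← List.take_append_drop j l]
  rw [List.drop_eq_getElem_cons (by omega), List.drop_eq_getElem_cons (by omega)]

lemma face_append (p : List (Word n)) (a b : Word n) (q : List (Word n)) (v : Word n) :
    face (p ++ a :: b :: q) p.length v = p ++ v :: q := by
  simp [face]

lemma prodAt_append (p : List (Word n)) (a b : Word n) (q : List (Word n)) :
    prodAt (p ++ a :: b :: q) p.length = a * b := by
  simp [prodAt]

end Words

/-! ### Minimal overlaps, and the weights of the edges of the bar graph. -/

section Matching

variable {k : Type*} [Field k] {n : ℕ} {lt : Word n → Word n → Prop} {I : Ideal (NCPoly k n)}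

/-! ### Chains of minimal overlaps -/

/-- `w` can follow the entry `prev` of a tuple that survives the matching at the coordinate of
`prev`; `none` stands for the beginning of the tuple. -/
def Overlap (lt : Word n → Word n → Prop) (I : Ideal (NCPoly k n)) : Option (Word n) → Word n → Prop
  | none, w => w ≠ 1
  | some p, w => p * w ∈ initialWords lt I

/-- `w` is minimal among its prefixes with the property `Overlap lt I prev`. -/
def IsMinOverlap (lt : Word n → Word n → Prop) (I : Ideal (NCPoly k n)) (prev : Option (Word n))
    (w : Word n) : Prop :=
  Overlap lt I prev w ∧ ∀ v, IsProperPrefix v w → ¬ Overlap lt I prev v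

/-- Every entry is a minimal overlap with the preceding one. -/
def MinChain (lt : Word n → Word n → Prop) (I : Ideal (NCPoly k n)) :
    Option (Word n) → List (Word n) → Prop
  | _, [] => True
  | prev, w :: c => IsMinOverlap lt I prev w ∧ MinChain lt I (some w) c

/-- The first `j` entries are minimal overlaps, and the next one is an overlap. -/
def CritTo (lt : Word n → Word n → Prop) (I : Ideal (NCPoly k n)) :
    ℕ → Option (Word n) → List (Word n) → Prop
  | _, _, [] => True
  | 0, prev, w :: _ => Overlap lt I prev w
  | j + 1, prev, w :: c => IsMinOverlap lt I prev w ∧ CritTo lt I j (some w) c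

/-- The last entry of a list, with a default for the empty list. -/
def lastOr : Option (Word n) → List (Word n) → Option (Word n)
  | prev, [] => prev
  | _, w :: c => lastOr (some w) c

@[simp] lemma lastOr_nil (prev : Option (Word n)) : lastOr prev [] = prev := rfl

@[simp] lemma lastOr_append_singleton (prev : Option (Word n)) (p : List (Word n)) (w : Word n) :
    lastOr prev (p ++ [w]) = some w := by
  induction p generalizing prev with
  | nil => rfl
  | cons a p ih => exact ih _

/-- The matching on tuples: `[p | u₁ | u₂ | q] → [p | u₁ u₂ | q]` if `[p | u₁]` is a chain of
minimal overlaps. -/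
def ListMatch (lt : Word n → Word n → Prop) (I : Ideal (NCPoly k n)) (c c' : List (Word n)) :
    Prop :=
  ∃ (p q : List (Word n)) (u₁ u₂ : Word n), c = p ++ u₁ :: u₂ :: q ∧ c' = p ++ (u₁ * u₂) :: q ∧
    MinChain lt I none p ∧ IsMinOverlap lt I (lastOr none p) u₁

lemma exists_isMinOverlap {prev : Option (Word n)} {w : Word n} (h : Overlap lt I prev w) :
    ∃ a b, w = a * b ∧ IsMinOverlap lt I prev a := by
  induction hl : w.length using Nat.strong_induction_on generalizing w with
  | _ l ih =>
    by_cases hm : ∀ v, IsProperPrefix v w → ¬ Overlap lt I prev v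
    · exact ⟨w, 1, by simp, h, hm⟩
    · push Not at hm
      obtain ⟨v, hv, ho⟩ := hm
      obtain ⟨a, b, rfl, ha⟩ := ih v.length (hl ▸ hv.length_lt) ho rfl
      obtain ⟨r, -, rfl⟩ := hv
      exact ⟨a, b * r, by rw [mul_assoc], ha⟩

lemma IsMinOverlap.unique {prev : Option (Word n)} {a b a' b' : Word n}
    (ha : IsMinOverlap lt I prev a) (ha' : IsMinOverlap lt I prev a') (h : a * b = a' * b') :
    a = a' ∧ b = b' := by
  rcases mul_eq_mul_cases h with h | h | h
  · exact h
  · exact absurd ha.1 (ha'.2 _ h)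
  · exact absurd ha'.1 (ha.2 _ h)

lemma not_isMinOverlap_mul {prev : Option (Word n)} {a b : Word n} (ha : Overlap lt I prev a)
    (hb : b ≠ 1) : ¬ IsMinOverlap lt I prev (a * b) :=
  fun h => h.2 a ⟨b, hb, rfl⟩ ha

lemma minChain_append (prev : Option (Word n)) (p c : List (Word n)) :
    MinChain lt I prev (p ++ c) ↔ MinChain lt I prev p ∧ MinChain lt I (lastOr prev p) c := by
  induction p generalizing prev with
  | nil => simp [MinChain]
  | cons w p ih => simp [MinChain, lastOr, ih, and_assoc]

/-- The part before the splitting is the longest initial chain of minimal overlaps, hence determined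
by the tuple. This is why a cell has at most one partner. -/
lemma minChain_split_unique {prev : Option (Word n)} {p p' q q' : List (Word n)} {w w' : Word n}
    (hp : MinChain lt I prev p) (hp' : MinChain lt I prev p')
    (hw : ¬ IsMinOverlap lt I (lastOr prev p) w) (hw' : ¬ IsMinOverlap lt I (lastOr prev p') w')
    (h : p ++ w :: q = p' ++ w' :: q') : p = p' ∧ w = w' ∧ q = q' := by
  induction p generalizing prev p' with
  | nil =>
    cases p' with
    | nil => simpa using h
    | cons a p' =>
      simp only [List.nil_append, List.cons_append, List.cons.injEq] at h
      obtain ⟨rfl, -⟩ := h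
      exact absurd hp'.1 hw
  | cons a p ih =>
    cases p' with
    | nil =>
      simp only [List.nil_append, List.cons_append, List.cons.injEq] at h
      obtain ⟨rfl, -⟩ := h
      exact absurd hp.1 hw'
    | cons b p' =>
      simp only [List.cons_append, List.cons.injEq] at h
      obtain ⟨rfl, h⟩ := h
      obtain ⟨rfl, h1⟩ := ih hp.2 hp'.2 hw hw' h
      exact ⟨rfl, h1⟩

lemma minChain_or_exists (prev : Option (Word n)) (c : List (Word n)) :
    MinChain lt I prev c ∨ ∃ p w q, c = p ++ w :: q ∧ MinChain lt I prev p ∧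
      ¬ IsMinOverlap lt I (lastOr prev p) w := by
  induction c generalizing prev with
  | nil => exact Or.inl trivial
  | cons w c ih =>
    by_cases hw : IsMinOverlap lt I prev w
    · rcases ih (some w) with h | ⟨p, v, q, rfl, hp, hv⟩
      · exact Or.inl ⟨hw, h⟩
      · exact Or.inr ⟨w :: p, v, q, rfl, ⟨hw, hp⟩, hv⟩
    · exact Or.inr ⟨[], w, c, rfl, trivial, hw⟩

lemma critTo_append (prev : Option (Word n)) (p : List (Word n)) (w : Word n)
    (q : List (Word n)) : CritTo lt I p.length prev (p ++ w :: q) ↔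
      MinChain lt I prev p ∧ Overlap lt I (lastOr prev p) w := by
  induction p generalizing prev with
  | nil => simp [CritTo, MinChain]
  | cons a p ih => simp [CritTo, MinChain, lastOr, ih, and_assoc]

lemma critTo_of_length_le {j : ℕ} (prev : Option (Word n)) (c : List (Word n))
    (h : c.length ≤ j) : CritTo lt I j prev c ↔ MinChain lt I prev c := by
  induction c generalizing prev j with
  | nil => cases j <;> simp [CritTo, MinChain]
  | cons a c ih =>
    cases j with
    | zero => simp at h
    | succ j => simp [CritTo, MinChain, ih (some a) (by simpa using h)]

lemma critTo_succ_append (prev : Option (Word n)) (p : List (Word n)) (w : Word n)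
    (q : List (Word n)) : CritTo lt I (p.length + 1) prev (p ++ w :: q) ↔
      MinChain lt I prev p ∧ IsMinOverlap lt I (lastOr prev p) w ∧
        CritTo lt I 0 (some w) q := by
  induction p generalizing prev with
  | nil => simp [CritTo, MinChain]
  | cons a p ih => simp [CritTo, MinChain, lastOr, ih, and_assoc]

variable [I.IsTwoSided] [Setting lt I]

lemma Overlap.mul {prev : Option (Word n)} {v : Word n} (h : Overlap lt I prev v) (r : Word n) :
    Overlap lt I prev (v * r) := by
  cases prev with
  | none =>
    intro h'
    have h1 := congrArg FreeMonoid.length h'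
    have h2 := length_pos_of_ne_one h
    rw [FreeMonoid.length_mul, FreeMonoid.length_one] at h1
    omega
  | some p =>
    change p * (v * r) ∈ _
    rw [← mul_assoc]
    exact mul_right_mem_initialWords r h

lemma not_overlap_one {prev : Option (Word n)} (h : ∀ p ∈ prev, p ∈ stdWords lt I) :
    ¬ Overlap lt I prev 1 := by
  cases prev with
  | none => simp [Overlap]
  | some p =>
    change p * 1 ∉ _
    rw [mul_one]
    exact (h p rfl).1

lemma IsMinOverlap.ne_one {prev : Option (Word n)} (h : ∀ p ∈ prev, p ∈ stdWords lt I)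
    {w : Word n} (hw : IsMinOverlap lt I prev w) : w ≠ 1 := by
  rintro rfl
  exact not_overlap_one h hw.1

lemma lastOr_mem {prev : Option (Word n)} (h : ∀ p ∈ prev, p ∈ stdWords lt I)
    {p : List (Word n)} (hp : ∀ w ∈ p, w ∈ stdWords lt I) :
    ∀ w ∈ lastOr prev p, w ∈ stdWords lt I := by
  induction p generalizing prev with
  | nil => exact h
  | cons a p ih =>
    refine ih ?_ fun w hw => hp w (by simp [hw])
    simp only [Option.mem_def, Option.some.injEq]
    rintro _ rfl
    exact hp _ (by simp)

/-! ### The graph of the bar resolution -/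

lemma barWeight_eq (c c' : Cell lt I) :
    barWeight lt I c c' = listBoundary lt I c.entries c' := (listBoundary_apply _ _).symm

lemma innerBoundary_apply (c : List (Word n)) (x : Cell lt I) :
    innerBoundary lt I c x = ∑ j ∈ Finset.range (c.length - 1),
      (normalForm lt I (prodAt c j)).coeff.sum fun v a => if v ≠ 1 ∧ face c j v = x.entries then
        algebraMap k (NCPoly k n ⧸ I) ((-1) ^ (j + 1) * a) else 0 := by
  rw [innerBoundary, Finsupp.finsetSum_apply]
  refine Finset.sum_congr rfl fun j _ => ?_
  rw [Finsupp.sum, Finsupp.finsetSum_apply]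
  refine Finset.sum_congr rfl fun v _ => ?_
  by_cases hv : v = 1
  · simp [hv]
  · rw [if_pos hv, barTerm_apply, Finsupp.single_apply]
    simp [hv]

lemma innerBoundary_apply_of_not_mergesTo {c x : Cell lt I} (h : ¬ MergesTo lt I c x) :
    innerBoundary lt I c.entries x = 0 := by
  rw [innerBoundary_apply]
  refine Finset.sum_eq_zero fun j hj => Finset.sum_eq_zero fun v hv => ?_
  change (if _ then _ else _) = _
  rw [if_neg]
  rintro ⟨hv1, hf⟩
  refine h ⟨j, v, ?_, hv1, Finsupp.mem_support_iff.1 hv, hf.symm⟩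
  have := Finset.mem_range.1 hj
  change j + 1 < c.entries.length
  omega

/-- The outer face and several inner faces may coincide and add up in one coefficient; if no inner
face is involved, the coefficient is the bare word w. -/
lemma barWeight_of_not_mergesTo {c x : Cell lt I} (h : ¬ MergesTo lt I c x) :
    barWeight lt I c x = 0 ∨ ∃ w ∈ stdWords lt I, c.entries = w :: x.entries ∧
      barWeight lt I c x = mon I w := by
  rw [barWeight_eq]
  rcases hc : c.entries with _ | ⟨w, c0⟩
  · exact Or.inl rfl
  · rw [listBoundary, ← hc, Finsupp.add_apply, innerBoundary_apply_of_not_mergesTo h, add_zero,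
      barTerm_apply, Finsupp.single_apply]
    split_ifs with hx
    · exact Or.inr ⟨w, c.std w (by simp [hc]), by rw [← hx, hc], rfl⟩
    · exact Or.inl rfl

lemma barWeight_ne_zero_cases {c x : Cell lt I} (h : barWeight lt I c x ≠ 0) :
    MergesTo lt I c x ∨ ∃ w ∈ stdWords lt I, c.entries = w :: x.entries := by
  by_cases hm : MergesTo lt I c x
  · exact Or.inl hm
  · rcases barWeight_of_not_mergesTo hm with h' | ⟨w, hw, hc, -⟩
    · exact absurd h' h
    · exact Or.inr ⟨w, hw, hc⟩

/-- A merge replaces two neighbours by a word that is at most their product. -/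
lemma MergesTo.exists_split {c x : Cell lt I} (h : MergesTo lt I c x) :
    ∃ p a b q v, c.entries = p ++ a :: b :: q ∧ x.entries = p ++ v :: q ∧
      (v = a * b ∨ rank lt v < rank lt (a * b)) := by
  obtain ⟨j, v, hj, hv1, hv, hx⟩ := h
  obtain ⟨p, a, b, q, hc, rfl⟩ := AnickMorse.exists_split hj
  rw [hc, prodAt_append] at hv
  rw [hc, face_append] at hx
  refine ⟨p, a, b, q, v, hc, hx, ?_⟩
  rcases (rank_le_of_mem_normalForm hv).eq_or_lt with h | h
  · exact Or.inl (rank_inj (Setting.ord lt I) h)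
  · exact Or.inr h

/-- The underlying word of a cell. -/
def Cell.word (c : Cell lt I) : Word n := c.entries.prod

lemma rank_word_lt_of_cons {c x : Cell lt I} {w : Word n} (hw : w ∈ stdWords lt I)
    (h : c.entries = w :: x.entries) : rank lt x.word < rank lt c.word := by
  refine rank_lt_of_length_lt (Setting.ord lt I) ?_
  rw [Cell.word, Cell.word, h, List.prod_cons, FreeMonoid.length_mul]
  have := length_pos_of_ne_one hw.2
  omega

/-- An edge of the graph of the bar resolution makes the word smaller, or it merges two
neighbours. -/
lemma edge_cases {c x : Cell lt I} (h : barWeight lt I c x ≠ 0) :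
    rank lt x.word < rank lt c.word ∨
      ∃ p a b q, c.entries = p ++ a :: b :: q ∧ x.entries = p ++ (a * b) :: q := by
  rcases barWeight_ne_zero_cases h with h | ⟨w, hw, hc⟩
  · obtain ⟨p, a, b, q, v, hc, hx, rfl | hv⟩ := h.exists_split
    · exact Or.inr ⟨p, a, b, q, hc, hx⟩
    · left
      rw [Cell.word, Cell.word, hc, hx]
      simp only [List.prod_append, List.prod_cons, ← mul_assoc]
      rw [mul_assoc _ a b]
      exact rank_lt_mul (Setting.ord lt I) _ _ hv
  · exact Or.inl (rank_word_lt_of_cons hw hc)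

lemma edge_length {c x : Cell lt I} (h : barWeight lt I c x ≠ 0) :
    c.entries.length = x.entries.length + 1 := by
  rcases barWeight_ne_zero_cases h with h | ⟨w, hw, hc⟩
  · obtain ⟨p, a, b, q, v, hc, hx, -⟩ := h.exists_split
    rw [hc, hx]
    simp
    omega
  · rw [hc, List.length_cons]

lemma word_eq_of_merge {c x : Cell lt I} {p q : List (Word n)} {a b : Word n}
    (hc : c.entries = p ++ a :: b :: q) (hx : x.entries = p ++ (a * b) :: q) :
    x.word = c.word := by
  rw [Cell.word, Cell.word, hc, hx]
  simp [mul_assoc]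

/-- At the leftmost of two different merge positions the entry would be both a and ab, which forces
b = 1. Thus only one summand of the boundary contributes to a merge. -/
lemma merge_unique {p q p' q' : List (Word n)} {a b a' b' : Word n}
    (h1 : p ++ a :: b :: q = p' ++ a' :: b' :: q')
    (h2 : p ++ (a * b) :: q = p' ++ (a' * b') :: q') (hb : b ≠ 1) (hb' : b' ≠ 1) :
    p.length = p'.length := by
  have key : ∀ {p q p' q' : List (Word n)} {a b a' b' : Word n},
      p ++ a :: b :: q = p' ++ a' :: b' :: q' →
      p ++ (a * b) :: q = p' ++ (a' * b') :: q' → b ≠ 1 → ¬ p.length < p'.length := by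
    intro p q p' q' a b a' b' h1 h2 hb hlt
    have e1 := congrArg (fun l => l[p.length]?) h1
    have e2 := congrArg (fun l => l[p.length]?) h2
    simp only [List.getElem?_append_right le_rfl, Nat.sub_self, List.getElem?_cons_zero,
      List.getElem?_append_left hlt] at e1 e2
    rw [← e1] at e2
    simp at e2
    exact hb e2
  have := key h1 h2 hb
  have := key h1.symm h2.symm hb'
  omega

/-- A merge of neighbours has the weight `± 1`. -/
lemma barWeight_merge {c x : Cell lt I} {p q : List (Word n)} {a b : Word n}
    (hc : c.entries = p ++ a :: b :: q) (hx : x.entries = p ++ (a * b) :: q) :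
    barWeight lt I c x = algebraMap k _ ((-1) ^ (p.length + 1)) := by
  have hword := word_eq_of_merge hc hx
  have hb : b ∈ stdWords lt I := c.std b (by simp [hc])
  have hab : a * b ∈ stdWords lt I := x.std _ (by simp [hx])
  -- The outer face has a shorter word, whereas a merge keeps the word.
  have h1 : barWeight lt I c x = innerBoundary lt I c.entries x := by
    rw [barWeight_eq]
    rcases hc' : c.entries with _ | ⟨w, c0⟩
    · simp [hc'] at hc
    · rw [listBoundary, Finsupp.add_apply, barTerm_apply, Finsupp.single_eq_of_ne', zero_add]
      rintro rfl
      have := rank_word_lt_of_cons (c.std w (by simp [hc'])) hc'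
      rw [hword] at this
      exact lt_irrefl _ this
  rw [h1, innerBoundary_apply, Finset.sum_eq_single p.length]
  · rw [hc, prodAt_append, normalForm_of_std hab.1]
    change Finsupp.sum (Finsupp.single _ _) _ = _
    rw [Finsupp.sum_single_index (by simp), if_pos ⟨hab.2, by rw [hx, face_append]⟩, mul_one]
  · intro j hj hne
    refine Finset.sum_eq_zero fun v hv => ?_
    change (if _ then _ else _) = _
    rw [if_neg]
    rintro ⟨hv1, hf⟩
    have hj' : j + 1 < c.entries.length := by
      have := Finset.mem_range.1 hj
      omega
    obtain ⟨p', a', b', q', hc', rfl⟩ := exists_split hj'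
    rw [hc', face_append] at hf
    rw [hc', prodAt_append] at hv
    have hv' := Finsupp.mem_support_iff.1 hv
    -- A smaller monomial at this place would make the word of x smaller than that of c.
    have hva : v = a' * b' := by
      rcases (rank_le_of_mem_normalForm hv').eq_or_lt with h | h
      · exact rank_inj (Setting.ord lt I) h
      · exfalso
        have h2 := rank_lt_mul (Setting.ord lt I) p'.prod q'.prod h
        have h3 : x.word = p'.prod * v * q'.prod := by
          rw [Cell.word, ← hf]
          simp [mul_assoc]
        have h4 : c.word = p'.prod * (a' * b') * q'.prod := by
          rw [Cell.word, hc']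
          simp [mul_assoc]
        rw [← h3, ← h4, hword] at h2
        exact lt_irrefl _ h2
    subst hva
    refine hne (merge_unique (hc'.symm.trans hc) (hf.trans hx) ?_ hb.2)
    exact (c.std b' (by simp [hc'])).2
  · intro h
    exfalso
    refine h (Finset.mem_range.2 ?_)
    rw [hc]
    simp

lemma algebraMap_injective (lt : Word n → Word n → Prop) (I : Ideal (NCPoly k n))
    [I.IsTwoSided] [Setting lt I] : Function.Injective (algebraMap k (NCPoly k n ⧸ I)) := by
  intro a b h
  have := congrArg (counit lt I) h
  simpa using this

end Matching

/-! ### The matching in terms of minimal overlaps, and its unmatched cells. -/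

section Matching

variable {k : Type*} [Field k] {n : ℕ} {lt : Word n → Word n → Prop} {I : Ideal (NCPoly k n)}
variable [I.IsTwoSided] [Setting lt I]

/-! ### The matching -/

lemma barWeight_merge_ne_zero {c x : Cell lt I} {p q : List (Word n)} {a b : Word n}
    (hc : c.entries = p ++ a :: b :: q) (hx : x.entries = p ++ (a * b) :: q) :
    barWeight lt I c x ≠ 0 := by
  rw [barWeight_merge hc hx, Ne, ← map_zero (algebraMap k (NCPoly k n ⧸ I)),
    (algebraMap_injective lt I).eq_iff]
  exact pow_ne_zero _ (by simp)

lemma none_std : ∀ p ∈ (none : Option (Word n)), p ∈ stdWords lt I := by simp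

lemma ListMatch.length {c c' : List (Word n)} (h : ListMatch lt I c c') :
    c.length = c'.length + 1 := by
  obtain ⟨p, q, a, b, rfl, rfl, -⟩ := h
  simp
  omega

/-- The description of the matching at one coordinate, provided that the cells that are left over
by the preceding coordinates are known. -/
lemma matchAt_iff {j : ℕ} {B : Set (Cell lt I)}
    (hB : ∀ c : Cell lt I, c ∈ B ↔ CritTo lt I j none c.entries) (c c' : Cell lt I) :
    MatchAt lt I B j c c' ↔ ∃ (p q : List (Word n)) (u₁ u₂ : Word n), p.length = j ∧
      c.entries = p ++ u₁ :: u₂ :: q ∧ c'.entries = p ++ (u₁ * u₂) :: q ∧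
      MinChain lt I none p ∧ IsMinOverlap lt I (lastOr none p) u₁ := by
  constructor
  · rintro ⟨hc, hc', -, p, q, u₁, u₂, rfl, h1, h2, h3⟩
    change c.entries = _ at h1
    change c'.entries = _ at h2
    rw [hB, h1, critTo_append] at hc
    refine ⟨p, q, u₁, u₂, rfl, h1, h2, hc.1, hc.2, fun v hv ho => ?_⟩
    have hab : u₁ * u₂ ∈ stdWords lt I := c'.std _ (by simp [h2])
    obtain ⟨r, hr, rfl⟩ := hv
    have hpstd : ∀ w ∈ p, w ∈ stdWords lt I := fun w hw => c.std w (by simp [h1, hw])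
    have hv1 : v ≠ 1 := by
      rintro rfl
      exact not_overlap_one (lastOr_mem none_std hpstd) ho
    have hvs : v ∈ stdWords lt I := stdWords_of_mul (p := 1) (q := r * u₂)
      (by simpa [mul_assoc] using hab.1) hv1
    have hrs : r * u₂ ∈ stdWords lt I := by
      refine stdWords_of_mul (p := v) (q := 1) (by simpa [mul_assoc] using hab.1) fun h => ?_
      have h4 := congrArg FreeMonoid.length h
      have h5 := length_pos_of_ne_one hr
      rw [FreeMonoid.length_mul, FreeMonoid.length_one] at h4
      omega
    -- If a proper prefix v of u₁ were an overlap, cutting u₁u₂ after v would give a cell in B,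
    -- which `MatchAt` forbids.
    let b : Cell lt I := Cell.mk (p ++ v :: (r * u₂) :: q) (by
      intro w hw
      simp only [List.mem_append, List.mem_cons] at hw
      rcases hw with hw | rfl | rfl | hw
      · exact hpstd w hw
      · exact hvs
      · exact hrs
      · exact c.std w (by simp [h1, hw]))
    refine h3 v (r * u₂) ⟨r, hr, rfl⟩ (by rw [mul_assoc]) b ?_ rfl
    rw [hB, Cell.entries_mk, critTo_append]
    exact ⟨hc.1, ho⟩
  · rintro ⟨p, q, u₁, u₂, rfl, h1, h2, hp, hu⟩
    refine ⟨?_, ?_, barWeight_merge_ne_zero h1 h2, p, q, u₁, u₂, rfl, h1, h2, ?_⟩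
    · rw [hB, h1, critTo_append]
      exact ⟨hp, hu.1⟩
    · rw [hB, h2, critTo_append]
      exact ⟨hp, hu.1.mul u₂⟩
    · intro v₁ v₂ hv _ b hb hbe
      change b.entries = _ at hbe
      rw [hB, hbe, critTo_append] at hb
      exact hu.2 v₁ hv hb.2

lemma critTo_one_of_cell (c : Cell lt I) {p q : List (Word n)} {w w' : Word n}
    (hc : c.entries = p ++ w :: w' :: q) : CritTo lt I 0 (some w) (w' :: q) ↔
      ¬ w * w' ∈ stdWords lt I := by
  have hw : w ∈ stdWords lt I := c.std w (by simp [hc])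
  have h1 : w * w' ≠ 1 := prod_ne_one_of_pair hw w'
  change w * w' ∈ initialWords lt I ↔ _
  constructor
  · exact fun h h' => h'.1 h
  · intro h
    by_contra hn
    exact h ⟨hn, h1⟩

/-- A cell surviving j coordinates has an overlap w at the next one. If w is not minimal, the cell
is matched from above by splitting w; if w is minimal and its product with the next entry is
standard, it is matched downwards by merging. What survives has w minimal and an overlap after it.
-/
lemma critAfter_iff (j : ℕ) : ∀ c : Cell lt I,
    c ∈ critAfter lt I j ↔ CritTo lt I j none c.entries := by
  induction j with
  | zero =>
    intro c
    refine ⟨fun _ => ?_, fun _ => Set.mem_univ _⟩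
    rcases hc : c.entries with _ | ⟨w, q⟩
    · trivial
    · exact (c.std w (by simp [hc])).2
  | succ j ih =>
    intro c
    change (c ∈ critAfter lt I j ∧ ∀ c', ¬ MatchAt lt I (critAfter lt I j) j c c' ∧
      ¬ MatchAt lt I (critAfter lt I j) j c' c) ↔ _
    rw [ih]
    simp only [matchAt_iff ih]
    by_cases hlen : c.entries.length ≤ j
    · rw [critTo_of_length_le _ _ hlen, critTo_of_length_le _ _ (by omega)]
      refine ⟨fun h => h.1, fun h => ⟨h, fun c' => ⟨?_, ?_⟩⟩⟩
      · rintro ⟨p, q, u₁, u₂, rfl, h1, h2, -⟩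
        simp [h1] at hlen
      · rintro ⟨p, q, u₁, u₂, rfl, h1, h2, -⟩
        simp [h2] at hlen
    · push Not at hlen
      obtain ⟨p, w, q, hc, rfl⟩ : ∃ p w q, c.entries = p ++ w :: q ∧ p.length = j := by
        refine ⟨c.entries.take j, c.entries[j], c.entries.drop (j + 1), ?_, by simp; omega⟩
        rw [← List.drop_eq_getElem_cons, List.take_append_drop]
      have hpstd : ∀ w ∈ p, w ∈ stdWords lt I := fun w hw => c.std w (by simp [hc, hw])
      have hlast := lastOr_mem none_std hpstd
      rw [hc, critTo_append, critTo_succ_append]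
      constructor
      · rintro ⟨⟨hp, ho⟩, hno⟩
        have hmin : IsMinOverlap lt I (lastOr none p) w := by
          by_contra hn
          -- The cell with w split after its minimal overlap a would be a partner from above.
          obtain ⟨a, b, rfl, ha⟩ := exists_isMinOverlap ho
          have hb : b ≠ 1 := by
            rintro rfl
            rw [mul_one] at hn
            exact hn ha
          have ha1 := ha.ne_one hlast
          have hws : a * b ∈ stdWords lt I := c.std _ (by simp [hc])
          have has : a ∈ stdWords lt I := stdWords_of_mul (p := 1) (q := b) (by simpa using hws.1) ha1
          have hbs : b ∈ stdWords lt I := stdWords_of_mul (p := a) (q := 1) (by simpa using hws.1) hb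
          refine (hno (Cell.mk (p ++ a :: b :: q) ?_)).2 ⟨p, q, a, b, rfl, rfl, rfl, hp, ha⟩
          intro v hv
          simp only [List.mem_append, List.mem_cons] at hv
          rcases hv with hv | rfl | rfl | hv
          · exact hpstd v hv
          · exact has
          · exact hbs
          · exact c.std v (by simp [hc, hv])
        refine ⟨hp, hmin, ?_⟩
        rcases q with _ | ⟨w', q⟩
        · trivial
        · rw [critTo_one_of_cell c hc]
          intro hs
          refine (hno (Cell.mk (p ++ (w * w') :: q) ?_)).1 ⟨p, q, w, w', rfl, rfl, rfl, hp, hmin⟩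
          intro v hv
          simp only [List.mem_append, List.mem_cons] at hv
          rcases hv with hv | rfl | hv
          · exact hpstd v hv
          · exact hs
          · exact c.std v (by simp [hc, hv])
      · rintro ⟨hp, hmin, hq⟩
        refine ⟨⟨hp, hmin.1⟩, fun c' => ⟨?_, ?_⟩⟩
        · rintro ⟨p', q', u₁, u₂, hl, h1, h2, -⟩
          obtain ⟨rfl, h3⟩ := List.append_inj h1 hl.symm
          obtain ⟨rfl, rfl⟩ := List.cons.inj h3
          rw [critTo_one_of_cell c hc] at hq
          exact hq (c'.std _ (by simp [h2]))
        · rintro ⟨p', q', u₁, u₂, hl, h1, h2, hp', hu⟩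
          obtain ⟨rfl, h3⟩ := List.append_inj h2 hl.symm
          obtain ⟨rfl, rfl⟩ := List.cons.inj h3
          have hu2 : u₂ ∈ stdWords lt I := c'.std _ (by simp [h1])
          exact not_isMinOverlap_mul hu.1 hu2.2 hmin

lemma barMatching_iff (c c' : Cell lt I) :
    barMatching lt I c c' ↔ ListMatch lt I c.entries c'.entries := by
  unfold barMatching ListMatch
  simp only [matchAt_iff (critAfter_iff _)]
  constructor
  · rintro ⟨_, p, q, u₁, u₂, -, h⟩
    exact ⟨p, q, u₁, u₂, h⟩
  · rintro ⟨p, q, u₁, u₂, h⟩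
    exact ⟨_, p, q, u₁, u₂, rfl, h⟩

/-! ### Upper, lower and critical cells -/

/-- The cells that are matched with a cell of smaller degree. -/
def IsUpper (c : Cell lt I) : Prop := ∃ (p q : List (Word n)) (u₁ u₂ : Word n),
  c.entries = p ++ u₁ :: u₂ :: q ∧ MinChain lt I none p ∧ IsMinOverlap lt I (lastOr none p) u₁ ∧
    u₁ * u₂ ∈ stdWords lt I

/-- The cells that are matched with a cell of larger degree. -/
def IsLower (c : Cell lt I) : Prop := ∃ (p q : List (Word n)) (w : Word n),
  c.entries = p ++ w :: q ∧ MinChain lt I none p ∧ Overlap lt I (lastOr none p) w ∧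
    ¬ IsMinOverlap lt I (lastOr none p) w

lemma isUpper_of_match {c c' : Cell lt I} (h : barMatching lt I c c') : IsUpper c := by
  rw [barMatching_iff] at h
  obtain ⟨p, q, a, b, h1, h2, h3, h4⟩ := h
  exact ⟨p, q, a, b, h1, h3, h4, c'.std _ (by simp [h2])⟩

lemma isLower_of_match {c c' : Cell lt I} (h : barMatching lt I c c') : IsLower c' := by
  rw [barMatching_iff] at h
  obtain ⟨p, q, a, b, h1, h2, h3, h4⟩ := h
  exact ⟨p, q, a * b, h2, h3, h4.1.mul b,
    not_isMinOverlap_mul h4.1 (c.std b (by simp [h1])).2⟩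

lemma IsUpper.exists_match {c : Cell lt I} (h : IsUpper c) : ∃ c', barMatching lt I c c' := by
  obtain ⟨p, q, a, b, h1, h2, h3, h4⟩ := h
  refine ⟨Cell.mk (p ++ (a * b) :: q) ?_, (barMatching_iff _ _).2 ⟨p, q, a, b, h1, rfl, h2, h3⟩⟩
  intro v hv
  simp only [List.mem_append, List.mem_cons] at hv
  rcases hv with hv | rfl | hv
  · exact c.std v (by simp [h1, hv])
  · exact h4
  · exact c.std v (by simp [h1, hv])

lemma IsLower.exists_match {c' : Cell lt I} (h : IsLower c') : ∃ c, barMatching lt I c c' := by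
  obtain ⟨p, q, w, h1, h2, h3, h4⟩ := h
  obtain ⟨a, b, rfl, ha⟩ := exists_isMinOverlap h3
  have hw : a * b ∈ stdWords lt I := c'.std _ (by simp [h1])
  have hb : b ≠ 1 := by
    rintro rfl
    rw [mul_one] at h4
    exact h4 ha
  have hp : ∀ w ∈ p, w ∈ stdWords lt I := fun w hw => c'.std w (by simp [h1, hw])
  refine ⟨Cell.mk (p ++ a :: b :: q) ?_, (barMatching_iff _ _).2 ⟨p, q, a, b, rfl, h1, h2, ha⟩⟩
  intro v hv
  simp only [List.mem_append, List.mem_cons] at hv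
  rcases hv with hv | rfl | rfl | hv
  · exact hp v hv
  · exact stdWords_of_mul (p := 1) (q := b) (by simpa using hw.1)
      (ha.ne_one (lastOr_mem none_std hp))
  · exact stdWords_of_mul (p := a) (q := 1) (by simpa using hw.1) hb
  · exact c'.std v (by simp [h1, hv])

/-- An upper cell in the form in which it is compared with a splitting of the entries at the first
entry that is not a minimal overlap. -/
lemma isUpper_split {c : Cell lt I} {p q : List (Word n)} {a b : Word n}
    (hc : c.entries = p ++ a :: b :: q) (h2 : MinChain lt I none p)
    (h3 : IsMinOverlap lt I (lastOr none p) a) (h4 : a * b ∈ stdWords lt I) :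
    c.entries = (p ++ [a]) ++ b :: q ∧ MinChain lt I none (p ++ [a]) ∧
      ¬ Overlap lt I (lastOr none (p ++ [a])) b := by
  refine ⟨by simp [hc], ?_, ?_⟩
  · rw [minChain_append]
    exact ⟨h2, h3, trivial⟩
  · rw [lastOr_append_singleton]
    exact h4.1

/-- The first entry that is not a minimal overlap is no overlap at all in an upper cell, but is an
overlap in a lower one. -/
lemma IsUpper.not_isLower {c : Cell lt I} (h : IsUpper c) : ¬ IsLower c := by
  rintro ⟨p', q', w, h1', h2', h3', h4'⟩
  obtain ⟨p, q, a, b, h1, h2, h3, h4⟩ := h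
  obtain ⟨e1, e2, e3⟩ := isUpper_split h1 h2 h3 h4
  obtain ⟨rfl, rfl, rfl⟩ := minChain_split_unique e2 h2' (fun h => e3 h.1) h4'
    (e1.symm.trans h1')
  exact e3 h3'

lemma match_right_unique {c c' d' : Cell lt I} (h : barMatching lt I c c')
    (h' : barMatching lt I c d') : c' = d' := by
  have hd := (barMatching_iff _ _).1 h'
  have hc := (barMatching_iff _ _).1 h
  obtain ⟨p, q, a, b, h1, h2, h3, h4⟩ := hc
  obtain ⟨p', q', a', b', h1', h2', h3', h4'⟩ := hd
  have hs : a * b ∈ stdWords lt I := c'.std _ (by simp [h2])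
  have hs' : a' * b' ∈ stdWords lt I := d'.std _ (by simp [h2'])
  obtain ⟨e1, e2, e3⟩ := isUpper_split h1 h3 h4 hs
  obtain ⟨e1', e2', e3'⟩ := isUpper_split h1' h3' h4' hs'
  obtain ⟨f1, rfl, rfl⟩ := minChain_split_unique e2 e2' (fun h => e3 h.1) (fun h => e3' h.1)
    (e1.symm.trans e1')
  obtain ⟨rfl, f2⟩ := List.append_inj' f1 rfl
  obtain ⟨rfl, -⟩ := List.cons.inj f2
  exact Cell.ext (h2.trans h2'.symm)

lemma match_left_unique {c d c' : Cell lt I} (h : barMatching lt I c c')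
    (h' : barMatching lt I d c') : c = d := by
  have hd := (barMatching_iff _ _).1 h'
  have hc := (barMatching_iff _ _).1 h
  obtain ⟨p, q, a, b, h1, h2, h3, h4⟩ := hc
  obtain ⟨p', q', a', b', h1', h2', h3', h4'⟩ := hd
  have hb : b ≠ 1 := (c.std b (by simp [h1])).2
  have hb' : b' ≠ 1 := (d.std b' (by simp [h1'])).2
  obtain ⟨rfl, f2, rfl⟩ := minChain_split_unique h3 h3' (not_isMinOverlap_mul h4.1 hb)
    (not_isMinOverlap_mul h4'.1 hb') (h2.symm.trans h2')
  obtain ⟨rfl, rfl⟩ := h4.unique h4' f2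
  exact Cell.ext (h1.trans h1'.symm)

/-- The first entry that is not a minimal overlap decides: if it is an overlap, the cell is lower;
otherwise its product with the preceding entry is standard, and the cell is upper. -/
lemma isUpper_or_isLower_or_minChain (c : Cell lt I) :
    IsUpper c ∨ IsLower c ∨ MinChain lt I none c.entries := by
  rcases minChain_or_exists (lt := lt) (I := I) none c.entries with h | ⟨p, w, q, h1, h2, h3⟩
  · exact Or.inr (Or.inr h)
  · by_cases ho : Overlap lt I (lastOr none p) w
    · exact Or.inr (Or.inl ⟨p, q, w, h1, h2, ho, h3⟩)
    · left
      rcases List.eq_nil_or_concat p with rfl | ⟨p', a, rfl⟩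
      -- The entry cannot be the first one: at the beginning every word other than 1 counts as an
      -- overlap.
      · exact absurd (c.std w (by simp [h1])).2 ho
      · rw [List.concat_eq_append] at h1 h2 ho
        rw [lastOr_append_singleton] at ho
        rw [minChain_append] at h2
        refine ⟨p', q, a, w, by simpa using h1, h2.1, h2.2.1, ho, ?_⟩
        exact prod_ne_one_of_pair (c.std a (by simp [h1])) w

lemma minChain_not_isUpper {c : Cell lt I} (h : MinChain lt I none c.entries) : ¬ IsUpper c := by
  rintro ⟨p, q, a, b, h1, h2, h3, h4⟩
  rw [h1, minChain_append] at h
  exact h4.1 h.2.2.1.1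

lemma minChain_not_isLower {c : Cell lt I} (h : MinChain lt I none c.entries) : ¬ IsLower c := by
  rintro ⟨p, q, w, h1, h2, h3, h4⟩
  rw [h1, minChain_append] at h
  exact h4 h.2.1

lemma isCritical_iff_minChain (c : Cell lt I) :
    IsCritical (barMatching lt I) c ↔ MinChain lt I none c.entries := by
  constructor
  · intro h
    rcases isUpper_or_isLower_or_minChain c with h' | h' | h'
    · obtain ⟨c', hc'⟩ := h'.exists_match
      exact absurd hc' (h c').1
    · obtain ⟨c', hc'⟩ := h'.exists_match
      exact absurd hc' (h c').2
    · exact h'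
  · intro h c'
    exact ⟨fun hm => minChain_not_isUpper h (isUpper_of_match hm),
      fun hm => minChain_not_isLower h (isLower_of_match hm)⟩

end Matching

/-! ### Acyclicity via a potential; unmatched cells are the fully attached tuples. -/

section Acyclic

variable {k : Type*} [Field k] {n : ℕ} {lt : Word n → Word n → Prop} {I : Ideal (NCPoly k n)}

/-! ### Acyclicity of the matching -/

/-- The length of the longest initial chain of minimal overlaps of the tuple, after the tuple has
been replaced by its partner if it is lower. -/
def depth (lt : Word n → Word n → Prop) (I : Ideal (NCPoly k n)) :
    Option (Word n) → List (Word n) → ℕ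
  | _, [] => 0
  | prev, w :: c => if IsMinOverlap lt I prev w then depth lt I (some w) c + 1
      else if Overlap lt I prev w then 1 else 0

/-- `1` for the lower tuples and `0` for the others. -/
def lowerFlag (lt : Word n → Word n → Prop) (I : Ideal (NCPoly k n)) :
    Option (Word n) → List (Word n) → ℕ
  | _, [] => 0
  | prev, w :: c => if IsMinOverlap lt I prev w then lowerFlag lt I (some w) c
      else if Overlap lt I prev w then 1 else 0

lemma depth_le_length (prev : Option (Word n)) (c : List (Word n)) :
    depth lt I prev c ≤ c.length := by
  induction c generalizing prev with
  | nil => simp [depth]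
  | cons w c ih =>
    rw [depth, List.length_cons]
    have := ih (some w)
    split_ifs <;> omega

lemma depth_append {prev : Option (Word n)} {p : List (Word n)} (hp : MinChain lt I prev p)
    (c : List (Word n)) : depth lt I prev (p ++ c) = p.length + depth lt I (lastOr prev p) c := by
  induction p generalizing prev with
  | nil => simp
  | cons w p ih =>
    rw [List.cons_append, depth, if_pos hp.1, ih hp.2, List.length_cons, lastOr]
    omega

lemma lowerFlag_append {prev : Option (Word n)} {p : List (Word n)} (hp : MinChain lt I prev p)
    (c : List (Word n)) : lowerFlag lt I prev (p ++ c) = lowerFlag lt I (lastOr prev p) c := by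
  induction p generalizing prev with
  | nil => simp
  | cons w p ih => rw [List.cons_append, lowerFlag, if_pos hp.1, ih hp.2, lastOr]

variable [I.IsTwoSided] [Setting lt I]

/-- A merge to the right of the first entry that breaks the chain changes nothing. At that entry x,
merging either keeps the state of x or turns a non-overlap into an overlap, which can only lengthen
the initial chain. -/
lemma depth_merge {prev : Option (Word n)} {p q : List (Word n)} {x y : Word n} (hy : y ≠ 1)
    (h : ¬ (MinChain lt I prev p ∧ IsMinOverlap lt I (lastOr prev p) x)) :
    depth lt I prev (p ++ x :: y :: q) < depth lt I prev (p ++ (x * y) :: q) ∨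
      (depth lt I prev (p ++ x :: y :: q) = depth lt I prev (p ++ (x * y) :: q) ∧
        lowerFlag lt I prev (p ++ x :: y :: q) = lowerFlag lt I prev (p ++ (x * y) :: q)) := by
  induction p generalizing prev with
  | nil =>
    have hx : ¬ IsMinOverlap lt I prev x := fun hx => h ⟨trivial, hx⟩
    simp only [List.nil_append, depth, lowerFlag, if_neg hx]
    by_cases ho : Overlap lt I prev x
    · rw [if_neg (not_isMinOverlap_mul ho hy), if_pos ho, if_pos (ho.mul y)]
      simp [not_isMinOverlap_mul ho hy]
    · rw [if_neg ho]
      by_cases h1 : IsMinOverlap lt I prev (x * y)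
      · rw [if_pos h1]
        left
        exact Nat.succ_pos _
      · rw [if_neg h1, if_neg h1]
        split_ifs <;> simp
  | cons w p ih =>
    by_cases hw : IsMinOverlap lt I prev w
    · have := ih (prev := some w) fun h' => h ⟨⟨hw, h'.1⟩, h'.2⟩
      simp only [List.cons_append, depth, lowerFlag, if_pos hw]
      omega
    · simp [List.cons_append, depth, lowerFlag, if_neg hw]

/-- The potential that decreases along the edges of the graph `G_M`. -/
def potential (c : Cell lt I) : ℕ ×ₗ ℕ ×ₗ ℕ :=
  -- Depth is at most the number of entries and so at most the length of the word; the subtraction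
  -- is not truncated. For a matched pair whose upper cell has l entries the last component is 2l
  -- above and 2((l-1)+1)+1 below, so a reversed edge lowers it by 1. An unmatched merge either
  -- raises the depth or lowers the last component by 2.
  toLex (rank lt c.word, toLex (c.word.length - depth lt I none c.entries,
    2 * (c.entries.length + lowerFlag lt I none c.entries) + lowerFlag lt I none c.entries))

lemma length_le_length_prod {c : List (Word n)} (h : ∀ w ∈ c, w ≠ 1) :
    c.length ≤ c.prod.length := by
  induction c with
  | nil => simp
  | cons w c ih =>
    rw [List.prod_cons, FreeMonoid.length_mul, List.length_cons]
    have h1 := length_pos_of_ne_one (h w (by simp))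
    have h2 := ih fun v hv => h v (by simp [hv])
    omega

lemma Cell.length_le_word (c : Cell lt I) : c.entries.length ≤ c.word.length :=
  length_le_length_prod fun w hw => (c.std w hw).2

lemma potential_lt {c d : Cell lt I} (h1 : rank lt c.word < rank lt d.word ∨ (c.word = d.word ∧
    (depth lt I none d.entries < depth lt I none c.entries ∨
      (depth lt I none d.entries = depth lt I none c.entries ∧
      2 * (c.entries.length + lowerFlag lt I none c.entries) + lowerFlag lt I none c.entries <
      2 * (d.entries.length + lowerFlag lt I none d.entries) + lowerFlag lt I none d.entries)))) :
    potential c < potential d := by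
  unfold potential
  rw [Prod.Lex.toLex_lt_toLex]
  rcases h1 with h1 | ⟨h1, h2⟩
  · exact Or.inl h1
  · refine Or.inr ⟨congrArg (rank lt) h1, ?_⟩
    change toLex _ < toLex _
    rw [Prod.Lex.toLex_lt_toLex]
    simp only
    have hc := depth_le_length (lt := lt) (I := I) none c.entries
    have hcl := c.length_le_word
    rw [← h1]
    omega

lemma potential_lt_of_match {c c' : Cell lt I} (h : barMatching lt I c c') :
    potential c < potential c' := by
  obtain ⟨p, q, a, b, h1, h2, h3, h4⟩ := (barMatching_iff _ _).1 h
  have hs : a * b ∈ stdWords lt I := c'.std _ (by simp [h2])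
  have hb : b ∈ stdWords lt I := c.std _ (by simp [h1])
  have hb' : ¬ Overlap lt I (some a) b := hs.1
  have hb'' : ¬ IsMinOverlap lt I (some a) b := fun h => hb' h.1
  have hab := not_isMinOverlap_mul h4.1 hb.2
  refine potential_lt (Or.inr ⟨(word_eq_of_merge h1 h2).symm, Or.inr ?_⟩)
  rw [h1, h2, depth_append h3, depth_append h3, lowerFlag_append h3, lowerFlag_append h3]
  simp only [depth, lowerFlag, if_pos h4, if_neg hb', if_neg hb'', if_neg hab, if_pos (h4.1.mul b),
    List.length_append, List.length_cons]
  exact ⟨trivial, by omega⟩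

lemma potential_lt_of_edge {c d : Cell lt I} (h : barWeight lt I c d ≠ 0)
    (hm : ¬ barMatching lt I c d) : potential d < potential c := by
  rcases edge_cases h with h | ⟨p, a, b, q, h1, h2⟩
  · exact potential_lt (Or.inl h)
  · refine potential_lt (Or.inr ⟨word_eq_of_merge h1 h2, ?_⟩)
    have hb : b ∈ stdWords lt I := c.std _ (by simp [h1])
    have h3 : ¬ (MinChain lt I none p ∧ IsMinOverlap lt I (lastOr none p) a) := fun h' =>
      hm ((barMatching_iff _ _).2 ⟨p, q, a, b, h1, h2, h'⟩)
    have h4 := depth_merge (q := q) hb.2 h3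
    rw [← h1, ← h2] at h4
    have h5 := edge_length h
    omega

lemma potential_lt_of_morseEdge {c d : Cell lt I}
    (h : MorseEdge (barWeight lt I) (barMatching lt I) c d) : potential d < potential c := by
  rcases h with ⟨h1, h2⟩ | h
  · exact potential_lt_of_edge h1 h2
  · exact potential_lt_of_match h

lemma barWeight_match {c c' : Cell lt I} (h : barMatching lt I c c') :
    ∃ m : ℕ, barWeight lt I c c' = algebraMap k _ ((-1) ^ m) := by
  obtain ⟨p, q, a, b, h1, h2, h3, h4⟩ := (barMatching_iff _ _).1 h
  exact ⟨_, barWeight_merge h1 h2⟩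

lemma isUnit_barWeight {c c' : Cell lt I} (h : barMatching lt I c c') :
    IsUnit (barWeight lt I c c') := by
  obtain ⟨m, hm⟩ := barWeight_match h
  rw [hm]
  exact (IsUnit.pow m (by simp)).map _

variable (lt I) in
theorem isAcyclicMatching : IsAcyclicMatching (barWeight lt I) (barMatching lt I) where
  edge c c' h := by
    obtain ⟨p, q, a, b, h1, h2, h3, h4⟩ := (barMatching_iff _ _).1 h
    exact barWeight_merge_ne_zero h1 h2
  matching c c' d d' h h' := by
    rintro (rfl | rfl | rfl | rfl)
    · exact ⟨rfl, match_right_unique h h'⟩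
    · exact absurd (isLower_of_match h') (isUpper_of_match h).not_isLower
    · exact absurd (isLower_of_match h) (isUpper_of_match h').not_isLower
    · exact ⟨match_left_unique h h', rfl⟩
  invertible c c' h := by
    refine ⟨isUnit_barWeight h, ?_⟩
    obtain ⟨m, hm⟩ := barWeight_match h
    rw [hm, Subring.mem_center_iff]
    exact fun g => mul_algebraMap_comm g _
  acyclic c h := by
    have : ∀ d, Relation.TransGen (MorseEdge (barWeight lt I) (barMatching lt I)) c d →
        potential d < potential c := by
      intro d hd
      induction hd with
      | single h => exact potential_lt_of_morseEdge h
      | tail _ h ih => exact (potential_lt_of_morseEdge h).trans ih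
    exact lt_irrefl _ (this c h)

/-! ### Fully attached tuples are the chains of minimal overlaps -/

lemma minChain_some_iff (a : Word n) (c : List (Word n)) : MinChain lt I (some a) c ↔
    ∀ i < c.length, IsMinOverlap lt I (some ((a :: c).getD i 1)) (c.getD i 1) := by
  induction c generalizing a with
  | nil => simp [MinChain]
  | cons w c ih =>
    rw [MinChain, ih]
    constructor
    · rintro ⟨h1, h2⟩ i hi
      cases i with
      | zero => simpa using h1
      | succ i => simpa using h2 i (by simpa using hi)
    · intro h
      refine ⟨by simpa using h 0 (by simp), fun i hi => ?_⟩
      simpa using h (i + 1) (by simpa using hi)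

lemma isMinOverlap_none_iff {w : Word n} : IsMinOverlap lt I none w ↔ w.length = 1 := by
  constructor
  · rintro ⟨h1, h2⟩
    induction w using FreeMonoid.casesOn with
    | one => exact absurd rfl h1
    | of_mul x xs =>
      by_cases hx : xs = 1
      · simp [hx]
      · exact absurd (FreeMonoid.of_ne_one x) (h2 (FreeMonoid.of x) ⟨xs, hx, rfl⟩)
  · intro h
    refine ⟨fun h1 => ?_, fun v hv hv1 => ?_⟩
    · rw [h1] at h
      simp at h
    · have h2 := hv.length_lt
      have := length_pos_of_ne_one hv1
      omega

/-- Take the shortest suffix w of x for which wy is initial. An initial factor of wy must reach the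
right end, since y is a minimal overlap and x is standard; it must reach the left end, since w is
shortest and y is standard. -/
lemma exists_minGen_suffix {x y : Word n} (hx : x ∉ initialWords lt I) (hy : y ∉ initialWords lt I)
    (hxy : IsMinOverlap lt I (some x) y) : ∃ v w, x = v * w ∧ w * y ∈ minGen lt I := by
  have hex : ∃ l : ℕ, ∃ v w : Word n, x = v * w ∧ w * y ∈ initialWords lt I ∧ w.length = l :=
    ⟨_, 1, x, (one_mul x).symm, hxy.1, rfl⟩
  obtain ⟨v, w, rfl, hw, hl⟩ := Nat.find_spec hex
  refine ⟨v, w, rfl, hw, fun m hm hmf => ?_⟩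
  obtain ⟨p, q, hpq⟩ := hmf
  -- Otherwise a proper prefix of xy = vwy is initial, and it ends either inside x or after a proper
  -- prefix of y.
  have hq : q = 1 := by
    by_contra hq
    have h1 : w * y = (p * m) * q := hpq
    have hpm := mul_left_mem_initialWords p hm
    rcases mul_eq_mul_cases h1 with ⟨h2, -⟩ | ⟨r, hr, h2⟩ | ⟨r, hr, h2⟩
    · rw [← h2] at hpm
      exact hx (mul_left_mem_initialWords v hpm)
    · have h3 : y = r * q := by
        rw [← h2, mul_assoc] at h1
        exact mul_left_cancel h1
      refine hxy.2 r ⟨q, hq, h3.symm⟩ ?_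
      change v * w * r ∈ _
      rw [mul_assoc, h2]
      exact mul_left_mem_initialWords v hpm
    · refine hx ?_
      rw [← h2]
      exact mul_left_mem_initialWords v (mul_right_mem_initialWords r hpm)
  subst hq
  rw [mul_one] at hpq
  -- Otherwise m lies inside y, or it starts inside w and gives a shorter suffix.
  have hp : p = 1 := by
    by_contra hp
    have hppos := length_pos_of_ne_one hp
    rcases mul_eq_mul_cases hpq with ⟨-, h2⟩ | ⟨r, hr, h2⟩ | ⟨r, hr, h2⟩
    · exact hy (h2 ▸ hm)
    · have h3 : y = r * m := by
        rw [← h2, mul_assoc] at hpq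
        exact mul_left_cancel hpq
      exact hy (h3 ▸ mul_left_mem_initialWords r hm)
    · have h3 : r * y = m := by
        rw [← h2, mul_assoc] at hpq
        exact mul_left_cancel hpq
      refine Nat.find_min hex (m := r.length) ?_ ⟨v * p, r, by rw [mul_assoc, h2], h3 ▸ hm, rfl⟩
      rw [← hl, ← h2, FreeMonoid.length_mul]
      omega
  rw [hpq, hp, one_mul]

/-- The standardness of v_j w_j p for proper prefixes p is the minimality of an overlap. The minimal
generators make the overlaps initial; conversely they are recovered from suffixes of the preceding
entries by `exists_minGen_suffix`. -/
lemma isFullyAttached_iff (c : Cell lt I) :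
    IsFullyAttached lt I c.entries ↔ MinChain lt I none c.entries := by
  constructor
  · rintro (h | ⟨i, h⟩ | ⟨r, u, v, w, hr, h1, h2, h3, h4, h5⟩)
    · rw [h]
      trivial
    · rw [h]
      exact ⟨isMinOverlap_none_iff.2 (by simp), trivial⟩
    · rw [h5]
      refine ⟨isMinOverlap_none_iff.2 h3, ?_⟩
      rw [minChain_some_iff]
      intro i hi
      simp only [List.length_map, List.length_range] at hi
      have hti : ∀ j < r, ((List.range r).map fun j => v j * w j).getD j 1 = v j * w j := by
        intro j hj
        simp [List.getD_eq_getElem?_getD, hj]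
      rw [hti i hi]
      cases i with
      | zero =>
        rw [List.getD_cons_zero]
        have hm := h1 0 hi
        rw [mul_assoc] at hm
        refine ⟨hm.1, fun p hp ho => ?_⟩
        obtain ⟨s, hs, hps⟩ := hp
        have := hm.2 _ ho ⟨1, s, by rw [one_mul, mul_assoc, hps]⟩
        rw [← hps] at this
        have h6 := mul_left_cancel this
        exact hs (by simpa using h6)
      | succ i =>
        rw [List.getD_cons_succ, hti i (by omega)]
        refine ⟨?_, fun p hp ho => ?_⟩
        · have hm := (h1 (i + 1) hi).1
          rw [h2 i hi] at hm
          change v i * w i * _ ∈ _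
          rw [mul_assoc (v i)]
          refine mul_left_mem_initialWords _ ?_
          rwa [← mul_assoc]
        · exact (h4 i hi p hp).1 ho
  · intro h
    rcases hc : c.entries with _ | ⟨a, c'⟩
    · exact Or.inl rfl
    · right
      rw [hc] at h
      obtain ⟨ha, hc'⟩ := h
      have ha1 := isMinOverlap_none_iff.1 ha
      rcases Nat.eq_zero_or_pos c'.length with h0 | h0
      · left
        rw [List.length_eq_zero_iff] at h0
        obtain ⟨m, rfl⟩ := FreeMonoid.length_eq_one.1 ha1
        exact ⟨m, by rw [h0]⟩
      · right
        rw [minChain_some_iff] at hc'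
        have hstd : ∀ i, i < (a :: c').length → (a :: c').getD i 1 ∈ stdWords lt I := by
          intro i hi
          rw [List.getD_eq_getElem _ _ hi]
          exact c.std _ (by rw [hc]; exact List.getElem_mem hi)
        have hex : ∀ i, ∃ v w : Word n, i < c'.length → (a :: c').getD i 1 = v * w ∧
            w * c'.getD i 1 ∈ minGen lt I := by
          intro i
          by_cases hi : i < c'.length
          · have h1 := hstd i (by simp; omega)
            have h2 := hstd (i + 1) (by simpa using hi)
            rw [List.getD_cons_succ] at h2
            obtain ⟨v, w, h⟩ := exists_minGen_suffix h1.1 h2.1 (hc' i hi)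
            exact ⟨v, w, fun _ => h⟩
          -- Arbitrary values beyond the end of the tuple.
          · exact ⟨1, 1, fun h => absurd h hi⟩
        choose V W hVW using hex
        have hfac : ∀ j < c'.length,
            (if j + 1 < c'.length then V (j + 1) else 1) *
              (if j + 1 < c'.length then W (j + 1) else c'.getD j 1) = c'.getD j 1 := by
          intro j hj
          split_ifs with hj1
          · rw [← (hVW (j + 1) hj1).1, List.getD_cons_succ]
          · rw [one_mul]
        -- Each entry is cut where the generator shared with its successor begins. The last entry
        -- has no successor and is left whole, with v = 1.
        refine ⟨c'.length, fun j => if j = 0 then a else W j,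
          fun j => if j + 1 < c'.length then V (j + 1) else 1,
          fun j => if j + 1 < c'.length then W (j + 1) else c'.getD j 1, h0, ?_, ?_, by simpa, ?_, ?_⟩
        · intro j hj
          simp only
          rw [mul_assoc, hfac j hj]
          have h1 := hVW j hj
          split_ifs with hj0
          -- The first entry a is a letter and its suffix W 0 is not 1, so W 0 is all of a.
          · subst hj0
            have h2 := hstd 1 (by simp; omega)
            rw [List.getD_cons_succ] at h2
            have h3 : (V 0) * (W 0) = a := by simpa using h1.1.symm
            have h4 : W 0 ≠ 1 := by
              intro h4
              rw [h4, one_mul] at h1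
              exact h2.1 h1.2.1
            have h5 := length_pos_of_ne_one h4
            have h6 : V 0 = 1 := by
              rw [← FreeMonoid.length_eq_zero]
              rw [← h3, FreeMonoid.length_mul] at ha1
              omega
            rw [h6, one_mul] at h3
            rw [← h3]
            exact h1.2
          · exact h1.2
        · intro j hj
          simp [hj]
        · intro j hj p hp
          simp only at hp ⊢
          rw [hfac j (by omega)]
          rw [hfac (j + 1) hj] at hp
          have h1 := hc' (j + 1) hj
          rw [List.getD_cons_succ] at h1
          have h2 := hstd (j + 1) (by simp; omega)
          rw [List.getD_cons_succ] at h2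
          exact ⟨h1.2 p hp, prod_ne_one_of_pair h2 p⟩
        · congr 1
          refine List.ext_getElem (by simp) fun i hi hi' => ?_
          rw [List.getElem_map, List.getElem_range, hfac i hi, List.getD_eq_getElem]

theorem isCritical_iff (c : Cell lt I) :
    IsCritical (barMatching lt I) c ↔ IsFullyAttached lt I c.entries := by
  rw [isFullyAttached_iff, isCritical_iff_minChain]

end Acyclic

/-! ### Path sums, the Morse complex, and the chain map onto it. -/

section Paths

variable {k : Type*} [Field k] {n : ℕ} {lt : Word n → Word n → Prop} {I : Ideal (NCPoly k n)}
variable [I.IsTwoSided] [Setting lt I]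

/-! ### Paths in the graph `G_M` -/

variable (lt I) in
/-- The edges of `G_M`. -/
abbrev BarEdge (c d : Cell lt I) : Prop := MorseEdge (barWeight lt I) (barMatching lt I) c d

variable (lt I) in
/-- The path sums in `G_M`. -/
abbrev barPathSum (c d : Cell lt I) : NCPoly k n ⧸ I :=
  pathSum (barWeight lt I) (barMatching lt I) c d

lemma finite_barEdge (c : Cell lt I) : {d | BarEdge lt I c d}.Finite := by
  have h1 : {d : Cell lt I | barMatching lt I d c}.Finite :=
    Set.Subsingleton.finite fun d hd d' hd' => match_left_unique hd hd'
  refine ((cellBoundary c).hasFiniteSupport.union h1).subset ?_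
  rintro d (⟨h, -⟩ | h)
  · left
    rw [Function.mem_support, cellBoundary_apply]
    exact h
  · exact Or.inr h

/-- The graph is locally finite, and the potential is well-founded and drops along edges. -/
lemma finite_paths_from (c : Cell lt I) :
    {p : List (Cell lt I) | p.IsChain (BarEdge lt I) ∧ p.head? = some c}.Finite := by
  induction hp : potential c using WellFoundedLT.induction generalizing c with
  | _ m ih =>
    subst hp
    refine ((Set.finite_singleton [c]).union ((finite_barEdge c).biUnion fun d hd =>
      (ih _ (potential_lt_of_morseEdge hd) d rfl).image (List.cons c))).subset ?_
    rintro p ⟨h1, h2⟩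
    rcases p with _ | ⟨a, _ | ⟨d, p⟩⟩
    · simp at h2
    · left
      simpa using h2
    · right
      simp only [List.head?_cons, Option.some.injEq] at h2
      subst h2
      rw [List.isChain_cons_cons] at h1
      exact Set.mem_biUnion h1.1 ⟨d :: p, ⟨h1.2, rfl⟩, rfl⟩

lemma finite_isPath (c d : Cell lt I) :
    {p | IsPath (barWeight lt I) (barMatching lt I) c d p}.Finite :=
  (finite_paths_from c).subset fun _ hp => ⟨hp.1, hp.2.1⟩

lemma isPath_set_eq (c f : Cell lt I) :
    {p | IsPath (barWeight lt I) (barMatching lt I) c f p} =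
      {p | p = [c] ∧ c = f} ∪ ⋃ d ∈ {d | BarEdge lt I c d},
        List.cons c '' {p | IsPath (barWeight lt I) (barMatching lt I) d f p} := by
  ext p
  simp only [Set.mem_union, Set.mem_iUnion, Set.mem_image, Set.mem_ofPred_eq, exists_prop]
  constructor
  · rintro ⟨h1, h2, h3⟩
    rcases p with _ | ⟨a, _ | ⟨d, p⟩⟩
    · simp at h2
    · left
      simp only [List.head?_cons, Option.some.injEq, List.getLast?_singleton] at h2 h3
      exact ⟨by rw [h2], h2.symm.trans h3⟩
    · right
      simp only [List.head?_cons, Option.some.injEq] at h2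
      subst h2
      rw [List.isChain_cons_cons] at h1
      refine ⟨d, h1.1, d :: p, ⟨h1.2, rfl, ?_⟩, rfl⟩
      rwa [List.getLast?_cons_cons] at h3
  · rintro (⟨rfl, rfl⟩ | ⟨d, hd, p, ⟨h1, h2, h3⟩, rfl⟩)
    · exact ⟨by simp, rfl, rfl⟩
    · rcases p with _ | ⟨a, p⟩
      · simp at h2
      · simp only [List.head?_cons, Option.some.injEq] at h2
        subst h2
        exact ⟨List.isChain_cons_cons.2 ⟨hd, h1⟩, rfl, by rwa [List.getLast?_cons_cons]⟩

/-- The decomposition of the paths by their first edge. -/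
lemma pathSum_eq (c f : Cell lt I) : barPathSum lt I c f = (if c = f then 1 else 0) +
    ∑ᶠ d ∈ {d | BarEdge lt I c d},
      edgeWeight (barWeight lt I) (barMatching lt I) c d * barPathSum lt I d f := by
  have hfin : ∀ d ∈ {d | BarEdge lt I c d}, (List.cons c ''
      {p | IsPath (barWeight lt I) (barMatching lt I) d f p}).Finite :=
    fun d _ => (finite_isPath d f).image _
  have hhead : ∀ {d : Cell lt I} {p : List (Cell lt I)},
      IsPath (barWeight lt I) (barMatching lt I) d f p → ∃ q, p = d :: q := by
    rintro d (_ | ⟨a, p⟩) ⟨-, h2, -⟩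
    · simp at h2
    · simp only [List.head?_cons, Option.some.injEq] at h2
      exact ⟨p, by rw [h2]⟩
  have hdisj : Disjoint {p : List (Cell lt I) | p = [c] ∧ c = f} (⋃ d ∈ {d | BarEdge lt I c d},
      List.cons c '' {p | IsPath (barWeight lt I) (barMatching lt I) d f p}) := by
    rw [Set.disjoint_left]
    rintro p ⟨rfl, -⟩ hp
    simp only [Set.mem_iUnion, Set.mem_image, Set.mem_ofPred_eq, exists_prop] at hp
    obtain ⟨d, -, p, hp, he⟩ := hp
    obtain ⟨q, rfl⟩ := hhead hp
    simp at he
  rw [barPathSum, pathSum, isPath_set_eq, finsum_mem_union hdisj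
    ((Set.finite_singleton [c]).subset fun p hp => hp.1)
    ((finite_barEdge c).biUnion hfin)]
  congr 1
  · split_ifs with h
    · simp only [h, and_true]
      rw [Set.ofPred_eq_eq_singleton, finsum_mem_singleton]
      rfl
    · simp [h]
  · rw [finsum_mem_biUnion _ (finite_barEdge c) hfin]
    · refine finsum_mem_congr rfl fun d _ => ?_
      rw [finsum_mem_image (List.cons_injective.injOn), barPathSum, pathSum]
      change _ = (AddMonoidHom.mulLeft _) _
      rw [AddMonoidHom.map_finsum_mem _ _ (finite_isPath d f)]
      refine finsum_mem_congr rfl fun p hp => ?_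
      obtain ⟨q, rfl⟩ := hhead hp
      rfl
    · intro d _ d' _ hne
      change Disjoint _ _
      rw [Set.disjoint_left]
      rintro _ ⟨p, hp, rfl⟩ ⟨p', hp', he⟩
      rw [(List.cons_injective he)] at hp'
      obtain ⟨q, rfl⟩ := hhead hp
      obtain ⟨q', hq'⟩ := hhead hp'
      exact hne (List.cons.inj hq').1

lemma match_length {c c' : Cell lt I} (h : barMatching lt I c c') :
    c.entries.length = c'.entries.length + 1 :=
  ((barMatching_iff _ _).1 h).length

/-- There are no paths to critical cells of too large a degree. -/
lemma pathSum_eq_zero {f : Cell lt I} (hf : MinChain lt I none f.entries) (c : Cell lt I)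
    (h : c.entries.length < f.entries.length ∨
      (¬ IsLower c ∧ c ≠ f ∧ c.entries.length ≤ f.entries.length)) :
    barPathSum lt I c f = 0 := by
  induction hp : potential c using WellFoundedLT.induction generalizing c with
  | _ m ih =>
    subst hp
    have hcf : c ≠ f := by
      rintro rfl
      rcases h with h | h
      · exact lt_irrefl _ h
      · exact h.2.1 rfl
    rw [pathSum_eq, if_neg hcf, zero_add]
    refine finsum_mem_eq_zero_of_forall_eq_zero fun d hd => ?_
    rw [ih _ (potential_lt_of_morseEdge hd) d _ rfl, mul_zero]
    -- An ordinary edge lowers the degree by one and leads to the first alternative. A reversed edge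
    -- starts at a lower cell, so the first alternative held; it ends at an upper cell, for which
    -- the second holds.
    rcases hd with ⟨hd, -⟩ | hd
    · have := edge_length hd
      omega
    · have h1 := match_length hd
      have h2 := isUpper_of_match hd
      right
      refine ⟨h2.not_isLower, ?_, ?_⟩
      · rintro rfl
        exact minChain_not_isUpper hf h2
      · rcases h with h | h
        · omega
        · exact absurd (isLower_of_match hd) h.1

lemma pathSum_of_not_isLower {c : Cell lt I} (hc : ¬ IsLower c) (f : Cell lt I) :
    barPathSum lt I c f = (if c = f then 1 else 0) +
      ∑ d ∈ (cellBoundary c).support with ¬ barMatching lt I c d,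
        barWeight lt I c d * barPathSum lt I d f := by
  rw [pathSum_eq]
  congr 1
  have hset : {d | BarEdge lt I c d} =
      ↑((cellBoundary c).support.filter fun d => ¬ barMatching lt I c d) := by
    ext d
    simp only [Set.mem_ofPred_eq, Finset.coe_filter, Finsupp.mem_support_iff, cellBoundary_apply]
    exact ⟨fun h => h.resolve_right fun h' => hc (isLower_of_match h'), Or.inl⟩
  rw [hset, finsum_mem_coe_finset]
  refine Finset.sum_congr rfl fun d _ => ?_
  rw [edgeWeight, if_neg fun h' => hc (isLower_of_match h')]

/-- Any other first edge drops to a degree from which f cannot be reached, so every path to f starts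
with the reversed edge. -/
lemma pathSum_of_isLower {c c' : Cell lt I} (h : barMatching lt I c c') {f : Cell lt I}
    (hf : MinChain lt I none f.entries) (hl : f.entries.length = c'.entries.length) :
    barPathSum lt I c' f = -Ring.inverse (barWeight lt I c c') * barPathSum lt I c f := by
  rw [pathSum_eq, if_neg, zero_add, finsum_eq_single _ c]
  · rw [finsum_eq_if, if_pos (show c ∈ {d | BarEdge lt I c' d} from Or.inr h), edgeWeight, if_pos h]
  · intro d hne
    rw [finsum_eq_if, ite_eq_right_iff]
    intro hd
    rcases hd with ⟨hd, -⟩ | hd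
    · have := edge_length hd
      rw [pathSum_eq_zero hf d (by omega), mul_zero]
    · exact absurd (match_left_unique hd h) hne
  · rintro rfl
    exact minChain_not_isLower hf (isLower_of_match h)

/-! ### The projection of the bar resolution to the Morse complex -/

variable {l : ℕ}

/-- The cell of a fully attached tuple. -/
def Chain.cell (f : Chain lt I l) : Cell lt I := f.1

lemma Chain.length_cell (f : Chain lt I l) : f.cell.entries.length = l := f.2.2

lemma Chain.minChain (f : Chain lt I l) : MinChain lt I none f.cell.entries :=
  (isFullyAttached_iff f.cell).1 f.2.1

@[ext] lemma Chain.ext {f g : Chain lt I l} (h : f.cell = g.cell) : f = g := Subtype.ext h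

/-- The fully attached tuple of a chain of minimal overlaps. -/
def Chain.mk (c : Cell lt I) (hc : MinChain lt I none c.entries) (hl : c.entries.length = l) :
    Chain lt I l := ⟨c, (isFullyAttached_iff c).2 hc, hl⟩

@[simp] lemma Chain.cell_mk (c : Cell lt I) (hc : MinChain lt I none c.entries)
    (hl : c.entries.length = l) : (Chain.mk c hc hl).cell = c := rfl

variable (l) in
/-- The sum of the path sums from `c` to the critical cells of degree `l`. -/
def pathVec (c : Cell lt I) : FreeMod lt I l :=
  ∑ᶠ f : Chain lt I l, Finsupp.single f (barPathSum lt I c f.cell)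

lemma finite_support_pathSum (c : Cell lt I) :
    {f : Chain lt I l | barPathSum lt I c f.cell ≠ 0}.Finite := by
  have h1 : ((fun p : List (Cell lt I) => p.getLast?) ''
      {p | p.IsChain (BarEdge lt I) ∧ p.head? = some c}).Finite := (finite_paths_from c).image _
  refine Set.Finite.of_finite_image (f := fun f : Chain lt I l => some f.cell)
    (h1.subset ?_) ?_
  · rintro _ ⟨f, hf, rfl⟩
    by_contra hn
    refine hf ?_
    rw [barPathSum, pathSum]
    refine finsum_mem_eq_zero_of_forall_eq_zero fun p hp => ?_
    exact absurd ⟨p, ⟨hp.1, hp.2.1⟩, hp.2.2⟩ hn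
  · intro f _ g _ h
    exact Chain.ext (Option.some.inj h)

lemma pathVec_apply (c : Cell lt I) (g : Chain lt I l) :
    pathVec l c g = barPathSum lt I c g.cell := by
  have hfin : (Function.support fun f : Chain lt I l =>
      Finsupp.single f (barPathSum lt I c f.cell)).Finite := by
    refine (finite_support_pathSum c).subset fun f hf h => hf ?_
    change Finsupp.single f _ = 0
    rw [h, Finsupp.single_zero]
  change Finsupp.applyAddHom g _ = _
  rw [pathVec, AddMonoidHom.map_finsum _ hfin]
  rw [finsum_eq_single _ g]
  · exact Finsupp.single_eq_same
  · intro f hf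
    exact Finsupp.single_eq_of_ne' hf

variable (lt I l) in
/-- The projection of the bar resolution to the Morse complex, in degree `l`. -/
def morseProj : BarMod lt I →ₗ[NCPoly k n ⧸ I] FreeMod lt I l :=
  Finsupp.linearCombination (NCPoly k n ⧸ I) fun c =>
    if c.entries.length = l then pathVec l c else 0

lemma morseProj_single (c : Cell lt I) (a : NCPoly k n ⧸ I) : morseProj lt I l (Finsupp.single c a) =
    a • if c.entries.length = l then pathVec l c else 0 := by
  rw [morseProj, Finsupp.linearCombination_single]

lemma morseProj_of_length_ne {c : Cell lt I} (h : c.entries.length ≠ l) (a : NCPoly k n ⧸ I) :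
    morseProj lt I l (Finsupp.single c a) = 0 := by
  rw [morseProj_single, if_neg h, smul_zero]

/-- A path that leaves a critical cell loses a degree at once and cannot reach a critical cell of
the old degree; only the trivial path counts. -/
lemma morseProj_chain (f : Chain lt I l) (a : NCPoly k n ⧸ I) :
    morseProj lt I l (Finsupp.single f.cell a) = Finsupp.single f a := by
  rw [morseProj_single, if_pos f.length_cell]
  have : pathVec l f.cell = Finsupp.single f 1 := by
    ext g
    rw [pathVec_apply, pathSum_of_not_isLower (minChain_not_isLower f.minChain),
      Finset.sum_eq_zero, add_zero, Finsupp.single_apply]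
    · simp only [Chain.ext_iff]
    · intro d hd
      rw [Finset.mem_filter, Finsupp.mem_support_iff, cellBoundary_apply] at hd
      have := edge_length hd.1
      have h1 := f.length_cell
      have h2 := g.length_cell
      rw [pathSum_eq_zero g.minChain d (by omega), mul_zero]
  rw [this, Finsupp.smul_single, smul_eq_mul, mul_one]

lemma morseProj_upper {c : Cell lt I} (h : IsUpper c) (a : NCPoly k n ⧸ I) :
    morseProj lt I l (Finsupp.single c a) = 0 := by
  rw [morseProj_single]
  split_ifs with hl
  · have : pathVec l c = 0 := by
      ext g
      rw [pathVec_apply, pathSum_eq_zero g.minChain c, Finsupp.zero_apply]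
      right
      refine ⟨h.not_isLower, ?_, by rw [hl, g.length_cell]⟩
      rintro rfl
      exact minChain_not_isUpper g.minChain h
    rw [this, smul_zero]
  · exact smul_zero _

lemma morseProj_apply (y : BarMod lt I) (hy : ∀ c ∈ y.support, c.entries.length = l)
    (g : Chain lt I l) : morseProj lt I l y g = ∑ c ∈ y.support, y c * barPathSum lt I c g.cell := by
  rw [morseProj, Finsupp.linearCombination_apply, Finsupp.sum, Finsupp.finsetSum_apply]
  refine Finset.sum_congr rfl fun c hc => ?_
  rw [if_pos (hy c hc), Finsupp.smul_apply, pathVec_apply, smul_eq_mul]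

lemma length_of_mem_support_cellBoundary {c : Cell lt I} (hc : c.entries.length = l + 1) :
    ∀ d ∈ (cellBoundary c).support, d.entries.length = l := by
  intro d hd
  rw [Finsupp.mem_support_iff, cellBoundary_apply] at hd
  have := edge_length hd
  omega

lemma morseProj_cellBoundary_of_ne {c : Cell lt I} (hc : c.entries.length ≠ l + 1) :
    morseProj lt I l (cellBoundary c) = 0 := by
  rw [morseProj, Finsupp.linearCombination_apply]
  refine Finset.sum_eq_zero fun d hd => ?_
  rw [Finsupp.mem_support_iff, cellBoundary_apply] at hd
  have := edge_length hd
  change _ • (if _ then _ else _) = _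
  rw [if_neg (by omega), smul_zero]

/-- The faces of c other than its partner c' contribute the path sum Γ(c, g). The partner
contributes [c:c'] · (-[c:c']⁻¹) · Γ(c, g), which cancels it. -/
lemma morseProj_cellBoundary_upper {c : Cell lt I} (h : IsUpper c) :
    morseProj lt I l (cellBoundary c) = 0 := by
  by_cases hc : c.entries.length = l + 1
  · ext g
    rw [morseProj_apply _ (length_of_mem_support_cellBoundary hc), Finsupp.zero_apply]
    obtain ⟨c', hm⟩ := h.exists_match
    have hl := match_length hm
    have h1 := pathSum_of_not_isLower h.not_isLower g.cell
    rw [if_neg, zero_add] at h1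
    · rw [← Finset.sum_filter_add_sum_filter_not _ fun d => ¬ barMatching lt I c d]
      simp only [cellBoundary_apply]
      rw [← h1]
      have h2 : ((cellBoundary c).support.filter fun d => ¬ ¬ barMatching lt I c d) = {c'} := by
        ext d
        rw [Finset.mem_filter, Finset.mem_singleton, not_not]
        constructor
        · exact fun hd => match_right_unique hd.2 hm
        · rintro rfl
          refine ⟨?_, hm⟩
          rw [Finsupp.mem_support_iff, cellBoundary_apply]
          exact (isAcyclicMatching lt I).edge _ _ hm
      rw [h2, Finset.sum_singleton, pathSum_of_isLower hm g.minChain (by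
        rw [g.length_cell]
        omega), ← mul_assoc, mul_neg, Ring.mul_inverse_cancel _ (isUnit_barWeight hm), neg_one_mul,
        add_neg_cancel]
    · rintro rfl
      exact minChain_not_isUpper g.minChain h
  · exact morseProj_cellBoundary_of_ne hc

lemma morseDifferential_single (e : Chain lt I (l + 1)) (a : NCPoly k n ⧸ I) :
    morseDifferential lt I l (Finsupp.single e a) = a • morseProj lt I l (cellBoundary e.cell) := by
  rw [morseDifferential, Finsupp.linearCombination_single]
  congr 1
  change pathVec l e.cell = _
  ext g
  rw [morseProj_apply _ (length_of_mem_support_cellBoundary e.length_cell), pathVec_apply,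
    pathSum_of_not_isLower (minChain_not_isLower e.minChain), if_neg, zero_add, Finset.filter_true_of_mem]
  · simp only [cellBoundary_apply]
  · intro d _ hd
    exact minChain_not_isUpper e.minChain (isUpper_of_match hd)
  · intro h
    have h1 := e.length_cell
    have h2 := g.length_cell
    rw [h] at h1
    omega

/-! ### The projection is a chain map -/

variable (lt I) in
/-- The submodule spanned by the critical cells, the upper cells and the boundaries of the upper
cells. -/
def triangularSpan : Submodule (NCPoly k n ⧸ I) (BarMod lt I) :=
  Submodule.span _ ({y | ∃ c : Cell lt I, ¬ IsLower c ∧ y = Finsupp.single c 1} ∪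
    {y | ∃ c : Cell lt I, IsUpper c ∧ y = cellBoundary c})

/-- A lower cell is, up to a unit, the boundary of its partner minus cells of smaller potential. -/
lemma single_mem_triangularSpan (c : Cell lt I) : Finsupp.single c 1 ∈ triangularSpan lt I := by
  induction hp : potential c using WellFoundedLT.induction generalizing c with
  | _ m ih =>
    subst hp
    by_cases hc : IsLower c
    · obtain ⟨d, hd⟩ := hc.exists_match
      have h1 : cellBoundary d ∈ triangularSpan lt I :=
        Submodule.subset_span (Or.inr ⟨d, isUpper_of_match hd, rfl⟩)
      rw [← Finsupp.single_add_erase c (cellBoundary d)] at h1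
      have h2 : (cellBoundary d).erase c ∈ triangularSpan lt I := by
        rw [← Finsupp.sum_single ((cellBoundary d).erase c)]
        refine Submodule.sum_mem _ fun x hx => ?_
        rw [Finsupp.support_erase, Finset.mem_erase, Finsupp.mem_support_iff,
          cellBoundary_apply] at hx
        rw [← Finsupp.smul_single_one]
        refine Submodule.smul_mem _ _ (ih _ ?_ x rfl)
        refine (potential_lt_of_edge hx.2 fun h => ?_).trans (potential_lt_of_match hd)
        exact hx.1 (match_right_unique h hd)
      have h3 := Submodule.smul_mem _ (Ring.inverse (barWeight lt I d c))
        (((triangularSpan lt I).add_mem_iff_left h2).1 h1)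
      rwa [cellBoundary_apply, Finsupp.smul_single, smul_eq_mul,
        Ring.inverse_mul_cancel _ (isUnit_barWeight hd)] at h3
    · exact Submodule.subset_span (Or.inl ⟨c, hc, rfl⟩)

lemma triangularSpan_eq_top : triangularSpan lt I = ⊤ := by
  rw [eq_top_iff]
  rintro y -
  rw [← Finsupp.sum_single y]
  refine Submodule.sum_mem _ fun c _ => ?_
  rw [← Finsupp.smul_single_one]
  exact Submodule.smul_mem _ _ (single_mem_triangularSpan c)

/-- It suffices to test generators of `triangularSpan`. Both sides vanish on upper cells and on
their boundaries; on critical cells they agree by the recursion of path sums. -/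
lemma morseProj_bd (y : BarMod lt I) :
    morseProj lt I l (bd lt I y) = morseDifferential lt I l (morseProj lt I (l + 1) y) := by
  suffices h : (morseProj lt I l).comp (bd lt I) =
      (morseDifferential lt I l).comp (morseProj lt I (l + 1)) from LinearMap.congr_fun h y
  have htop := triangularSpan_eq_top (lt := lt) (I := I)
  refine LinearMap.ext_on htop ?_
  rintro _ (⟨c, hc, rfl⟩ | ⟨c, hc, rfl⟩)
  · rw [LinearMap.comp_apply, LinearMap.comp_apply, bd_single, one_smul]
    rcases isUpper_or_isLower_or_minChain c with h | h | h
    · rw [morseProj_cellBoundary_upper h, morseProj_upper h, map_zero]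
    · exact absurd h hc
    · by_cases hl : c.entries.length = l + 1
      · have := morseProj_chain (Chain.mk c h hl) 1
        rw [Chain.cell_mk] at this
        rw [this, morseDifferential_single, one_smul, Chain.cell_mk]
      · rw [morseProj_cellBoundary_of_ne hl, morseProj_of_length_ne hl, map_zero]
  · rw [LinearMap.comp_apply, LinearMap.comp_apply, morseProj_cellBoundary_upper hc, map_zero]
    have : bd lt I (cellBoundary c) = 0 := by
      have := bd_bd (Finsupp.single c (1 : NCPoly k n ⧸ I))
      rwa [bd_single, one_smul] at this
    rw [this, map_zero]

lemma morseDifferential_morseDifferential (x : FreeMod lt I (l + 2)) :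
    morseDifferential lt I l (morseDifferential lt I (l + 1) x) = 0 := by
  induction x using Finsupp.induction_linear with
  | zero => simp
  | add x y hx hy => simp [hx, hy]
  | single e a =>
    rw [← morseProj_chain e a, ← morseProj_bd, ← morseProj_bd, bd_bd, map_zero]

end Paths

/-! ### Filtration by the rank of the words of terms; the differentials and the projection respect
it. -/

section Filtration

variable {k : Type*} [Field k] {n : ℕ} {lt : Word n → Word n → Prop} {I : Ideal (NCPoly k n)}
variable [I.IsTwoSided] [Setting lt I]

/-! ### The filtration of a free module by the words of its terms -/

variable {G G' : Type*} {wd : G → Word n} {wd' : G' → Word n}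

/-- The elements all of whose terms `t · g`, with a standard monomial `t`, have a word of rank
less than `m`. -/
def fil (lt : Word n → Word n → Prop) (I : Ideal (NCPoly k n)) [I.IsTwoSided] [Setting lt I]
    (wd : G → Word n) (m : ℕ) : Submodule k (G →₀ (NCPoly k n ⧸ I)) where
  carrier := {y | ∀ g t, stdCoeff lt I (y g) t ≠ 0 → rank lt (t * wd g) < m}
  zero_mem' := by
    intro g t h
    simp at h
  add_mem' := by
    intro x y hx hy g t h
    rw [Finsupp.add_apply, map_add, Finsupp.add_apply] at h
    by_cases h1 : stdCoeff lt I (x g) t = 0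
    · rw [h1, zero_add] at h
      exact hy g t h
    · exact hx g t h1
  smul_mem' := by
    intro c y hy g t h
    rw [Finsupp.smul_apply, map_smul, Finsupp.smul_apply, smul_eq_mul] at h
    exact hy g t (right_ne_zero_of_mul h)

lemma mem_fil {m : ℕ} {y : G →₀ (NCPoly k n ⧸ I)} : y ∈ fil lt I wd m ↔
    ∀ g t, stdCoeff lt I (y g) t ≠ 0 → rank lt (t * wd g) < m := Iff.rfl

lemma fil_mono {m m' : ℕ} (h : m ≤ m') : fil lt I wd m ≤ fil lt I wd m' :=
  fun _ hy g t ht => (hy g t ht).trans_le h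

lemma fil_zero {y : G →₀ (NCPoly k n ⧸ I)} (h : y ∈ fil lt I wd 0) : y = 0 := by
  ext g
  rw [Finsupp.zero_apply, ← sum_stdCoeff (lt := lt) (y g)]
  refine Finset.sum_eq_zero fun t ht => ?_
  exact absurd (h g t (Finsupp.mem_support_iff.1 ht)) (Nat.not_lt_zero _)

lemma exists_mem_fil (y : G →₀ (NCPoly k n ⧸ I)) : ∃ m, y ∈ fil lt I wd m := by
  induction y using Finsupp.induction_linear with
  | zero => exact ⟨0, Submodule.zero_mem _⟩
  | add x y hx hy =>
    obtain ⟨m, hm⟩ := hx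
    obtain ⟨m', hm'⟩ := hy
    exact ⟨max m m', Submodule.add_mem _ (fil_mono (le_max_left _ _) hm)
      (fil_mono (le_max_right _ _) hm')⟩
  | single g a =>
    refine ⟨(stdCoeff lt I a).support.sup (fun t => rank lt (t * wd g)) + 1, fun g' t ht => ?_⟩
    rw [Finsupp.single_apply] at ht
    split_ifs at ht with h
    · subst h
      exact Nat.lt_succ_of_le (Finset.le_sup (f := fun t => rank lt (t * wd g))
        (Finsupp.mem_support_iff.2 ht))
    · simp at ht

lemma single_mem_fil {m : ℕ} {g : G} {a : NCPoly k n ⧸ I} :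
    Finsupp.single g a ∈ fil lt I wd m ↔
      ∀ t, stdCoeff lt I a t ≠ 0 → rank lt (t * wd g) < m := by
  constructor
  · intro h t ht
    exact h g t (by rwa [Finsupp.single_eq_same])
  · intro h g' t ht
    rw [Finsupp.single_apply] at ht
    split_ifs at ht with hg
    · subst hg
      exact h t ht
    · simp at ht

/-- The word u need not be standard, because its Gröbner representation has no larger words. -/
lemma single_mon_mem_fil {m : ℕ} {g : G} {u : Word n} (h : rank lt (u * wd g) < m) :
    Finsupp.single g (mon I u) ∈ fil lt I wd m := by
  rw [single_mem_fil]
  intro t ht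
  rw [stdCoeff_mon] at ht
  exact (rank_mul_right_le (Setting.ord lt I) _ (rank_le_of_mem_normalForm ht)).trans_lt h

lemma single_mon_mem_fil_of_mem_initialWords {m : ℕ} {g : G} {u : Word n}
    (hu : u ∈ initialWords lt I) (h : rank lt (u * wd g) ≤ m) :
    Finsupp.single g (mon I u) ∈ fil lt I wd m := by
  rw [single_mem_fil]
  intro t ht
  rw [stdCoeff_mon] at ht
  refine (rank_mul_right_lt (Setting.ord lt I) _ ?_).trans_le h
  refine lt_of_le_of_ne (rank_le_of_mem_normalForm ht) fun he => ?_
  rw [rank_inj (Setting.ord lt I) he] at ht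
  exact notMem_of_mem_normalForm ht hu

lemma single_one_mem_fil {m : ℕ} {g : G} (h : rank lt (wd g) < m) :
    Finsupp.single g 1 ∈ fil lt I wd m := by
  rw [← mon_one]
  exact single_mon_mem_fil (by rwa [one_mul])

lemma eq_sum_terms (y : G →₀ (NCPoly k n ⧸ I)) :
    y = y.sum fun g a => (stdCoeff lt I a).sum fun t c => c • Finsupp.single g (mon I t) := by
  conv_lhs => rw [← Finsupp.sum_single y]
  refine Finsupp.sum_congr fun g _ => ?_
  conv_lhs => rw [← sum_stdCoeff (lt := lt) (y g)]
  rw [Finsupp.sum, Finsupp.single_finsetSum]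
  exact Finset.sum_congr rfl fun t _ => (Finsupp.smul_single _ _ _).symm

lemma fil_le {m : ℕ} {P : Submodule k (G →₀ (NCPoly k n ⧸ I))}
    (h : ∀ g t, t ∉ initialWords lt I → rank lt (t * wd g) < m →
      Finsupp.single g (mon I t) ∈ P) : fil lt I wd m ≤ P := by
  intro y hy
  rw [eq_sum_terms (lt := lt) y]
  refine Submodule.sum_mem _ fun g _ => Submodule.sum_mem _ fun t ht => Submodule.smul_mem _ _ ?_
  have ht' := Finsupp.mem_support_iff.1 ht
  exact h g t (notMem_of_stdCoeff_ne ht') (hy g t ht')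

lemma mon_smul_mem_fil {m m' : ℕ} (u : Word n)
    (hm : ∀ v : Word n, rank lt v < m → rank lt (u * v) < m') {y : G →₀ (NCPoly k n ⧸ I)}
    (hy : y ∈ fil lt I wd m) : mon I u • y ∈ fil lt I wd m' := by
  let f : (G →₀ (NCPoly k n ⧸ I)) →ₗ[k] (G →₀ (NCPoly k n ⧸ I)) :=
    { toFun := fun y => mon I u • y
      map_add' := fun x y => smul_add _ _ _
      map_smul' := fun c y => smul_comm _ _ _ }
  have h : fil lt I wd m ≤ (fil lt I wd m').comap f := by
    refine fil_le fun g t _ hr => ?_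
    change mon I u • (Finsupp.single g (mon I t) : G →₀ (NCPoly k n ⧸ I)) ∈ fil lt I wd m'
    rw [Finsupp.smul_single, smul_eq_mul, ← mon_mul]
    refine single_mon_mem_fil ?_
    rw [mul_assoc]
    exact hm _ hr
  exact h hy

lemma mon_smul_mem_fil_rank {u v : Word n} {y : G →₀ (NCPoly k n ⧸ I)}
    (hy : y ∈ fil lt I wd (rank lt v)) : mon I u • y ∈ fil lt I wd (rank lt (u * v)) :=
  mon_smul_mem_fil u (fun _ => rank_mul_left_lt (Setting.ord lt I) u) hy

lemma mon_smul_mem_fil_rank_succ {u v : Word n} {y : G →₀ (NCPoly k n ⧸ I)}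
    (hy : y ∈ fil lt I wd (rank lt v + 1)) : mon I u • y ∈ fil lt I wd (rank lt (u * v) + 1) :=
  mon_smul_mem_fil u (fun _ h => Nat.lt_succ_of_le
    (rank_mul_left_le (Setting.ord lt I) u (Nat.le_of_lt_succ h))) hy

/-- A linear map is filtered if it is so on the basis elements that are involved. -/
lemma map_mem_fil {m : ℕ} (f : (G →₀ (NCPoly k n ⧸ I)) →ₗ[NCPoly k n ⧸ I] (G' →₀ (NCPoly k n ⧸ I)))
    {y : G →₀ (NCPoly k n ⧸ I)} (hy : y ∈ fil lt I wd m)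
    (h : ∀ g ∈ y.support, f (Finsupp.single g 1) ∈ fil lt I wd' (rank lt (wd g) + 1)) :
    f y ∈ fil lt I wd' m := by
  rw [eq_sum_terms (lt := lt) y, map_finsuppSum]
  refine Submodule.sum_mem _ fun g hg => ?_
  change f (Finsupp.sum _ _) ∈ _
  rw [map_finsuppSum]
  refine Submodule.sum_mem _ fun t ht => ?_
  change f (_ • _) ∈ _
  rw [LinearMap.map_smul_of_tower]
  refine Submodule.smul_mem _ _ ?_
  rw [← Finsupp.smul_single_one, map_smul]
  have h1 := hy g t (Finsupp.mem_support_iff.1 ht)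
  exact fil_mono h1 (mon_smul_mem_fil_rank_succ (h g hg))

/-! ### The filtration of the bar resolution -/

lemma barTerm_mon_mem_fil {m : ℕ} {c : List (Word n)} {u : Word n}
    (h : rank lt (u * c.prod) < m) :
    barTerm lt I c (mon I u) ∈ fil lt I Cell.word m := by
  unfold barTerm
  split_ifs with hc
  · exact single_mon_mem_fil h
  · exact Submodule.zero_mem _

lemma barTerm_algebraMap_mem_fil {m : ℕ} {c : List (Word n)} (h : rank lt c.prod < m) (a : k) :
    barTerm lt I c (algebraMap k _ a) ∈ fil lt I Cell.word m := by
  rw [← mul_one (algebraMap k _ a), ← mon_one, ← smul_barTerm']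
  exact Submodule.smul_mem _ _ (barTerm_mon_mem_fil (by rwa [one_mul]))

/-- Modulo smaller words only the outer face and the literal merges remain. A merge with a
non-standard product is absorbed by the convention that `barTerm` is zero on tuples that are not
cells. -/
lemma cellBoundary_sub_mem_fil {c : Cell lt I} {w : Word n} {c' : List (Word n)}
    (hc : c.entries = w :: c') :
    cellBoundary c - (barTerm lt I c' (mon I w) + ∑ j ∈ Finset.range c'.length,
      (-1 : k) ^ (j + 1) • barTerm lt I (face (w :: c') j (prodAt (w :: c') j)) 1) ∈
      fil lt I Cell.word (rank lt c.word) := by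
  rw [cellBoundary, hc, listBoundary, innerBoundary, List.length_cons, Nat.add_sub_cancel,
    add_sub_add_left_eq_sub, ← Finset.sum_sub_distrib]
  refine Submodule.sum_mem _ fun j hj => ?_
  obtain ⟨p, a, b, q, hs, rfl⟩ := exists_split (l := w :: c') (j := j)
    (by simpa using Finset.mem_range.1 hj)
  rw [hs, prodAt_append]
  have hab : a * b ≠ 1 := prod_ne_one_of_pair (c.std a (by simp [hc, hs])) b
  by_cases hab' : a * b ∈ initialWords lt I
  · rw [barTerm_of_not (c := face _ _ _), smul_zero, sub_zero]
    · refine Submodule.sum_mem _ fun v hv => ?_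
      have hv' := Finsupp.mem_support_iff.1 hv
      change (if _ then _ else _) ∈ _
      split_ifs with hv1
      · rw [face_append]
        refine barTerm_algebraMap_mem_fil ?_ _
        have h1 : rank lt v < rank lt (a * b) := by
          refine lt_of_le_of_ne (rank_le_of_mem_normalForm hv') fun he => ?_
          rw [rank_inj (Setting.ord lt I) he] at hv'
          exact notMem_of_mem_normalForm hv' hab'
        have h2 := rank_lt_mul (Setting.ord lt I) p.prod q.prod h1
        rw [Cell.word, hc, hs]
        simpa [mul_assoc] using h2
      · exact Submodule.zero_mem _
    · intro h
      rw [face_append] at h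
      exact (h (a * b) (by simp)).1 hab'
  · rw [normalForm_of_std hab']
    change Finsupp.sum (Finsupp.single _ _) _ - _ ∈ _
    rw [Finsupp.sum_single_index (by simp [barTerm]), if_pos hab, mul_one, smul_barTerm', mul_one, sub_self]
    exact Submodule.zero_mem _

lemma cellBoundary_mem_fil (c : Cell lt I) :
    cellBoundary c ∈ fil lt I Cell.word (rank lt c.word + 1) := by
  rcases hc : c.entries with _ | ⟨w, c'⟩
  · rw [cellBoundary, hc]
    exact Submodule.zero_mem _
  · have h1 := fil_mono (Nat.le_succ _) (cellBoundary_sub_mem_fil hc)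
    refine ((Submodule.sub_mem_iff_left _ ?_).1 h1)
    have hw : c.word = w * c'.prod := by rw [Cell.word, hc, List.prod_cons]
    refine Submodule.add_mem _ (barTerm_mon_mem_fil ?_) (Submodule.sum_mem _ fun j hj =>
      Submodule.smul_mem _ _ ?_)
    · rw [hw]
      exact Nat.lt_succ_self _
    · rw [← map_one (algebraMap k (NCPoly k n ⧸ I))]
      refine barTerm_algebraMap_mem_fil ?_ _
      obtain ⟨p, a, b, q, hs, rfl⟩ := exists_split (l := w :: c') (j := j)
        (by simpa using Finset.mem_range.1 hj)
      rw [hs, prodAt_append, face_append, Cell.word, hc, hs]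
      simp [mul_assoc]

/-! ### The filtration of the Morse complex -/

variable {l : ℕ}

lemma Chain.word_eq (f : Chain lt I l) : f.word = f.cell.word := rfl

/-- For a lower cell c with partner d, which has the same word, the relation that the projection
kills the boundary of d expresses c by faces of smaller potential with no larger terms. -/
lemma morseProj_mem_fil_single (c : Cell lt I) : morseProj lt I l (Finsupp.single c 1) ∈
    fil lt I Chain.word (rank lt c.word + 1) := by
  induction hp : potential c using WellFoundedLT.induction generalizing c with
  | _ m ih =>
    subst hp
    rcases isUpper_or_isLower_or_minChain c with h | h | h
    · rw [morseProj_upper h]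
      exact Submodule.zero_mem _
    · obtain ⟨d, hd⟩ := h.exists_match
      have hdw : c.word = d.word := by
        obtain ⟨p, q, a, b, h1, h2, -⟩ := (barMatching_iff _ _).1 hd
        exact word_eq_of_merge h1 h2
      have h1 := morseProj_cellBoundary_upper (l := l) (isUpper_of_match hd)
      rw [← Finsupp.single_add_erase c (cellBoundary d), map_add, cellBoundary_apply] at h1
      obtain ⟨s, hs⟩ := barWeight_match hd
      have h2 : morseProj lt I l ((cellBoundary d).erase c) ∈
          fil lt I Chain.word (rank lt c.word + 1) := by
        refine map_mem_fil (wd := Cell.word) _ ?_ ?_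
        · intro g t ht
          rw [Finsupp.erase_apply] at ht
          split_ifs at ht with hg
          · simp at ht
          · have := cellBoundary_mem_fil d g t ht
            rwa [← hdw] at this
        · intro x hx
          rw [Finsupp.support_erase, Finset.mem_erase, Finsupp.mem_support_iff,
            cellBoundary_apply] at hx
          refine ih _ ?_ x rfl
          refine (potential_lt_of_edge hx.2 fun h => ?_).trans (potential_lt_of_match hd)
          exact hx.1 (match_right_unique h hd)
      have h3 := (Submodule.neg_mem_iff _).2 h2
      rw [← eq_neg_iff_add_eq_zero.2 h1, hs, ← Finsupp.smul_single_one, algebraMap_smul,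
        LinearMap.map_smul_of_tower] at h3
      exact ((Submodule.smul_mem_iff _ (pow_ne_zero _ (by simp))).1 h3)
    · by_cases hl : c.entries.length = l
      · have := morseProj_chain (Chain.mk c h hl) 1
        rw [Chain.cell_mk] at this
        rw [this]
        exact single_one_mem_fil (Nat.lt_succ_self _)
      · rw [morseProj_of_length_ne hl]
        exact Submodule.zero_mem _

lemma morseProj_mem_fil {m : ℕ} {y : BarMod lt I} (hy : y ∈ fil lt I Cell.word m) :
    morseProj lt I l y ∈ fil lt I Chain.word m :=
  map_mem_fil _ hy fun c _ => morseProj_mem_fil_single c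

lemma morseDifferential_mem_fil {m : ℕ} {x : FreeMod lt I (l + 1)}
    (hx : x ∈ fil lt I Chain.word m) : morseDifferential lt I l x ∈ fil lt I Chain.word m := by
  refine map_mem_fil _ hx fun e _ => ?_
  rw [morseDifferential_single, one_smul]
  exact morseProj_mem_fil (cellBoundary_mem_fil e.cell)

end Filtration

/-! ### Combinatorics of left and right greedy cuttings. -/

section Greedy

/-! ### Greedy sequences of positions -/

variable {B : ℕ → ℕ → Prop} {E R G : ℕ → ℕ} {m : ℕ}

/-- The intervals with the property `B` are closed under enlargement. -/
def IntervalMono (B : ℕ → ℕ → Prop) : Prop :=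
  ∀ ⦃a' a b b'⦄, a' ≤ a → b ≤ b' → B a b → B a' b'

/-- The positions `E 0 < ⋯ < E m` bound `m` blocks without the property `B`, of which the first is a
singleton and each further one is minimal such that it has `B` together with its predecessor. -/
structure LeftGreedy (B : ℕ → ℕ → Prop) (E : ℕ → ℕ) (m : ℕ) : Prop where
  first : 0 < m → E 1 = E 0 + 1
  lt_succ : ∀ i < m, E i < E (i + 1)
  block : ∀ i < m, ¬ B (E i) (E (i + 1))
  pair : ∀ i, i + 2 ≤ m → B (E i) (E (i + 2))
  min : ∀ i, i + 2 ≤ m → ∀ b < E (i + 2), ¬ B (E i) b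

/-- The mirror image of `LeftGreedy`. -/
structure RightGreedy (B : ℕ → ℕ → Prop) (R : ℕ → ℕ) (m : ℕ) : Prop where
  last : ∀ i, i + 1 = m → R m = R i + 1
  lt_succ : ∀ i < m, R i < R (i + 1)
  block : ∀ i < m, ¬ B (R i) (R (i + 1))
  pair : ∀ i, i + 2 ≤ m → B (R i) (R (i + 2))
  max : ∀ i, i + 2 ≤ m → ∀ a, R i < a → ¬ B a (R (i + 2))

/-- The sequence that starts at `a` and `a + 1` and continues with the minimal ends of the intervals
with `B` that start at the last but one position. -/
def leftGreedySeq (B : ℕ → ℕ → Prop) (a : ℕ) : ℕ → ℕ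
  | 0 => a
  | 1 => a + 1
  | i + 2 => sInf {b | B (leftGreedySeq B a i) b}

/-- The sequence that starts at `b` and `b - 1` and continues with the maximal starts, below a bound
`N`, of the intervals with `B` that end at the last but one position. -/
def rightGreedySeq (B : ℕ → ℕ → Prop) (N b : ℕ) : ℕ → ℕ
  | 0 => b
  | 1 => b - 1
  | i + 2 => Nat.findGreatest (fun a => B a (rightGreedySeq B N b i)) N

theorem LeftGreedy.exists_rightGreedy (hB : IntervalMono B) (hE : LeftGreedy B E m) :
    ∃ R, RightGreedy B R m ∧ R m = E m ∧ (∀ i ≤ m, E i ≤ R i) ∧ ∀ i < m, R i < E (i + 1) := by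
  -- S counts from the right end: S j is the position with index m - j. It is shown to lie between E
  -- (m - j) and E (m - j + 1).
  set S := rightGreedySeq B (E m) (E m) with hS
  have hEm : ∀ i ≤ m, E i ≤ E m := by
    intro i hi
    induction hd : m - i generalizing i with
    | zero => rw [show i = m by omega]
    | succ d ih => exact (hE.lt_succ i (by omega)).le.trans (ih (i + 1) (by omega) (by omega))
  have key : ∀ i j, i + j = m → E i ≤ S j ∧ (0 < j → S j < E (i + 1)) ∧
      ∀ j', j = j' + 2 → B (S j) (S j') ∧ ∀ a, S j < a → ¬ B a (S j') := by
    intro i j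
    induction j using Nat.strong_induction_on generalizing i with
    | _ j ih =>
      intro hij
      match j, ih, hij with
      | 0, _, hij =>
        refine ⟨?_, by simp, by simp⟩
        rw [hS, rightGreedySeq, ← hij, add_zero]
      | 1, _, hij =>
        have := hE.lt_succ i (by omega)
        subst hij
        rw [hS, rightGreedySeq]
        refine ⟨by omega, fun _ => by omega, fun j' h => by omega⟩
      | j + 2, ih, hij =>
        obtain ⟨h1, h2, -⟩ := ih j (by omega) (i + 2) (by omega)
        -- From E (i + 1) on, no interval up to S j has B: for j > 0 because S j lies left of E (i +
        -- 3), and for j = 0 because this is the last block of E.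
        have hle : ∀ a, B a (S j) → a ≤ E i ∨ a < E (i + 1) := by
          intro a ha
          by_contra hcon
          have ha' : E (i + 1) ≤ a := by omega
          rcases Nat.eq_zero_or_pos j with rfl | hj
          · have hS0 : S 0 = E (i + 2) := by rw [hS, rightGreedySeq]; congr 1; omega
            rw [hS0] at ha
            exact hE.block (i + 1) (by omega) (hB ha' le_rfl ha)
          · exact hE.min (i + 1) (by omega) _ (h2 hj) (hB ha' le_rfl ha)
        have hEi := hE.lt_succ i (by omega)
        have hex : B (E i) (S j) := hB le_rfl h1 (hE.pair i (by omega))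
        have hSj : S (j + 2) = Nat.findGreatest (fun a => B a (S j)) (E m) := rfl
        have hEim := hEm i (by omega)
        have hEim1 := hEm (i + 1) (by omega)
        have hspec : B (S (j + 2)) (S j) := by
          rw [hSj]
          exact Nat.findGreatest_spec (P := fun a => B a (S j)) hEim hex
        refine ⟨?_, fun _ => ?_, ?_⟩
        · rw [hSj]
          exact Nat.le_findGreatest hEim hex
        · have := hle _ hspec
          omega
        · intro j' hj'
          obtain rfl : j = j' := by omega
          refine ⟨hspec, fun a ha hBa => ?_⟩
          have h3 := hle a hBa
          rw [hSj] at ha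
          exact Nat.findGreatest_is_greatest ha (by omega) hBa
  have hlow : ∀ i ≤ m, E i ≤ S (m - i) := fun i hi => (key i (m - i) (by omega)).1
  have hup : ∀ i < m, S (m - i) < E (i + 1) := fun i hi =>
    (key i (m - i) (by omega)).2.1 (by omega)
  refine ⟨fun i => S (m - i), ⟨?_, ?_, ?_, ?_, ?_⟩, by simp [hS, rightGreedySeq], hlow, hup⟩
  · rintro i rfl
    have := hE.lt_succ i (by omega)
    simp only [Nat.sub_self, Nat.add_sub_cancel_left, hS, rightGreedySeq]
    omega
  · intro i hi
    exact (hup i hi).trans_le (hlow (i + 1) hi)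
  · intro i hi h
    rcases Nat.lt_or_ge (i + 1) m with h1 | h1
    · exact hE.min i (by omega) _ (hup (i + 1) h1) (hB (hlow i hi.le) le_rfl h)
    · obtain rfl : i + 1 = m := by omega
      refine hE.block i hi (hB (hlow i hi.le) ?_ h)
      simp [hS, rightGreedySeq]
  · intro i hi
    exact ((key i (m - i) (by omega)).2.2 (m - (i + 2)) (by omega)).1
  · intro i hi
    exact ((key i (m - i) (by omega)).2.2 (m - (i + 2)) (by omega)).2

/-- The position F i is trapped with R (i - 1) < F i ≤ R i: pairs of R supply ends for the minimal
intervals, while blocks and maximality of R forbid earlier ends. -/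
theorem RightGreedy.exists_leftGreedy (hB : IntervalMono B) (hR : RightGreedy B R m) :
    ∃ F, LeftGreedy B F m ∧ F 0 = R 0 ∧ F m = R m ∧ (∀ i ≤ m, F i ≤ R i) ∧
      ∀ i < m, R i < F (i + 1) := by
  set F := leftGreedySeq B (R 0) with hF
  have key : ∀ i ≤ m, F i ≤ R i ∧ (∀ j, i = j + 1 → R j < F i) ∧
      ∀ j, i = j + 2 → B (F j) (F i) ∧ ∀ b < F i, ¬ B (F j) b := by
    intro i
    induction i using Nat.strong_induction_on with
    | _ i ih =>
      intro hi
      match i, ih, hi with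
      | 0, _, _ => exact ⟨le_rfl, by simp, by simp⟩
      | 1, _, hi =>
        refine ⟨hR.lt_succ 0 hi, fun j hj => ?_, by simp⟩
        obtain rfl : j = 0 := by omega
        exact Nat.lt_succ_self _
      | i + 2, ih, hi =>
        obtain ⟨h1, h2, -⟩ := ih i (by omega) (by omega)
        have hex : B (F i) (R (i + 2)) := hB h1 le_rfl (hR.pair i hi)
        have hFi : F (i + 2) = sInf {b | B (F i) b} := rfl
        have hspec : B (F i) (F (i + 2)) := by
          rw [hFi]
          exact Nat.sInf_mem (s := {b | B (F i) b}) ⟨_, hex⟩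
        refine ⟨by rw [hFi]; exact Nat.sInf_le hex, fun j hj => ?_, fun j hj => ?_⟩
        · obtain rfl : i + 1 = j := by omega
          by_contra hcon
          have h3 : B (F i) (R (i + 1)) := hB le_rfl (not_lt.1 hcon) hspec
          rcases i with _ | i
          · exact hR.block 0 (by omega) h3
          · exact hR.max i (by omega) _ (h2 i rfl) h3
        · obtain rfl : i = j := by omega
          refine ⟨hspec, fun b hb hBb => ?_⟩
          rw [hFi] at hb
          exact Nat.notMem_of_lt_sInf hb hBb
  have hlow : ∀ i ≤ m, F i ≤ R i := fun i hi => (key i hi).1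
  have hup : ∀ i < m, R i < F (i + 1) := fun i hi => (key (i + 1) hi).2.1 i rfl
  refine ⟨F, ⟨fun _ => rfl, ?_, ?_, ?_, ?_⟩, rfl, ?_, hlow, hup⟩
  · intro i hi
    exact (hlow i hi.le).trans_lt (hup i hi)
  · intro i hi h
    have h3 : B (F i) (R (i + 1)) := hB le_rfl (hlow (i + 1) hi) h
    rcases i with _ | i
    · exact hR.block 0 hi h3
    · exact hR.max i hi _ (hup i (by omega)) h3
  · intro i hi
    exact ((key (i + 2) hi).2.2 i rfl).1
  · intro i hi
    exact ((key (i + 2) hi).2.2 i rfl).2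
  -- The last block of R has length one, so the interlacing leaves no choice for the last position.
  · rcases m with _ | m
    · rfl
    · have h1 := hR.last m rfl
      have h2 := hup m (by omega)
      have h3 := hlow (m + 1) le_rfl
      omega

/-- Greedy sequences are extremal, so that no sequence with the same number of blocks
starts further right. -/
theorem LeftGreedy.not_shift (hB : IntervalMono B) (hE : LeftGreedy B E m) (hm : 0 < m)
    (h0 : E 1 ≤ G 0) (hG : ∀ i < m, G i < G (i + 1)) (hpair : ∀ i, i + 2 ≤ m → B (G i) (G (i + 2)))
    (hGm : G m = E m) : False := by
  -- The shift is kept at every second position, by minimality of E. At the end, an odd m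
  -- contradicts the equality of the last positions, and for an even m the last block of E would
  -- have B.
  have key : ∀ j, 2 * j + 1 ≤ m → E (2 * j + 1) ≤ G (2 * j) := by
    intro j
    induction j with
    | zero => exact fun _ => h0
    | succ j ih =>
      intro hj
      by_contra hcon
      exact hE.min (2 * j + 1) (by omega) _ (not_le.1 hcon)
        (hB (ih (by omega)) le_rfl (hpair (2 * j) (by omega)))
  obtain ⟨j, hj | hj⟩ : ∃ j, m = 2 * j + 1 ∨ m = 2 * j + 2 :=
    ⟨(m - 1) / 2, by omega⟩
  · have h1 := key j hj.ge
    have h2 := hG (2 * j) (by omega)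
    subst hj
    omega
  · have h1 := key j (by omega)
    have h2 := hB h1 le_rfl (hpair (2 * j) hj.ge)
    rw [show 2 * j + 2 = 2 * j + 1 + 1 by rfl, ← show m = 2 * j + 1 + 1 from hj, hGm, hj] at h2
    exact hE.block (2 * j + 1) (by omega) h2

/-- No sequence with more blocks fits between the ends of a greedy sequence. -/
theorem LeftGreedy.not_longer (hB : IntervalMono B) (hE : LeftGreedy B E m)
    (h0 : E 0 ≤ G 0) (hG : ∀ i < m + 1, G i < G (i + 1))
    (hpair : ∀ i, i + 2 ≤ m + 1 → B (G i) (G (i + 2))) (hGm : G (m + 1) = E m) : False := by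
  -- G never falls behind E, so E m ≤ G m < G (m + 1). Two consecutive indices are carried because
  -- minimality looks back two steps.
  have key : ∀ i, (i ≤ m → E i ≤ G i) ∧ (i + 1 ≤ m → E (i + 1) ≤ G (i + 1)) := by
    intro i
    induction i with
    | zero =>
      refine ⟨fun _ => h0, fun h => ?_⟩
      have h1 := hE.first h
      have h2 : G 0 < G 1 := hG 0 (by omega)
      change E 1 ≤ G 1
      omega
    | succ i ih =>
      refine ⟨ih.2, fun h => ?_⟩
      by_contra hcon
      exact hE.min i h _ (not_le.1 hcon)
        (hB (ih.1 (by omega)) le_rfl (hpair i (by omega)))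
  have h1 := (key m).1 le_rfl
  have h2 := hG m (by omega)
  omega

theorem LeftGreedy.unique (hE : LeftGreedy B E m) (hG : LeftGreedy B G m) (h0 : E 0 = G 0) :
    ∀ i ≤ m, E i = G i := by
  intro i
  induction i using Nat.strong_induction_on with
  | _ i ih =>
    intro hi
    match i, ih, hi with
    | 0, _, _ => exact h0
    | 1, _, hi => rw [hE.first hi, hG.first hi, h0]
    | i + 2, ih, hi =>
      have h1 := ih i (by omega) (by omega)
      have h2 := hE.pair i hi
      have h3 := hG.pair i hi
      rcases lt_trichotomy (E (i + 2)) (G (i + 2)) with h | h | h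
      · exact absurd (h1 ▸ h2) (hG.min i hi _ h)
      · exact h
      · exact absurd (h1 ▸ h3) (hE.min i hi _ h)

/-- A right greedy sequence extends to the left. -/
theorem RightGreedy.exists_cons (hB : IntervalMono B) (hR : RightGreedy B R (m + 1)) {c : ℕ}
    (hc : B c (R 1)) (hc' : ¬ B c (R 0)) (hcR : c ≤ R 0) :
    ∃ a, c ≤ a ∧ a < R 0 ∧ RightGreedy B (fun i => Nat.casesOn i a R) (m + 2) := by
  have hle : ∀ a, B a (R 1) → a < R 0 := by
    intro a ha
    by_contra hcon
    exact hR.block 0 (by omega) (hB (not_lt.1 hcon) le_rfl ha)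
  -- The interval from c shows that a maximal start exists; as c ≤ a, the new first block lies
  -- inside the interval from c to R 0, which does not have B.
  set a := Nat.findGreatest (fun a => B a (R 1)) (R 0) with ha
  have hspec : B a (R 1) := Nat.findGreatest_spec (P := fun a => B a (R 1)) hcR hc
  have hca : c ≤ a := Nat.le_findGreatest hcR hc
  refine ⟨a, hca, hle a hspec, ⟨?_, ?_, ?_, ?_, ?_⟩⟩
  · rintro (_ | i) hi
    · omega
    · exact hR.last i (by omega)
  · rintro (_ | i) hi
    · exact hle a hspec
    · exact hR.lt_succ i (by omega)
  · rintro (_ | i) hi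
    · exact fun h => hc' (hB hca le_rfl h)
    · exact hR.block i (by omega)
  · rintro (_ | i) hi
    · exact hspec
    · exact hR.pair i (by omega)
  · rintro (_ | i) hi
    · intro b hb hBb
      exact Nat.findGreatest_is_greatest (P := fun a => B a (R 1)) hb (hle b hBb).le hBb
    · exact hR.max i (by omega)

theorem RightGreedy.tail (hR : RightGreedy B R (m + 1)) : RightGreedy B (fun i => R (i + 1)) m where
  last i hi := hR.last (i + 1) (by omega)
  lt_succ i hi := hR.lt_succ (i + 1) (by omega)
  block i hi := hR.block (i + 1) (by omega)
  pair i hi := hR.pair (i + 1) (by omega)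
  max i hi := hR.max (i + 1) (by omega)

end Greedy

/-! ### Tuples of subwords encoded by positions in one word. -/

section Subwords

/-! ### Subwords given by positions -/

variable {n : ℕ}

/-- The subword of `W` between the positions `a` and `b`. -/
def subword (W : Word n) (a b : ℕ) : Word n := FreeMonoid.ofList ((W.toList.drop a).take (b - a))

lemma subword_mul (W : Word n) {a b c : ℕ} (h1 : a ≤ b) (h2 : b ≤ c) :
    subword W a b * subword W b c = subword W a c := by
  apply FreeMonoid.toList.injective
  change (W.toList.drop a).take (b - a) ++ (W.toList.drop b).take (c - b) =
    (W.toList.drop a).take (c - a)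
  rw [show c - a = (b - a) + (c - b) by omega, List.take_add, List.drop_drop,
    show a + (b - a) = b by omega]

lemma length_subword (W : Word n) {a b : ℕ} (h : b ≤ W.length) :
    (subword W a b).length = b - a := by
  change ((W.toList.drop a).take (b - a)).length = _
  have : W.toList.length = W.length := rfl
  rw [List.length_take, List.length_drop, this]
  omega

lemma subword_self (W : Word n) (a : ℕ) : subword W a a = 1 := by
  rw [subword, Nat.sub_self, List.take_zero]
  rfl

lemma subword_zero_length (W : Word n) : subword W 0 W.length = W := by
  rw [subword, Nat.sub_zero, List.drop_zero]
  exact congrArg FreeMonoid.ofList (List.take_length (l := W.toList))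

lemma subword_mul_mul (p w q : Word n) :
    subword (p * w * q) p.length (p.length + w.length) = w := by
  apply FreeMonoid.toList.injective
  change ((p.toList ++ w.toList ++ q.toList).drop p.toList.length).take
    (p.toList.length + w.toList.length - p.toList.length) = w.toList
  rw [List.append_assoc, List.drop_left, Nat.add_sub_cancel_left, List.take_left]

/-- The tuple of the subwords between successive positions. -/
def blocks (W : Word n) (D : ℕ → ℕ) (l : ℕ) : List (Word n) :=
  (List.range l).map fun i => subword W (D i) (D (i + 1))

variable {W : Word n} {D : ℕ → ℕ} {l : ℕ}

@[simp] lemma length_blocks : (blocks W D l).length = l := by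
  simp [blocks]

lemma getD_blocks {i : ℕ} (h : i < l) :
    (blocks W D l).getD i 1 = subword W (D i) (D (i + 1)) := by
  simp [blocks, List.getD_eq_getElem?_getD, h]

lemma mem_blocks {w : Word n} :
    w ∈ blocks W D l ↔ ∃ i < l, w = subword W (D i) (D (i + 1)) := by
  simp [blocks, eq_comm]

lemma blocks_succ : blocks W D (l + 1) =
    subword W (D 0) (D 1) :: blocks W (fun i => D (i + 1)) l := by
  simp [blocks, List.range_succ_eq_map]

lemma blocks_congr {D' : ℕ → ℕ} (h : ∀ i ≤ l, D i = D' i) : blocks W D l = blocks W D' l := by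
  refine List.map_congr_left fun i hi => ?_
  rw [List.mem_range] at hi
  rw [h i hi.le, h (i + 1) hi]

lemma le_of_lt_succ (h : ∀ i < l, D i < D (i + 1)) {i j : ℕ} (hij : i ≤ j) (hj : j ≤ l) :
    D i ≤ D j := by
  induction j, hij using Nat.le_induction with
  | base => exact le_rfl
  | succ j _ ih => exact (ih (by omega)).trans (h j (by omega)).le

lemma prod_blocks (h : ∀ i < l, D i < D (i + 1)) :
    (blocks W D l).prod = subword W (D 0) (D l) := by
  induction l generalizing D with
  | zero => rw [subword_self]; rfl
  | succ l ih =>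
    rw [blocks_succ, List.prod_cons, ih (D := fun i => D (i + 1)) fun i hi => h (i + 1) (by omega)]
    exact subword_mul W (h 0 (by omega)).le (le_of_lt_succ h (by omega) le_rfl)

/-- The sequence of positions without the `j`-th one. -/
def skip (j : ℕ) (D : ℕ → ℕ) (i : ℕ) : ℕ := if i < j then D i else D (i + 1)

/-- Merging the blocks j and j + 1 erases the position between them, which has index j + 1. -/
lemma face_blocks (h : ∀ i < l + 1, D i < D (i + 1)) {j : ℕ} (hj : j < l) :
    face (blocks W D (l + 1)) j (prodAt (blocks W D (l + 1)) j) =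
      blocks W (skip (j + 1) D) l := by
  rw [prodAt, getD_blocks (by omega), getD_blocks (by omega),
    subword_mul W (h j (by omega)).le (h (j + 1) (by omega)).le]
  refine List.ext_getElem (by simp [face]; omega) fun i h1 h2 => ?_
  rw [length_blocks] at h2
  simp only [face, blocks, List.getElem_map, List.getElem_range, skip, List.getElem_append,
    List.getElem_cons, List.getElem_take, List.getElem_drop, List.length_take, List.length_map,
    List.length_range]
  rcases lt_trichotomy i j with h3 | h3 | h3
  · rw [dif_pos (by omega), if_pos (by omega), if_pos (by omega)]
  · subst h3
    rw [dif_neg (by omega), dif_pos (by omega), if_pos (by omega), if_neg (by omega)]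
  · rw [dif_neg (by omega), dif_neg (by omega), if_neg (by omega), if_neg (by omega),
      show j + 2 + (i - min j (l + 1) - 1) = i + 1 by omega]

end Subwords

/-! ### Dictionary between fully attached tuples and greedy sequences. -/

section ChainPositions

variable {k : Type*} [Field k] {n : ℕ} {lt : Word n → Word n → Prop} {I : Ideal (NCPoly k n)}
variable [I.IsTwoSided] [Setting lt I]

/-! ### Fully attached tuples as greedy sequences of positions -/

variable {W : Word n} {D E : ℕ → ℕ} {l : ℕ}

variable (lt I) in
/-- The subword between the positions `a` and `b` is not standard. -/
def NonStdAt (W : Word n) (a b : ℕ) : Prop := subword W a b ∈ initialWords lt I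

lemma intervalMono_nonStdAt (W : Word n) : IntervalMono (NonStdAt lt I W) := by
  intro a' a b b' ha hb h
  unfold NonStdAt at h ⊢
  rcases le_or_gt a b with hab | hab
  · rw [← subword_mul W ha (hab.trans hb), ← subword_mul W hab hb]
    exact mul_left_mem_initialWords _ (mul_right_mem_initialWords _ h)
  · rw [subword, Nat.sub_eq_zero_of_le hab.le, List.take_zero] at h
    exact absurd h one_notMem_initialWords

lemma subword_mem_stdWords {a b : ℕ} (h : ¬ NonStdAt lt I W a b) (hab : a < b)
    (hb : b ≤ W.length) : subword W a b ∈ stdWords lt I := by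
  refine ⟨h, fun h1 => ?_⟩
  have := length_subword W (a := a) hb
  rw [h1, FreeMonoid.length_one] at this
  omega

lemma blocks_std (h : ∀ i < l, D i < D (i + 1)) (hl : D l = W.length)
    (hD : ∀ i < l, ¬ NonStdAt lt I W (D i) (D (i + 1))) :
    ∀ w ∈ blocks W D l, w ∈ stdWords lt I := by
  intro w hw
  obtain ⟨i, hi, rfl⟩ := mem_blocks.1 hw
  refine subword_mem_stdWords (hD i hi) (h i hi) ?_
  rw [← hl]
  exact le_of_lt_succ h hi le_rfl

/-- The positions of a fully attached tuple at the end of a word. -/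
lemma Chain.exists_leftGreedy (e : Chain lt I l) {t : Word n} (hW : t * e.word = W) :
    ∃ E, LeftGreedy (NonStdAt lt I W) E l ∧ E 0 = t.length ∧ E l = W.length ∧
      e.cell.entries = blocks W E l := by
  obtain ⟨c, hc⟩ : ∃ c, c = e.cell.entries := ⟨_, rfl⟩
  have hcl : c.length = l := hc ▸ e.length_cell
  have hstd : ∀ i < l, c.getD i 1 ∈ stdWords lt I := by
    intro i hi
    refine e.cell.std _ ?_
    rw [← hc, List.getD_eq_getElem _ _ (by omega)]
    exact List.getElem_mem _
  have hmin := e.minChain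
  rw [← hc] at hmin
  have hprod : t * c.prod = W := by rw [hc]; exact hW
  set E : ℕ → ℕ := fun i => t.length + (c.take i).prod.length with hE
  have hEsucc : ∀ i < l, E (i + 1) = E i + (c.getD i 1).length := by
    intro i hi
    simp only [hE]
    rw [List.take_succ_eq_append_getElem (by omega), List.prod_append, FreeMonoid.length_mul,
      List.getD_eq_getElem _ _ (by omega)]
    simp [add_assoc]
  have hsub : ∀ i < l, subword W (E i) (E (i + 1)) = c.getD i 1 := by
    intro i hi
    have h1 : W = (t * (c.take i).prod) * c.getD i 1 * (c.drop (i + 1)).prod := by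
      have h0 : c.prod = (c.take i).prod * (c.getD i 1 * (c.drop (i + 1)).prod) := by
        conv_lhs => rw [← List.take_append_drop i c, List.prod_append,
          List.drop_eq_getElem_cons (by omega), List.prod_cons]
        rw [List.getD_eq_getElem]
      rw [← hprod, h0]
      simp only [mul_assoc]
    have h2 : E i = (t * (c.take i).prod).length := by
      simp only [hE, FreeMonoid.length_mul]
    rw [hEsucc i hi, h2]
    conv_lhs => rw [h1]
    exact subword_mul_mul _ _ _
  have hlt : ∀ i < l, E i < E (i + 1) := by
    intro i hi
    have := length_pos_of_ne_one (hstd i hi).2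
    have := hEsucc i hi
    omega
  have hEl : E l = W.length := by
    simp only [hE]
    rw [← hprod, ← hcl, List.take_length, FreeMonoid.length_mul]
  have hov : ∀ i, i + 2 ≤ l → IsMinOverlap lt I (some (c.getD i 1)) (c.getD (i + 1) 1) := by
    intro i hi
    rcases c with _ | ⟨w, c⟩
    · simp at hcl
      omega
    · have := (minChain_some_iff w c).1 hmin.2 i (by simp at hcl; omega)
      simpa using this
  refine ⟨E, ⟨?_, hlt, ?_, ?_, ?_⟩, by simp [hE], hEl, ?_⟩
  · intro hl
    rw [hEsucc 0 hl]
    rcases c with _ | ⟨w, c⟩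
    · simp at hcl
      omega
    · have := isMinOverlap_none_iff.1 hmin.1
      simpa using this
  · intro i hi
    rw [NonStdAt, hsub i hi]
    exact (hstd i hi).1
  · intro i hi
    rw [NonStdAt, ← subword_mul W (hlt i (by omega)).le (hlt (i + 1) (by omega)).le,
      hsub i (by omega), hsub (i + 1) (by omega)]
    exact (hov i hi).1
  · intro i hi b hb hBb
    -- The i-th block is standard, so a non-standard interval from its start must end beyond it; the
    -- excess would be a proper prefix of the next entry that already overlaps.
    have hb1 : E (i + 1) < b := by
      by_contra hcon
      have := intervalMono_nonStdAt W le_rfl (not_lt.1 hcon) hBb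
      rw [NonStdAt, hsub i (by omega)] at this
      exact (hstd i (by omega)).1 this
    rw [NonStdAt, ← subword_mul W (hlt i (by omega)).le hb1.le, hsub i (by omega)] at hBb
    refine (hov i hi).2 _ ⟨subword W b (E (i + 2)), fun h1 => ?_, ?_⟩ hBb
    · have := length_subword W (a := b) (hEl ▸ le_of_lt_succ hlt hi le_rfl)
      rw [h1, FreeMonoid.length_one] at this
      omega
    · rw [subword_mul W hb1.le hb.le, hsub (i + 1) (by omega)]
  · rw [← hc]
    refine List.ext_getElem (by simp [hcl]) fun i h1 h2 => ?_
    have h3 := hsub i (by omega)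
    rw [← getD_blocks (l := l) (by omega), List.getD_eq_getElem _ _ h2,
      List.getD_eq_getElem _ _ h1] at h3
    exact h3.symm

/-- A greedy sequence of positions yields a fully attached tuple. -/
lemma LeftGreedy.exists_chain (hE : LeftGreedy (NonStdAt lt I W) E l) (hl : E l = W.length) :
    ∃ e : Chain lt I l, e.cell.entries = blocks W E l ∧ subword W 0 (E 0) * e.word = W := by
  have hstd := blocks_std hE.lt_succ hl hE.block
  have hmin : MinChain lt I none (blocks W E l) := by
    rcases l with _ | l
    · trivial
    · rw [blocks_succ]
      have hle : ∀ i ≤ l + 1, E i ≤ W.length := fun i hi =>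
        hl ▸ le_of_lt_succ hE.lt_succ hi le_rfl
      refine ⟨?_, ?_⟩
      · rw [isMinOverlap_none_iff, length_subword W (hle 1 (by omega)), hE.first (by omega)]
        omega
      · rw [minChain_some_iff, ← blocks_succ, length_blocks]
        intro i hi
        rw [getD_blocks (by omega), getD_blocks hi]
        have h1 := hE.lt_succ i (by omega)
        have h2 : E (i + 1) < E (i + 2) := hE.lt_succ (i + 1) (by omega)
        refine ⟨?_, ?_⟩
        · change _ * _ ∈ _
          rw [subword_mul W h1.le h2.le]
          exact hE.pair i (by omega)
        · rintro v ⟨r, hr, hv⟩ hov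
          change v * r = subword W (E (i + 1)) (E (i + 2)) at hv
          have hlen := congrArg FreeMonoid.length hv
          rw [FreeMonoid.length_mul, length_subword W (hle (i + 2) (by omega))] at hlen
          have hr' := length_pos_of_ne_one hr
          refine hE.min i (by omega) (E (i + 1) + v.length) (by omega) ?_
          rw [NonStdAt, ← subword_mul W h1.le (Nat.le_add_right _ _)]
          have hvs : subword W (E (i + 1)) (E (i + 1) + v.length) = v := by
            have h3 := subword_mul W (a := E (i + 1)) (b := E (i + 1) + v.length)
              (c := E (i + 2)) (by omega) (by omega)
            rw [← hv] at h3
            have h4 : (subword W (E (i + 1)) (E (i + 1) + v.length)).length = v.length := by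
              rw [length_subword W]
              · omega
              · have := hle (i + 2) (by omega)
                omega
            exact (List.append_inj h3 h4).1
          rw [hvs]
          exact hov
  refine ⟨Chain.mk (Cell.mk _ hstd) hmin length_blocks, rfl, ?_⟩
  change _ * (blocks W E l).prod = W
  rw [prod_blocks hE.lt_succ, subword_mul W (Nat.zero_le _) (le_of_lt_succ hE.lt_succ (by omega)
    le_rfl), hl, subword_zero_length]

/-- The positions of such a suffix would be a sequence excluded by `LeftGreedy.not_shift`. -/
lemma not_chain_suffix_of_shift (hE : LeftGreedy (NonStdAt lt I W) E l) (hl : E l = W.length)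
    (hl0 : 0 < l) (g : Chain lt I l) {t : Word n} (ht : t * g.word = W) : t.length < E 1 := by
  by_contra hcon
  obtain ⟨G, hG, hG0, hGl, -⟩ := g.exists_leftGreedy ht
  exact hE.not_shift (intervalMono_nonStdAt W) hl0 (hG0 ▸ not_lt.1 hcon) hG.lt_succ hG.pair
    (hGl.trans hl.symm)

lemma not_chain_suffix_of_longer (hE : LeftGreedy (NonStdAt lt I W) E l) (hl : E l = W.length)
    (g : Chain lt I (l + 1)) {t : Word n} (ht : t * g.word = W) : t.length < E 0 := by
  by_contra hcon
  obtain ⟨G, hG, hG0, hGl, -⟩ := g.exists_leftGreedy ht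
  exact hE.not_longer (intervalMono_nonStdAt W) (hG0 ▸ not_lt.1 hcon) hG.lt_succ hG.pair
    (hGl.trans hl.symm)

/-- A word has at most one suffix that is a fully attached tuple of a given length. -/
theorem Chain.suffix_unique {f g : Chain lt I l} {t u : Word n} (h : t * f.word = u * g.word) :
    t = u ∧ f = g := by
  have key : ∀ {f g : Chain lt I l} {t u : Word n}, t * f.word = u * g.word →
      u.length ≤ t.length := by
    intro f g t u h
    obtain ⟨E, hE, hE0, hEl, -⟩ := f.exists_leftGreedy (rfl : t * f.word = _)
    by_cases hl : l = 0
    · have h0 : E l = E 0 := by rw [hl]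
      rw [h0, hE0, h, FreeMonoid.length_mul] at hEl
      omega
    -- The first block has length one, so this strict bound by E 1 is a weak bound by E 0; by
    -- symmetry the two prefixes have equal length.
    · have h1 := not_chain_suffix_of_shift hE hEl (by omega) g h.symm
      rw [hE.first (by omega)] at h1
      omega
  have hlen : t.length = u.length := le_antisymm (key h.symm) (key h)
  obtain ⟨htu, -⟩ := List.append_inj (show t.toList ++ f.word.toList = u.toList ++ g.word.toList
    from h) hlen
  refine ⟨htu, ?_⟩
  obtain ⟨E, hE, hE0, hEl, hEf⟩ := f.exists_leftGreedy (rfl : t * f.word = _)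
  obtain ⟨G, hG, hG0, hGl, hGg⟩ := g.exists_leftGreedy h.symm
  refine Chain.ext (Cell.ext ?_)
  rw [hEf, hGg]
  exact blocks_congr (hE.unique hG (by rw [hE0, hG0, hlen]))

end ChainPositions

/-! ### The leading terms of the Morse differential, by moving positions one at a time. -/

section Leading

variable {k : Type*} [Field k] {n : ℕ} {lt : Word n → Word n → Prop} {I : Ideal (NCPoly k n)}
variable [I.IsTwoSided] [Setting lt I]

/-! ### The leading terms of the Morse differential -/

variable {W : Word n} {D E L R : ℕ → ℕ} {l m : ℕ}

variable (lt I) in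
/-- The element of the bar resolution given by positions in the word `W`: the subword up to the
first position is the coefficient of the tuple of the following subwords. -/
def posTerm (W : Word n) (D : ℕ → ℕ) (l : ℕ) : BarMod lt I :=
  mon I (subword W 0 (D 0)) • barTerm lt I (blocks W D l) 1

lemma posTerm_of_pair (h : NonStdAt lt I W (D m) (D (m + 1))) (hm : m < l) :
    posTerm lt I W D l = 0 := by
  rw [posTerm, barTerm_of_not, smul_zero]
  exact fun hs => (hs _ (mem_blocks.2 ⟨m, hm, rfl⟩)).1 h

lemma posTerm_congr {D' : ℕ → ℕ} (h : ∀ i ≤ l, D i = D' i) :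
    posTerm lt I W D l = posTerm lt I W D' l := by
  rw [posTerm, posTerm, blocks_congr h, h 0 (Nat.zero_le l)]

lemma posTerm_mem_fil_of_nonStd (h : ∀ i < l, D i < D (i + 1)) (hl : D l = W.length)
    (h0 : NonStdAt lt I W 0 (D 0)) : posTerm lt I W D l ∈ fil lt I Cell.word (rank lt W) := by
  rw [posTerm, smul_barTerm_one]
  unfold barTerm
  split_ifs with hc
  · refine single_mon_mem_fil_of_mem_initialWords h0 ?_
    change rank lt (_ * (blocks W D l).prod) ≤ _
    rw [prod_blocks h, subword_mul W (Nat.zero_le _) (le_of_lt_succ h (Nat.zero_le l) le_rfl), hl,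
      subword_zero_length]
  · exact Submodule.zero_mem _

/-- No term of the projection has a larger word, and a term with the same word would exhibit a chain
as a suffix of it. -/
lemma morseProj_mem_fil_word (c : Cell lt I)
    (hno : ∀ (g : Chain lt I m) (t : Word n), t * g.word ≠ c.word) :
    morseProj lt I m (Finsupp.single c 1) ∈ fil lt I Chain.word (rank lt c.word) := by
  intro g t ht
  refine lt_of_le_of_ne (Nat.le_of_lt_succ (morseProj_mem_fil_single c g t ht)) fun he => ?_
  exact hno g t (rank_inj (Setting.ord lt I) he)

lemma morseProj_posTerm_mem_fil (h : ∀ i < l, D i < D (i + 1)) (hl : D l = W.length)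
    (hno : ∀ (g : Chain lt I m) (t : Word n), D 0 ≤ t.length → t * g.word ≠ W) :
    morseProj lt I m (posTerm lt I W D l) ∈ fil lt I Chain.word (rank lt W) := by
  rw [posTerm, map_smul]
  have hD := le_of_lt_succ h (Nat.zero_le l) le_rfl
  have hW : subword W 0 (D 0) * (blocks W D l).prod = W := by
    rw [prod_blocks h, subword_mul W (Nat.zero_le _) hD, hl, subword_zero_length]
  unfold barTerm
  split_ifs with hc
  · have := mon_smul_mem_fil_rank (u := subword W 0 (D 0)) (morseProj_mem_fil_word (m := m)
      (⟨blocks W D l, hc⟩ : Cell lt I) fun g t ht => ?_)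
    · change _ ∈ fil lt I Chain.word (rank lt (_ * (blocks W D l).prod)) at this
      rwa [hW] at this
    · refine hno g (subword W 0 (D 0) * t) ?_ ?_
      · rw [FreeMonoid.length_mul, length_subword W (hl ▸ hD)]
        omega
      · rw [mul_assoc, ht]
        exact hW
  · rw [map_zero, smul_zero]
    exact Submodule.zero_mem _

/-- The boundary of a tuple given by positions is the alternating sum over the omissions of one
position, up to lower terms. -/
lemma smul_cellBoundary_sub_mem_fil (h : ∀ i < l + 1, D i < D (i + 1)) (hl : D (l + 1) = W.length)
    {c : Cell lt I} (hc : c.entries = blocks W D (l + 1)) :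
    mon I (subword W 0 (D 0)) • cellBoundary c -
      ∑ j ∈ Finset.range (l + 1), (-1 : k) ^ j • posTerm lt I W (skip j D) l ∈
      fil lt I Cell.word (rank lt W) := by
  have hD := le_of_lt_succ h (Nat.zero_le (l + 1)) le_rfl
  have h1 := mon_smul_mem_fil_rank (u := subword W 0 (D 0))
    (cellBoundary_sub_mem_fil (hc.trans blocks_succ))
  have hW : subword W 0 (D 0) * c.word = W := by
    rw [Cell.word, hc, prod_blocks h, subword_mul W (Nat.zero_le _) hD, hl, subword_zero_length]
  rw [hW, smul_sub, ← blocks_succ, length_blocks, smul_add, Finset.smul_sum] at h1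
  convert h1 using 2
  rw [Finset.sum_range_succ', add_comm]
  congr 1
  -- Omitting the first position is the outer face: the first block moves into the coefficient.
  · rw [pow_zero, one_smul, posTerm, smul_barTerm_one, smul_barTerm, ← mon_mul]
    have h2 : skip 0 D = fun i => D (i + 1) := by
      funext i
      simp [skip]
    rw [h2, subword_mul W (Nat.zero_le _) (h 0 (by omega)).le]
  · refine Finset.sum_congr rfl fun j hj => ?_
    rw [smul_comm, face_blocks h (Finset.mem_range.1 hj), posTerm]
    simp [skip]

variable (L R) in
/-- The first `i` positions are taken from `L`, the others from `R`. -/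
def mixed (i j : ℕ) : ℕ := if j < i then L j else R j

variable (L R) in
/-- The positions `L 0, …, L i, R i, R (i + 1), …`. -/
def mixedBoth (i j : ℕ) : ℕ := if j ≤ i then L j else R (j - 1)

lemma skip_mixedBoth_self (i : ℕ) : skip i (mixedBoth L R i) = mixed L R i := by
  funext j
  simp only [skip, mixedBoth, mixed]
  split_ifs <;> first | rfl | omega

lemma skip_mixedBoth_succ (i : ℕ) : skip (i + 1) (mixedBoth L R i) = mixed L R (i + 1) := by
  funext j
  simp only [skip, mixedBoth, mixed]
  split_ifs <;> first | rfl | omega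

/-- Two interleaved sequences of positions yield homologous elements. -/
theorem morseProj_posTerm_mixed_sub_mem_fil (hRl : R l = W.length)
    (hLR : ∀ i ≤ l, L i ≤ R i) (hRL : ∀ i < l, R i < L (i + 1))
    (hLpair : ∀ i, i + 2 ≤ l → NonStdAt lt I W (L i) (L (i + 2)))
    (hRpair : ∀ i, i + 2 ≤ l → NonStdAt lt I W (R i) (R (i + 2)))
    (hLblock : ∀ i < l, ¬ NonStdAt lt I W (L i) (L (i + 1)))
    (hRblock : ∀ i < l, ¬ NonStdAt lt I W (R i) (R (i + 1)))
    (hno : ∀ (g : Chain lt I (l + 1)) (t : Word n), L 0 ≤ t.length → t * g.word ≠ W)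
    (hout : 0 < l → (∀ i < l, L i < L (i + 1)) → ∀ D : ℕ → ℕ, D 0 = L 1 →
      (∀ i < l, D i < D (i + 1)) → D l = W.length →
      morseProj lt I l (posTerm lt I W D l) ∈ fil lt I Chain.word (rank lt W))
    {i : ℕ} (hi : i ≤ l) :
    morseProj lt I l (posTerm lt I W R l) - morseProj lt I l (posTerm lt I W (mixed L R i) l) ∈
      fil lt I Chain.word (rank lt W) := by
  have hL : ∀ i < l, L i < L (i + 1) := fun i hi => (hLR i hi.le).trans_lt (hRL i hi)
  have hR : ∀ i < l, R i < R (i + 1) := fun i hi => (hRL i hi).trans_le (hLR (i + 1) hi)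
  induction i with
  | zero =>
    have : mixed L R 0 = R := by
      funext j
      simp [mixed]
    rw [this, sub_self]
    exact Submodule.zero_mem _
  | succ i ih =>
    rw [← sub_add_sub_cancel _ (morseProj lt I l (posTerm lt I W (mixed L R i) l))]
    refine Submodule.add_mem _ (ih (by omega)) ?_
    -- If the two positions coincide, there is nothing to move.
    rcases (hLR i (by omega)).eq_or_lt with hi' | hi'
    · have : mixed L R i = mixed L R (i + 1) := by
        funext j
        simp only [mixed]
        split_ifs <;> first | rfl | omega | skip
        obtain rfl : j = i := by omega
        exact hi'.symm
      rw [this, sub_self]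
      exact Submodule.zero_mem _
    -- The tuple with both L i and R i has one position more. Modulo smaller words, its boundary
    -- compares the sequence that switches at i with the one that switches at i + 1.
    set D := mixedBoth L R i with hDdef
    have hDl : ∀ j ≤ i, D j = L j := fun j hj => if_pos hj
    have hDr : ∀ j, i < j → D j = R (j - 1) := fun j hj => if_neg (not_le.2 hj)
    have hD : ∀ j < l + 1, D j < D (j + 1) := by
      intro j hj
      rcases lt_trichotomy j i with h | rfl | h
      · rw [hDl j h.le, hDl (j + 1) h]
        exact hL j (by omega)
      · rw [hDl j le_rfl, hDr (j + 1) (by omega)]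
        exact hi'
      · obtain ⟨j, rfl⟩ : ∃ j', j = j' + 1 := ⟨j - 1, by omega⟩
        rw [hDr _ h, hDr (j + 1 + 1) (by omega)]
        exact hR j (by omega)
    have hDW : D (l + 1) = W.length := by rw [hDr _ (by omega)]; exact hRl
    have hmono := intervalMono_nonStdAt (lt := lt) (I := I) W
    have hstd := blocks_std (lt := lt) (I := I) hD hDW fun j hj => by
      rcases lt_trichotomy j i with h | rfl | h
      · rw [hDl j h.le, hDl (j + 1) h]
        exact hLblock j (by omega)
      · rw [hDl j le_rfl, hDr (j + 1) (by omega)]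
        exact fun h => hLblock j (by omega) (hmono le_rfl (hRL j (by omega)).le h)
      · obtain ⟨j, rfl⟩ : ∃ j', j = j' + 1 := ⟨j - 1, by omega⟩
        rw [hDr _ h, hDr (j + 1 + 1) (by omega)]
        exact hRblock j (by omega)
    set c : Cell lt I := Cell.mk _ hstd with hc
    have hcent : c.entries = blocks W D (l + 1) := rfl
    have hbd := morseProj_mem_fil (l := l) (smul_cellBoundary_sub_mem_fil hD hDW hcent)
    have hterm : mon I (subword W 0 (D 0)) • cellBoundary c = bd lt I (posTerm lt I W D (l + 1)) := by
      rw [posTerm, ← hcent, barTerm_of_cell, map_smul, bd_single, one_smul]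
    -- The projection of this larger tuple has only smaller words, as no chain with l + 1 entries is
    -- a suffix starting at or after L 0; hence so has its Morse differential.
    have hno' := morseDifferential_mem_fil (morseProj_posTerm_mem_fil (m := l + 1) hD hDW
      (by rwa [hDl 0 (Nat.zero_le i)]))
    rw [hterm, map_sub, morseProj_bd] at hbd
    have hsum := (Submodule.sub_mem_iff_right _ hno').1 hbd
    rw [map_sum, ← Finset.add_sum_erase _ _ (Finset.mem_range.2 (show i < l + 1 by omega)),
      ← Finset.add_sum_erase _ _ (Finset.mem_erase.2 ⟨(show i + 1 ≠ i by omega),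
        Finset.mem_range.2 (show i + 1 < l + 1 by omega)⟩), ← add_assoc] at hsum
    have hrest := (Submodule.add_mem_iff_left _ (Submodule.sum_mem _ fun j hj => ?_)).1 hsum
    · rw [LinearMap.map_smul_of_tower, LinearMap.map_smul_of_tower, skip_mixedBoth_self,
        skip_mixedBoth_succ, pow_succ, mul_neg_one, neg_smul, ← sub_eq_add_neg, ← smul_sub] at hrest
      exact (Submodule.smul_mem_iff _ (pow_ne_zero _ (by simp))).1 hrest
    · rw [Finset.mem_erase, Finset.mem_erase, Finset.mem_range] at hj
      rw [LinearMap.map_smul_of_tower]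
      refine Submodule.smul_mem _ _ ?_
      -- Omitting the first position, if it is not L i itself, is covered by `hout`. Any other
      -- remaining omission joins two consecutive blocks of L or of R, which are non-standard
      -- together.
      rcases j with _ | j
      · refine hout (by omega) hL _ ?_ (fun j hj => ?_) ?_
        · change D 1 = _
          exact hDl 1 (by omega)
        · change D (j + 1) < D (j + 2)
          exact hD _ (by omega)
        · exact hDW
      · rw [posTerm_of_pair (m := j), map_zero]
        · exact Submodule.zero_mem _
        · have h1 : skip (j + 1) D j = D j := if_pos (Nat.lt_succ_self j)
          have h2 : skip (j + 1) D (j + 1) = D (j + 2) := if_neg (lt_irrefl _)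
          rw [h1, h2]
          rcases Nat.lt_or_ge (j + 1) i with h | h
          · rw [hDl j (by omega), hDl (j + 2) (by omega)]
            exact hLpair j (by omega)
          · obtain ⟨j, rfl⟩ : ∃ j', j = j' + 1 := ⟨j - 1, by omega⟩
            rw [hDr (j + 1) (by omega), hDr (j + 1 + 2) (by omega)]
            exact hRpair j (by omega)
        · omega

lemma morseProj_posTerm_chain (f : Chain lt I l) (hf : f.cell.entries = blocks W D l) :
    morseProj lt I l (posTerm lt I W D l) = Finsupp.single f (mon I (subword W 0 (D 0))) := by
  rw [posTerm, ← hf, barTerm_of_cell, map_smul, morseProj_chain, Finsupp.smul_single_one]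

/-- The tail of a right greedy sequence, made left greedy, yields the leading term of the Morse
differential. -/
theorem exists_leading_term (e : Chain lt I (l + 1)) (hE : LeftGreedy (NonStdAt lt I W) E (l + 1))
    (hEl : E (l + 1) = W.length) (he : e.cell.entries = blocks W E (l + 1))
    (hR : RightGreedy (NonStdAt lt I W) R (l + 1)) (hRl : R (l + 1) = W.length)
    (hER : ∀ i ≤ l + 1, E i ≤ R i) (hRE : ∀ i < l + 1, R i < E (i + 1)) (hE0 : E 0 = 0) :
    ∃ f : Chain lt I l, subword W 0 (R 1) * f.word = W ∧
      morseDifferential lt I l (Finsupp.single e 1) - Finsupp.single f (mon I (subword W 0 (R 1))) ∈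
        fil lt I Chain.word (rank lt W) := by
  have hmono := intervalMono_nonStdAt (lt := lt) (I := I) W
  obtain ⟨F, hF, hF0, hFl, hFR, hRF⟩ := hR.tail.exists_leftGreedy hmono
  obtain ⟨f, hf, hfW⟩ := hF.exists_chain (hFl.trans hRl)
  rw [hF0] at hfW
  refine ⟨f, hfW, ?_⟩
  -- From the positions of the outer face of e to those of R. No chain with l + 1 entries starts at
  -- or after E 1, and a tuple starting at E 2 has a non-standard coefficient.
  have h1 := morseProj_posTerm_mixed_sub_mem_fil (lt := lt) (I := I) (W := W) (l := l)
    (L := fun i => E (i + 1)) (R := fun i => R (i + 1)) hRl (fun i hi => hER _ (by omega))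
    (fun i hi => hRE _ (by omega)) (fun i hi => hE.pair _ (by omega))
    (fun i hi => hR.pair _ (by omega)) (fun i hi => hE.block _ (by omega))
    (fun i hi => hR.block _ (by omega))
    (fun g t ht htg => absurd (not_chain_suffix_of_shift hE hEl (by omega) g htg) (not_lt.2 ht))
    (fun hl _ D hD0 hD hDW => morseProj_mem_fil (posTerm_mem_fil_of_nonStd hD hDW (by
      rw [hD0, ← hE0]
      exact hE.pair 0 (by omega)))) (le_refl l)
  -- From the positions of R to the chain f given by F. Here longer chains do not fit, and a chain
  -- with l entries cannot start at or after F 1.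
  have h2 := morseProj_posTerm_mixed_sub_mem_fil (lt := lt) (I := I) (W := W) (l := l)
    (L := F) (R := fun i => R (i + 1)) hRl hFR
    hRF hF.pair (fun i hi => hR.pair _ (by omega)) hF.block (fun i hi => hR.block _ (by omega))
    (fun g t ht htg => absurd (not_chain_suffix_of_longer hF (hFl.trans hRl) g htg) (not_lt.2 ht))
    (fun hl _ D hD0 hD hDW => morseProj_posTerm_mem_fil hD hDW fun g t ht htg =>
      absurd (not_chain_suffix_of_shift hF (hFl.trans hRl) hl g htg) (not_lt.2 (hD0 ▸ ht)))
    (le_refl l)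
  rw [posTerm_congr (D := mixed F _ l) (D' := F), morseProj_posTerm_chain f hf, hF0] at h2
  · rw [posTerm_congr (D := mixed _ _ l) (D' := fun i => E (i + 1))] at h1
    · have h3 : morseDifferential lt I l (Finsupp.single e 1) -
          morseProj lt I l (posTerm lt I W (fun i => E (i + 1)) l) ∈
          fil lt I Chain.word (rank lt W) := by
        rw [morseDifferential_single, one_smul, ← map_sub]
        refine morseProj_mem_fil ?_
        have h4 := cellBoundary_sub_mem_fil (he.trans blocks_succ)
        have hew : e.cell.word = W := by
          rw [Cell.word, he, prod_blocks hE.lt_succ, hE0, hEl, subword_zero_length]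
        rw [hew, Finset.sum_eq_zero, add_zero] at h4
        · rw [hE0] at h4
          rwa [posTerm, smul_barTerm_one]
        · intro j hj
          rw [Finset.mem_range, length_blocks] at hj
          rw [← blocks_succ, barTerm_of_not, smul_zero]
          rw [face_blocks hE.lt_succ hj]
          intro hs
          refine (hs _ (mem_blocks.2 ⟨j, hj, rfl⟩)).1 ?_
          have h5 : skip (j + 1) E j = E j := if_pos (Nat.lt_succ_self j)
          have h6 : skip (j + 1) E (j + 1) = E (j + 2) := if_neg (lt_irrefl _)
          rw [h5, h6]
          exact hE.pair j (by omega)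
      have h7 := Submodule.add_mem _ (Submodule.sub_mem _ h3 h1) h2
      convert h7 using 1
      abel
    · intro i hi
      rcases hi.eq_or_lt with rfl | hi
      · simp [mixed, hRl, hEl]
      · exact if_pos hi
  · intro i hi
    rcases hi.eq_or_lt with rfl | hi
    · simp [mixed, hFl]
    · exact if_pos hi

/-- The leading term of the Morse differential, in terms of the filtration. -/
theorem morseDifferential_leading (e : Chain lt I (l + 1)) :
    ∃ (s : Word n) (f : Chain lt I l), s ∈ stdWords lt I ∧ s * f.word = e.word ∧
      morseDifferential lt I l (Finsupp.single e 1) - Finsupp.single f (mon I s) ∈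
        fil lt I Chain.word (rank lt e.word) := by
  obtain ⟨E, hE, hE0, hEl, he⟩ := e.exists_leftGreedy (one_mul e.word)
  obtain ⟨R, hR, hRm, hER, hRE⟩ := hE.exists_rightGreedy (intervalMono_nonStdAt _)
  rw [FreeMonoid.length_one] at hE0
  obtain ⟨f, hf, hd⟩ := exists_leading_term e hE hEl he hR (hRm.trans hEl) hER hRE hE0
  refine ⟨_, f, subword_mem_stdWords ?_ ?_ ?_, hf, hd⟩
  · have h1 := hRE 0 (by omega)
    have h2 := hE.first (by omega)
    have h3 : R 0 = 0 := by
      change R 0 < E 1 at h1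
      omega
    have := hR.block 0 (by omega)
    rwa [h3] at this
  · have h1 := hER 1 (by omega)
    have h2 := hE.first (by omega)
    omega
  · rw [← hRm.trans hEl]
    exact le_of_lt_succ hR.lt_succ (by omega) le_rfl

end Leading

/-! ### Exactness as a consequence of the leading terms. -/

section Exactness

variable {k : Type*} [Field k] {n : ℕ} {lt : Word n → Word n → Prop} {I : Ideal (NCPoly k n)}
variable [I.IsTwoSided] [Setting lt I]

/-! ### Complexes with leading terms are exact -/

variable {l m : ℕ}

lemma span_terms_eq_fil (w : Word n) :
    Submodule.span k {y : FreeMod lt I l | ∃ (t : Word n) (g : Chain lt I l),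
      t ∉ initialWords lt I ∧ lt (t * g.word) w ∧ y = Finsupp.single g (mon I t)} =
      fil lt I Chain.word (rank lt w) := by
  refine le_antisymm (Submodule.span_le.2 ?_) (fil_le fun g t ht hr => ?_)
  · rintro _ ⟨t, g, -, hlt, rfl⟩
    exact single_mon_mem_fil (rank_lt_of_lt (Setting.ord lt I) hlt)
  · exact Submodule.subset_span ⟨t, g, ht, (rank_lt_iff (Setting.ord lt I)).1 hr, rfl⟩

lemma hasAnickLeadingTerms_iff {d : Differential lt I} : HasAnickLeadingTerms lt I d ↔
    ∀ l (e : Chain lt I (l + 1)), ∃ (s : Word n) (f : Chain lt I l),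
      s ∈ stdWords lt I ∧ s * f.word = e.word ∧
        d l (Finsupp.single e 1) - Finsupp.single f (mon I s) ∈
          fil lt I Chain.word (rank lt e.word) := by
  simp only [HasAnickLeadingTerms, span_terms_eq_fil]

/-- **The Morse differential has the leading terms of an Anick resolution.** -/
theorem hasAnickLeadingTerms_morseDifferential :
    HasAnickLeadingTerms lt I (morseDifferential lt I) :=
  hasAnickLeadingTerms_iff.2 fun _ e => morseDifferential_leading e

lemma single_mon_eq_smul {G : Type*} (g : G) (t : Word n) :
    (Finsupp.single g (mon I t) : G →₀ (NCPoly k n ⧸ I)) = mon I t • Finsupp.single g 1 :=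
  (Finsupp.smul_single_one _ _).symm

/-- The leading term is determined by the word. -/
lemma HasAnickLeadingTerms.sub_mem_fil {d : Differential lt I} (hd : HasAnickLeadingTerms lt I d)
    {e : Chain lt I (l + 1)} {s : Word n} {f : Chain lt I l} (h : s * f.word = e.word) :
    d l (Finsupp.single e 1) - Finsupp.single f (mon I s) ∈
      fil lt I Chain.word (rank lt e.word) := by
  obtain ⟨s', f', -, h', hmem⟩ := hasAnickLeadingTerms_iff.1 hd l e
  obtain ⟨rfl, rfl⟩ := Chain.suffix_unique (h'.trans h.symm)
  exact hmem

lemma HasAnickLeadingTerms.map_mem_fil {d : Differential lt I} (hd : HasAnickLeadingTerms lt I d)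
    {x : FreeMod lt I (l + 1)} (hx : x ∈ fil lt I Chain.word m) :
    d l x ∈ fil lt I Chain.word m := by
  refine AnickMorse.map_mem_fil (d l) hx fun e _ => ?_
  obtain ⟨s, f, -, h, hmem⟩ := hasAnickLeadingTerms_iff.1 hd l e
  have h1 : Finsupp.single f (mon I s) ∈ fil lt I Chain.word (rank lt e.word + 1) :=
    single_mon_mem_fil (h ▸ Nat.lt_succ_self _)
  have h2 := Submodule.add_mem _ (fil_mono (Nat.le_succ _) hmem) h1
  rwa [sub_add_cancel] at h2

/-- An element of the free module has at most one term whose word has maximal rank. -/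
lemma exists_top_term {z : FreeMod lt I l} (hz : z ∈ fil lt I Chain.word (m + 1))
    (hz' : z ∉ fil lt I Chain.word m) :
    ∃ (g : Chain lt I l) (t : Word n), stdCoeff lt I (z g) t ≠ 0 ∧ rank lt (t * g.word) = m ∧
      z - stdCoeff lt I (z g) t • Finsupp.single g (mon I t) ∈ fil lt I Chain.word m := by
  rw [mem_fil] at hz'
  push Not at hz'
  obtain ⟨g, t, hα, hm⟩ := hz'
  have hm' : rank lt (t * g.word) = m := le_antisymm (Nat.le_of_lt_succ (hz g t hα)) hm
  refine ⟨g, t, hα, hm', fun g' t' h => ?_⟩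
  by_contra hcon
  rw [Finsupp.sub_apply, map_sub, Finsupp.sub_apply, Finsupp.smul_apply, map_smul,
    Finsupp.smul_apply, Finsupp.single_apply] at h
  have hsame : g' = g ∧ t' = t → False := by
    rintro ⟨rfl, rfl⟩
    rw [if_pos rfl, stdCoeff_mon_of_std (notMem_of_stdCoeff_ne hα), Finsupp.single_eq_same,
      smul_eq_mul, mul_one, sub_self] at h
    exact h rfl
  have hne : stdCoeff lt I (z g') t' ≠ 0 := by
    intro h0
    rw [h0, zero_sub, neg_ne_zero] at h
    split_ifs at h with hg
    · rw [stdCoeff_mon_of_std (notMem_of_stdCoeff_ne hα), Finsupp.single_apply] at h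
      split_ifs at h with ht
      · exact hsame ⟨hg.symm, ht.symm⟩
      · simp at h
    · simp at h
  have h1 : rank lt (t' * g'.word) = rank lt (t * g.word) := by
    have := hz g' t' hne
    omega
  obtain ⟨h2, h3⟩ := Chain.suffix_unique (rank_inj (Setting.ord lt I) h1)
  exact hsame ⟨h3, h2⟩

/-- If the leading term of the differential of a term is not standard, then the term is itself
the leading term of a differential. -/
lemma exists_extension {t s : Word n} {g : Chain lt I (l + 1)} {g' : Chain lt I l}
    (h : s * g'.word = g.word) (ht : t ∉ initialWords lt I) (hts : t * s ∈ initialWords lt I) :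
    ∃ (t' s' : Word n) (e : Chain lt I (l + 2)), t = t' * s' ∧ s' * g.word = e.word := by
  obtain ⟨W, hW⟩ : ∃ W, W = t * g.word := ⟨_, rfl⟩
  have hmono := intervalMono_nonStdAt (lt := lt) (I := I) W
  obtain ⟨E, hE, hE0, hEl, -⟩ := g.exists_leftGreedy hW.symm
  obtain ⟨R, hR, hRl, hER, hRE⟩ := hE.exists_rightGreedy hmono
  obtain ⟨F, hF, hF0, hFl, -, -⟩ := hR.tail.exists_leftGreedy hmono
  obtain ⟨f, -, hf⟩ := hF.exists_chain (hFl.trans (hRl.trans hEl))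
  -- The first block of g is one letter, which leaves no room between E 0 and E 1.
  have hR0 : R 0 = t.length := by
    have h1 := hRE 0 (by omega)
    have h2 := hER 0 (by omega)
    have h3 := hE.first (by omega)
    change R 0 < E 1 at h1
    omega
  have htW : subword W 0 t.length = t := by
    have := subword_mul_mul 1 t g.word
    rwa [one_mul, ← hW, FreeMonoid.length_one, zero_add] at this
  have hts' : t * s * g'.word = W := by rw [mul_assoc, h, hW]
  -- The chain obtained from the tail of R is g', since suffixes are unique; so R 1 is the length of
  -- ts.
  obtain ⟨h1, -⟩ := Chain.suffix_unique (hf.trans hts'.symm)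
  rw [hF0] at h1
  -- Up to R 1 the word is ts, which is not standard; up to R 0 it is t, which is standard. So R
  -- extends to the left inside t.
  obtain ⟨a, -, haR, hR'⟩ := hR.exists_cons hmono (c := 0)
    (by change subword W 0 (R (0 + 1)) ∈ _; rw [h1]; exact hts)
    (by rw [hR0, NonStdAt, htW]; exact ht) (Nat.zero_le _)
  obtain ⟨F', hF', hF'0, hF'l, -, -⟩ := hR'.exists_leftGreedy hmono
  obtain ⟨e, -, he⟩ := hF'.exists_chain (hF'l.trans (hRl.trans hEl))
  have hta : subword W 0 a * subword W a t.length = t := by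
    rw [subword_mul W (Nat.zero_le _) (by omega), htW]
  refine ⟨subword W 0 a, subword W a t.length, e, hta.symm, ?_⟩
  have h2 : F' 0 = a := hF'0
  rw [h2] at he
  refine mul_left_cancel (a := subword W 0 a) ?_
  rw [he, ← mul_assoc, hta, hW]

/-- The differential of t'·e has the leading term t's·g = t·g, which cancels the top term of z. -/
lemma exists_reduction_of_extension {d : Differential lt I} (hd : HasAnickLeadingTerms lt I d)
    {z : FreeMod lt I l} {g : Chain lt I l} {t t' s : Word n} {a : k} {e : Chain lt I (l + 1)}
    (hm : rank lt (t * g.word) = m)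
    (hz : z - a • Finsupp.single g (mon I t) ∈ fil lt I Chain.word m)
    (ht : t = t' * s) (he : s * g.word = e.word) :
    ∃ y ∈ fil lt I Chain.word (m + 1), z - d l y ∈ fil lt I Chain.word m := by
  have hm' : rank lt (t' * e.word) = m := by rw [← he, ← mul_assoc, ← ht, hm]
  refine ⟨a • Finsupp.single e (mon I t'), Submodule.smul_mem _ _ (single_mon_mem_fil ?_), ?_⟩
  · rw [hm']
    exact Nat.lt_succ_self m
  · have h1 := mon_smul_mem_fil_rank (u := t') (hd.sub_mem_fil he)
    rw [smul_sub, ← map_smul, Finsupp.smul_single_one, Finsupp.smul_single, smul_eq_mul,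
      ← mon_mul, ← ht, hm'] at h1
    have h2 := Submodule.sub_mem _ hz (Submodule.smul_mem _ a h1)
    rw [LinearMap.map_smul_of_tower]
    convert h2 using 1
    rw [smul_sub]
    abel

/-- Let t·g be the top term of the cycle and s·f the leading term of dg. If ts were standard, ts·f
would survive in dz; so ts is not standard and `exists_extension` applies. -/
lemma exists_reduction_succ {d : Differential lt I} (hd : HasAnickLeadingTerms lt I d)
    {z : FreeMod lt I (l + 1)} (hz : d l z = 0) (hzm : z ∈ fil lt I Chain.word (m + 1)) :
    ∃ y ∈ fil lt I Chain.word (m + 1), z - d (l + 1) y ∈ fil lt I Chain.word m := by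
  by_cases hz' : z ∈ fil lt I Chain.word m
  · exact ⟨0, Submodule.zero_mem _, by rwa [map_zero, sub_zero]⟩
  obtain ⟨g, t, hα, hm, htop⟩ := exists_top_term hzm hz'
  have hstd := notMem_of_stdCoeff_ne hα
  obtain ⟨s, f, -, hsf, hmem⟩ := hasAnickLeadingTerms_iff.1 hd l g
  have hts : t * s ∈ initialWords lt I := by
    by_contra hts
    have h1 := hd.map_mem_fil htop
    rw [map_sub, hz, zero_sub, LinearMap.map_smul_of_tower, ← smul_neg,
      Submodule.smul_mem_iff _ hα, Submodule.neg_mem_iff, single_mon_eq_smul, map_smul] at h1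
    have h2 := mon_smul_mem_fil_rank (u := t) hmem
    rw [hm, smul_sub, Submodule.sub_mem_iff_right _ h1, Finsupp.smul_single, smul_eq_mul,
      ← mon_mul, single_mem_fil] at h2
    have h3 := h2 (t * s) (by rw [stdCoeff_mon_of_std hts, Finsupp.single_eq_same]; exact one_ne_zero)
    rw [mul_assoc, hsf, hm] at h3
    exact lt_irrefl _ h3
  obtain ⟨t', s', e, ht, he⟩ := exists_extension hsf hstd hts
  exact exists_reduction_of_extension hd hm htop ht he

lemma Chain.word_zero (f : Chain lt I 0) : f.word = 1 := by
  have := List.length_eq_zero_iff.1 f.length_cell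
  rw [Chain.word_eq, Cell.word, this, List.prod_nil]

instance : Unique (Chain lt I 0) where
  default := Chain.mk Cell.nil trivial rfl
  uniq f := (Chain.suffix_unique (t := 1) (u := 1) (by rw [Chain.word_zero, Chain.word_zero])).2

lemma augmentation_eq_zero_iff {z : FreeMod lt I 0} {g : Chain lt I 0} :
    augmentation lt I z = 0 ↔ stdCoeff lt I (z g) 1 = 0 := by
  have hz : z = Finsupp.single g (z g) := by
    refine Finsupp.ext fun g' => ?_
    rw [Subsingleton.elim g' g, Finsupp.single_eq_same]
  rw [stdCoeff_apply_one, ← mem_augIdeal_iff (lt := lt), hz, augmentation,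
    Finsupp.linearCombination_single, Finsupp.single_eq_same, ← Submodule.Quotient.mk_smul,
    Submodule.Quotient.mk_eq_zero, smul_eq_mul, mul_one]

/-- A top term in the kernel of the augmentation is not constant; its last letter is the chain that
provides the boundary. -/
lemma exists_reduction_zero {d : Differential lt I} (hd : HasAnickLeadingTerms lt I d)
    {z : FreeMod lt I 0} (hz : augmentation lt I z = 0)
    (hzm : z ∈ fil lt I Chain.word (m + 1)) :
    ∃ y ∈ fil lt I Chain.word (m + 1), z - d 0 y ∈ fil lt I Chain.word m := by
  by_cases hz' : z ∈ fil lt I Chain.word m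
  · exact ⟨0, Submodule.zero_mem _, by rwa [map_zero, sub_zero]⟩
  obtain ⟨g, t, hα, hm, htop⟩ := exists_top_term hzm hz'
  have hstd := notMem_of_stdCoeff_ne hα
  have ht1 : t ≠ 1 := by
    rintro rfl
    exact hα (augmentation_eq_zero_iff.1 hz)
  obtain ⟨t', i, ht⟩ : ∃ (t' : Word n) (i : Fin n), t = t' * FreeMonoid.of i := by
    obtain ⟨l, i, h⟩ := List.eq_nil_or_concat t.toList |>.resolve_left ht1
    exact ⟨FreeMonoid.ofList l, i, by
      apply FreeMonoid.toList.injective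
      rw [h, FreeMonoid.toList_mul]
      simp⟩
  have hi : FreeMonoid.of i ∈ stdWords lt I := by
    refine ⟨fun h => hstd ?_, FreeMonoid.of_ne_one i⟩
    rw [ht]
    exact mul_left_mem_initialWords t' h
  have hcell : ∀ w ∈ [FreeMonoid.of i], w ∈ stdWords lt I := by
    intro w hw
    rw [List.mem_singleton.1 hw]
    exact hi
  refine exists_reduction_of_extension hd hm htop ht
    (e := Chain.mk (Cell.mk _ hcell) ⟨isMinOverlap_none_iff.2 rfl, trivial⟩ rfl) ?_
  rw [Chain.word_zero, mul_one]
  change FreeMonoid.of i = List.prod [FreeMonoid.of i]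
  rw [List.prod_singleton]

/-- A filtered map is onto if it is so up to lower terms. -/
lemma exists_preimage_mem_fil {d : FreeMod lt I (l + 1) →ₗ[NCPoly k n ⧸ I] FreeMod lt I l}
    {K : AddSubgroup (FreeMod lt I l)} (hd : ∀ y, d y ∈ K)
    (hstep : ∀ m, ∀ z ∈ K, z ∈ fil lt I Chain.word (m + 1) →
      ∃ y ∈ fil lt I Chain.word (m + 1), z - d y ∈ fil lt I Chain.word m)
    {z : FreeMod lt I l} (hz : z ∈ K) (hzm : z ∈ fil lt I Chain.word m) :
    ∃ y ∈ fil lt I Chain.word m, d y = z := by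
  induction m generalizing z with
  | zero => exact ⟨0, Submodule.zero_mem _, by rw [map_zero, fil_zero hzm]⟩
  | succ m ih =>
    obtain ⟨y, hy, hzy⟩ := hstep m z hz hzm
    obtain ⟨y', hy', h⟩ := ih (K.sub_mem hz (hd y)) hzy
    exact ⟨y + y', Submodule.add_mem _ hy (fil_mono (Nat.le_succ m) hy'), by
      rw [map_add, h, add_sub_cancel]⟩

variable (lt I) in
/-- The cycles of an augmented complex. -/
def cycles (d : Differential lt I) : ∀ l, AddSubgroup (FreeMod lt I l)
  | 0 => (augmentation lt I).toAddMonoidHom.ker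
  | l + 1 => (d l).toAddMonoidHom.ker

lemma mem_cycles_zero {d : Differential lt I} {z : FreeMod lt I 0} :
    z ∈ cycles lt I d 0 ↔ augmentation lt I z = 0 := Iff.rfl

lemma mem_cycles_succ {d : Differential lt I} {z : FreeMod lt I (l + 1)} :
    z ∈ cycles lt I d (l + 1) ↔ d l z = 0 := Iff.rfl

/-- A cycle is the boundary of an element with terms of no larger words. -/
theorem HasAnickLeadingTerms.exists_preimage {d : Differential lt I}
    (hd : HasAnickLeadingTerms lt I d) (hdd : ∀ l y, d l y ∈ cycles lt I d l)
    {z : FreeMod lt I l} (hz : z ∈ cycles lt I d l) (hzm : z ∈ fil lt I Chain.word m) :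
    ∃ y ∈ fil lt I Chain.word m, d l y = z := by
  refine exists_preimage_mem_fil (hdd l) (fun m z hz hzm => ?_) hz hzm
  cases l with
  | zero => exact exists_reduction_zero hd hz hzm
  | succ l => exact exists_reduction_succ hd hz hzm

lemma augmentation_morseDifferential (x : FreeMod lt I 1) :
    augmentation lt I (morseDifferential lt I 0 x) = 0 := by
  suffices h : (augmentation lt I).comp (morseDifferential lt I 0) = 0 from
    LinearMap.congr_fun h x
  refine Finsupp.lhom_ext' fun e => LinearMap.ext_ring ?_
  change augmentation lt I (morseDifferential lt I 0 (Finsupp.single e 1)) = 0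
  obtain ⟨w, hw⟩ := List.length_eq_one_iff.1 e.length_cell
  have hb : cellBoundary e.cell = Finsupp.single (default : Chain lt I 0).cell (mon I w) := by
    rw [cellBoundary, hw, listBoundary, innerBoundary]
    simp only [List.length_singleton, Nat.sub_self, Finset.range_zero, Finset.sum_empty, add_zero]
    exact barTerm_of_cell (default : Chain lt I 0).cell _
  rw [morseDifferential_single, one_smul, hb, morseProj_chain, augmentation,
    Finsupp.linearCombination_single, ← Submodule.Quotient.mk_smul, Submodule.Quotient.mk_eq_zero,
    smul_eq_mul, mul_one]
  exact mon_mem_augIdeal (e.cell.std w (by simp [hw])).2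

lemma morseDifferential_mem_cycles (l : ℕ) (y : FreeMod lt I (l + 1)) :
    morseDifferential lt I l y ∈ cycles lt I (morseDifferential lt I) l := by
  cases l with
  | zero => exact augmentation_morseDifferential y
  | succ l => exact morseDifferential_morseDifferential y

/-- **The Morse complex is a resolution.** -/
theorem isResolution_morseDifferential : IsResolution lt I (morseDifferential lt I) where
  surjective := by
    intro y
    obtain ⟨a, rfl⟩ := Submodule.Quotient.mk_surjective _ y
    refine ⟨Finsupp.single default a, ?_⟩
    rw [augmentation, Finsupp.linearCombination_single, ← Submodule.Quotient.mk_smul, smul_eq_mul,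
      mul_one]
  exact_zero := by
    intro z
    refine ⟨fun hz => ?_, ?_⟩
    · obtain ⟨m, hm⟩ := exists_mem_fil (lt := lt) (wd := Chain.word) z
      obtain ⟨y, -, hy⟩ := hasAnickLeadingTerms_morseDifferential.exists_preimage
        morseDifferential_mem_cycles (mem_cycles_zero.2 hz) hm
      exact ⟨y, hy⟩
    · rintro ⟨y, rfl⟩
      exact augmentation_morseDifferential y
  exact_succ l := by
    intro z
    refine ⟨fun hz => ?_, ?_⟩
    · obtain ⟨m, hm⟩ := exists_mem_fil (lt := lt) (wd := Chain.word) z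
      obtain ⟨y, -, hy⟩ := hasAnickLeadingTerms_morseDifferential.exists_preimage
        morseDifferential_mem_cycles (mem_cycles_succ.2 hz) hm
      exact ⟨y, hy⟩
    · rintro ⟨y, rfl⟩
      exact morseDifferential_morseDifferential y

end Exactness

/-! ### Comparison of complexes with the same leading terms. -/

section Comparison

variable {k : Type*} [Field k] {n : ℕ} {lt : Word n → Word n → Prop} {I : Ideal (NCPoly k n)}
variable [I.IsTwoSided] [Setting lt I]

/-! ### Anick resolutions are isomorphic -/

variable {l m : ℕ}

/-- A linear map that lowers the terms of basis elements lowers all terms. -/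
lemma map_mem_fil_pred {G G' : Type*} {wd : G → Word n} {wd' : G' → Word n}
    (f : (G →₀ (NCPoly k n ⧸ I)) →ₗ[NCPoly k n ⧸ I] (G' →₀ (NCPoly k n ⧸ I)))
    (h : ∀ g, f (Finsupp.single g 1) ∈ fil lt I wd' (rank lt (wd g)))
    {y : G →₀ (NCPoly k n ⧸ I)} (hy : y ∈ fil lt I wd (m + 1)) :
    f y ∈ fil lt I wd' m := by
  have hle : fil lt I wd (m + 1) ≤ (fil lt I wd' m).comap (f.restrictScalars k) := by
    refine fil_le fun g t _ hr => ?_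
    change f (Finsupp.single g (mon I t)) ∈ fil lt I wd' m
    rw [single_mon_eq_smul, map_smul]
    exact fil_mono (Nat.le_of_lt_succ hr) (mon_smul_mem_fil_rank (h g))
  exact hle hy

variable (lt I) in
/-- The linear map differs from the identity by lower terms. -/
def IsUnitriangular (φ : FreeMod lt I l →ₗ[NCPoly k n ⧸ I] FreeMod lt I l) : Prop :=
  ∀ e, φ (Finsupp.single e 1) - Finsupp.single e 1 ∈ fil lt I Chain.word (rank lt e.word)

lemma IsUnitriangular.sub_mem {φ : FreeMod lt I l →ₗ[NCPoly k n ⧸ I] FreeMod lt I l}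
    (hφ : IsUnitriangular lt I φ) {x : FreeMod lt I l} (hx : x ∈ fil lt I Chain.word (m + 1)) :
    φ x - x ∈ fil lt I Chain.word m := by
  let δ : FreeMod lt I l →ₗ[NCPoly k n ⧸ I] FreeMod lt I l := φ - LinearMap.id
  have h : ∀ e : Chain lt I l, δ (Finsupp.single e 1) ∈
      fil lt I Chain.word (rank lt e.word) := hφ
  exact map_mem_fil_pred δ h hx

lemma IsUnitriangular.map_mem {φ : FreeMod lt I l →ₗ[NCPoly k n ⧸ I] FreeMod lt I l}
    (hφ : IsUnitriangular lt I φ) {x : FreeMod lt I l} (hx : x ∈ fil lt I Chain.word m) :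
    φ x ∈ fil lt I Chain.word m := by
  have h1 := Submodule.add_mem _ (hφ.sub_mem (fil_mono (Nat.le_succ m) hx)) hx
  rwa [sub_add_cancel] at h1

/-- The difference from the identity strictly lowers a filtration that is exhaustive and is zero at
index 0. -/
lemma IsUnitriangular.bijective {φ : FreeMod lt I l →ₗ[NCPoly k n ⧸ I] FreeMod lt I l}
    (hφ : IsUnitriangular lt I φ) : Function.Bijective φ := by
  refine ⟨(injective_iff_map_eq_zero φ).2 fun x hx => ?_, fun z => ?_⟩
  · obtain ⟨m, hm⟩ := exists_mem_fil (lt := lt) (wd := Chain.word) x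
    induction m with
    | zero => exact fil_zero hm
    | succ m ih =>
      have := hφ.sub_mem hm
      rw [hx, zero_sub, Submodule.neg_mem_iff] at this
      exact ih this
  · obtain ⟨m, hm⟩ := exists_mem_fil (lt := lt) (wd := Chain.word) z
    induction m generalizing z with
    | zero => exact ⟨0, by rw [map_zero, fil_zero hm]⟩
    | succ m ih =>
      have h1 := hφ.sub_mem hm
      rw [← Submodule.neg_mem_iff, neg_sub] at h1
      obtain ⟨y, hy⟩ := ih _ h1
      exact ⟨y + z, by rw [map_add, hy, sub_add_cancel]⟩

/-- The inductive step of the comparison of two complexes with leading terms. -/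
lemma exists_comparison_succ {d d' : Differential lt I} (hd : HasAnickLeadingTerms lt I d)
    (hdd : ∀ l y, d l y ∈ cycles lt I d l) (hd' : HasAnickLeadingTerms lt I d')
    {φ : FreeMod lt I l →ₗ[NCPoly k n ⧸ I] FreeMod lt I l} (hφ : IsUnitriangular lt I φ)
    (hc : ∀ x, φ (d' l x) ∈ cycles lt I d l) :
    ∃ ψ : FreeMod lt I (l + 1) →ₗ[NCPoly k n ⧸ I] FreeMod lt I (l + 1),
      IsUnitriangular lt I ψ ∧ ∀ x, d l (ψ x) = φ (d' l x) := by
  have key : ∀ e : Chain lt I (l + 1), ∃ y ∈ fil lt I Chain.word (rank lt e.word),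
      d l y = φ (d' l (Finsupp.single e 1)) - d l (Finsupp.single e 1) := by
    intro e
    -- Both differentials have the same leading term s·f, because the chain suffix of the word is
    -- unique, and φ fixes it modulo smaller words. So the defect is a cycle with smaller words, and
    -- its preimage can be chosen so too.
    refine hd.exists_preimage hdd (AddSubgroup.sub_mem _ (hc _) (hdd l _)) ?_
    obtain ⟨s, f, -, hsf, -⟩ := hasAnickLeadingTerms_iff.1 hd l e
    have h1 := hd.sub_mem_fil hsf
    have h2 := hφ.map_mem (hd'.sub_mem_fil hsf)
    have h3 : φ (Finsupp.single f (mon I s)) - Finsupp.single f (mon I s) ∈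
        fil lt I Chain.word (rank lt e.word) :=
      hφ.sub_mem (single_mon_mem_fil (hsf ▸ Nat.lt_succ_self _))
    rw [map_sub] at h2
    have h4 := Submodule.sub_mem _ (Submodule.add_mem _ h2 h3) h1
    convert h4 using 1
    abel
  choose y hy hdy using key
  refine ⟨Finsupp.linearCombination (NCPoly k n ⧸ I) fun e => Finsupp.single e 1 + y e, ?_, ?_⟩
  · intro e
    rw [Finsupp.linearCombination_single, one_smul, add_sub_cancel_left]
    exact hy e
  · intro x
    refine LinearMap.congr_fun (f := (d l).comp (Finsupp.linearCombination (NCPoly k n ⧸ I)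
      fun e => Finsupp.single e 1 + y e)) (g := φ.comp (d' l)) ?_ x
    refine Finsupp.lhom_ext' fun e => LinearMap.ext_ring ?_
    change d l (Finsupp.linearCombination _ _ (Finsupp.single e 1)) = φ (d' l (Finsupp.single e 1))
    rw [Finsupp.linearCombination_single, one_smul, map_add, hdy, add_sub_cancel]

/-- Two complexes with leading terms are isomorphic. -/
theorem exists_comparison {d d' : Differential lt I} (hd : HasAnickLeadingTerms lt I d)
    (hdd : ∀ l y, d l y ∈ cycles lt I d l) (hd' : HasAnickLeadingTerms lt I d')
    (hdd' : ∀ l y, d' l y ∈ cycles lt I d' l) :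
    ∃ φ : ∀ l, FreeMod lt I l ≃ₗ[NCPoly k n ⧸ I] FreeMod lt I l,
      φ 0 = LinearEquiv.refl _ _ ∧
      ∀ (l : ℕ) (x : FreeMod lt I (l + 1)), d l (φ (l + 1) x) = φ l (d' l x) := by
  -- The recursion carries, besides the map, unitriangularity and the fact that the next right-hand
  -- side is a cycle.
  let T : ℕ → Type _ := fun l =>
    {φ : FreeMod lt I l →ₗ[NCPoly k n ⧸ I] FreeMod lt I l //
      IsUnitriangular lt I φ ∧ ∀ x, φ (d' l x) ∈ cycles lt I d l}
  have base : IsUnitriangular lt I (LinearMap.id : FreeMod lt I 0 →ₗ[NCPoly k n ⧸ I] _) ∧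
      ∀ x, LinearMap.id (R := NCPoly k n ⧸ I) (d' 0 x) ∈ cycles lt I d 0 :=
    ⟨fun e => by rw [LinearMap.id_apply, sub_self]; exact Submodule.zero_mem _, fun x => hdd' 0 x⟩
  have step : ∀ l (φ : T l), ∃ ψ : T (l + 1), ∀ x, d l (ψ.1 x) = φ.1 (d' l x) := by
    intro l φ
    obtain ⟨ψ, h1, h2⟩ := exists_comparison_succ hd hdd hd' φ.2.1 φ.2.2
    refine ⟨⟨ψ, h1, fun x => ?_⟩, h2⟩
    rw [mem_cycles_succ, h2, mem_cycles_succ.1 (hdd' (l + 1) x), map_zero]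
  choose next hnext using step
  let Φ : ∀ l, T l := fun l => Nat.rec ⟨LinearMap.id, base⟩ next l
  refine ⟨fun l => LinearEquiv.ofBijective (Φ l).1 (Φ l).2.1.bijective, ?_, fun l x => ?_⟩
  · ext1
    rfl
  · exact hnext l (Φ l) x

lemma IsResolution.mem_cycles {d : Differential lt I} (hd : IsResolution lt I d) (l : ℕ)
    (y : FreeMod lt I (l + 1)) : d l y ∈ cycles lt I d l := by
  cases l with
  | zero => exact (hd.exact_zero _).2 ⟨y, rfl⟩
  | succ l => exact (hd.exact_succ l _).2 ⟨y, rfl⟩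

end Comparison

/-! ### Path sums modulo the augmentation ideal. -/

section Minimality

variable {k : Type*} [Field k] {n : ℕ} {lt : Word n → Word n → Prop} {I : Ideal (NCPoly k n)}
variable [I.IsTwoSided] [Setting lt I]

/-! ### Minimality -/

variable {l : ℕ}

/-- Modulo the augmentation ideal only inner faces of d count. An upper face has no path to f, a
lower face continues through its partner, which is a reduction of Type I, and a critical face would
be a reduction of Type II. -/
lemma counit_pathSum_eq_zero (hII : ¬ TypeIIPossible lt I) {e : Cell lt I}
    (he : IsFullyAttached lt I e.1) {d : Cell lt I}
    (hed : Relation.ReflTransGen (ReducesTypeI lt I) e d) (hd : ¬ IsLower d)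
    (f : Chain lt I l) (hl : d.entries.length = l + 1) :
    counit lt I (barPathSum lt I d f.cell) = 0 := by
  induction hp : potential d using WellFoundedLT.induction generalizing d with
  | _ m ih =>
    subst hp
    rw [pathSum_of_not_isLower hd, if_neg, zero_add, map_sum]
    · refine Finset.sum_eq_zero fun x hx => ?_
      rw [Finset.mem_filter, Finsupp.mem_support_iff, cellBoundary_apply] at hx
      have hxl := edge_length hx.1
      rw [map_mul]
      by_cases hm : MergesTo lt I d x
      · rcases isUpper_or_isLower_or_minChain x with h | h | h
        · rw [pathSum_eq_zero f.minChain x, map_zero, mul_zero]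
          refine Or.inr ⟨h.not_isLower, ?_, by rw [f.length_cell]; omega⟩
          rintro rfl
          exact minChain_not_isUpper f.minChain h
        · obtain ⟨d', hd'⟩ := h.exists_match
          rw [pathSum_of_isLower hd' f.minChain (by rw [f.length_cell]; omega), map_mul,
            ih _ ((potential_lt_of_match hd').trans (potential_lt_of_edge hx.1 hx.2))
              (hed.tail ⟨x, hm, hd'⟩) (isUpper_of_match hd').not_isLower ?_ rfl, mul_zero,
            mul_zero]
          have := edge_length (c := d') (x := x) ((isAcyclicMatching lt I).edge _ _ hd')
          omega
        · exact absurd ⟨e, d, x, he, hed, hm, (isFullyAttached_iff x).2 h⟩ hII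
      · rcases barWeight_of_not_mergesTo hm with h | ⟨w, hw, -, h⟩
        · rw [h, map_zero, zero_mul]
        · rw [h, counit_mon hw.2, zero_mul]
    · rintro rfl
      rw [f.length_cell] at hl
      omega

/-- **The Morse complex is minimal if no reduction of Type II is possible.** -/
theorem isMinimal_morseDifferential (hII : ¬ TypeIIPossible lt I) :
    IsMinimal lt I (morseDifferential lt I) := by
  intro l x f
  induction x using Finsupp.induction_linear with
  | zero =>
    rw [map_zero, Finsupp.zero_apply]
    exact Submodule.zero_mem _
  | add x y hx hy =>
    rw [map_add, Finsupp.add_apply]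
    exact Submodule.add_mem _ hx hy
  | single e a =>
    rw [morseDifferential_single, Finsupp.smul_apply]
    refine Submodule.smul_mem _ _ ?_
    rw [mem_augIdeal_iff (lt := lt),
      morseProj_apply _ (length_of_mem_support_cellBoundary e.length_cell)]
    have h := counit_pathSum_eq_zero (d := e.cell) hII e.2.1 Relation.ReflTransGen.refl
      (minChain_not_isLower e.minChain) f e.length_cell
    rw [pathSum_of_not_isLower (minChain_not_isLower e.minChain), if_neg, zero_add,
      Finset.filter_true_of_mem] at h
    · simpa only [cellBoundary_apply] using h
    · intro d _ hd
      exact minChain_not_isUpper e.minChain (isUpper_of_match hd)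
    · intro he
      have := f.length_cell
      rw [← he, e.length_cell] at this
      omega

end Minimality

end AnickMorse

end

theorem theorem4p3 {k : Type*} [Field k] (n : ℕ)
    (lt : AnickMorse.Word n → AnickMorse.Word n → Prop)
    (hlt : AnickMorse.IsDegreeMonomialOrder lt)
    (I : Ideal (AnickMorse.NCPoly k n)) [I.IsTwoSided]
    (S : Finset (AnickMorse.NCPoly k n))
    (hS : AnickMorse.IsReducedGroebnerBasis lt I S)
    (hI : ∀ p ∈ I, p.coeff 1 = 0) :
    -- the matching on the normalized bar resolution is acyclic,
    AnickMorse.IsAcyclicMatching (AnickMorse.barWeight lt I) (AnickMorse.barMatching lt I) ∧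
    -- its critical cells are the fully attached tuples,
    (∀ c : AnickMorse.Cell lt I, AnickMorse.IsCritical (AnickMorse.barMatching lt I) c ↔
      AnickMorse.IsFullyAttached lt I c.1) ∧
    -- the path sums that define the Morse differential are finite,
    (∀ (l : ℕ) (e : AnickMorse.Chain lt I (l + 1)),
      {p : List (AnickMorse.Cell lt I) | ∃ f : AnickMorse.Chain lt I l,
        AnickMorse.IsPath (AnickMorse.barWeight lt I) (AnickMorse.barMatching lt I)
          e.1 f.1 p}.Finite) ∧
    -- `A / ⟨x_1, …, x_n⟩` is the field `k`,
    Function.Bijective (fun a : k => (Submodule.Quotient.mk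
      (algebraMap k (AnickMorse.NCPoly k n ⧸ I) a) :
        (AnickMorse.NCPoly k n ⧸ I) ⧸ AnickMorse.augIdeal I)) ∧
    -- the Morse complex is a free resolution of it,
    AnickMorse.IsResolution lt I (AnickMorse.morseDifferential lt I) ∧
    -- it is an Anick resolution, and isomorphic to every Anick resolution,
    AnickMorse.HasAnickLeadingTerms lt I (AnickMorse.morseDifferential lt I) ∧
    (∀ d : AnickMorse.Differential lt I, AnickMorse.IsAnickResolution lt I d →
      ∃ φ : ∀ l : ℕ, AnickMorse.FreeMod lt I l ≃ₗ[AnickMorse.NCPoly k n ⧸ I]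
          AnickMorse.FreeMod lt I l,
        φ 0 = LinearEquiv.refl _ _ ∧
        ∀ (l : ℕ) (x : AnickMorse.FreeMod lt I (l + 1)),
          d l (φ (l + 1) x) = φ l (AnickMorse.morseDifferential lt I l x)) ∧
    -- and it is minimal if no reduction of Type II is possible.
    (¬ AnickMorse.TypeIIPossible lt I →
      AnickMorse.IsMinimal lt I (AnickMorse.morseDifferential lt I)) := by
  have : AnickMorse.Setting lt I := ⟨hlt, hI⟩
  refine ⟨AnickMorse.isAcyclicMatching lt I, AnickMorse.isCritical_iff,
    fun l e => ?_, AnickMorse.bijective_algebraMap_quotient lt I,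
    AnickMorse.isResolution_morseDifferential, AnickMorse.hasAnickLeadingTerms_morseDifferential,
    fun d hd => ?_, AnickMorse.isMinimal_morseDifferential⟩
  · refine (AnickMorse.finite_paths_from e.cell).subset ?_
    rintro p ⟨f, hp⟩
    exact ⟨hp.1, hp.2.1⟩
  · exact AnickMorse.exists_comparison hd.leading hd.resolution.mem_cycles
      AnickMorse.hasAnickLeadingTerms_morseDifferential AnickMorse.morseDifferential_mem_cycles
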